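/- Let $N\ge 3$, $0<\mu<N$, let $\Omega\subset\mathbb R^N$ be a bounded open set, and put $2^*=\frac{2N}{N-2}$, $2^*_\mu=\frac{2N-\mu}{N-2}$. Let $$S_{H,L}=\inf\Big\{\int_{\mathbb R^N}|\nabla u|^2dx:\ u\in D^{1,2}(\mathbb R^N),\ \int_{\mathbb R^N}\int_{\mathbb R^N}\frac{|u(x)|^{2^*_\mu}|u(y)|^{2^*_\mu}}{|x-y|^\mu}\,dx\,dy=1\Big\},$$ where $D^{1,2}(\mathbb R^N)=\{u\in L^{2^*}(\mathbb R^N):\nabla u\in L^2(\mathbb R^N,\mathbb R^N)\}$, and let $$\lambda_1=\inf\Big\{\int_\Omega|\nabla u|^2dx:\ u\in H^1_0(\Omega),\ \int_\Omega|u|^2dx=1\Big\}.$$ For $\lambda\in(0,\lambda_1)$ and $q\in[2,2^*)$ let $J_\lambda:H^1_0(\Omega)\to\mathbb R$ be $$J_\lambda(u)=\frac12\int_\Omega|\nabla u|^2dx-\frac\lambda q\int_\Omega|u|^qdx-\frac1{2\cdot2^*_\mu}\int_\Omega\int_\Omega\frac{|u(x)|^{2^*_\mu}|u(y)|^{2^*_\mu}}{|x-y|^\mu}\,dy\,dx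 .$$ Then $J_\lambda\in C^1(H^1_0(\Omega),\mathbb R)$, and for every real $c<\frac{N-\mu+2}{2(2N-\mu)}\,S_{H,L}^{\frac{2N-\mu}{N-\mu+2}}$ the following hold. (a) $J_\lambda$ satisfies the Palais–Smale condition at level $c$: every sequence $(u_n)$ in $H^1_0(\Omega)$ with $J_\lambda(u_n)\to c$ and $J_\lambda'(u_n)\to0$ in the dual of $H^1_0(\Omega)$ has a subsequence that converges in the norm of $H^1_0(\Omega)$. (b) $J_\lambda$ constrained to the Nehari manifold $\mathcal N_\lambda=\{u\in H^1_0(\Omega)\setminus\{0\}:\langle J_\lambda'(u),u\rangle=0\}$ satisfies the Palais–Smale condition at level $c$: with $$T_\lambda(u)=\int_\Omega|\nabla u|^2dx-\lambda\int_\Omega|u|^qdx-\int_\Omega\int_\Omega\frac{|u(x)|^{2^*_\mu}|u(y)|^{2^*_\mu}}{|x-y|^\mu}\,dy\,dx,$$ every sequence $(u_n)$ in $\mathcal N_\lambda$ such that $J_\lambda(u_n)\to c$ and, for some real numbers $\alpha_n$, $J_\lambda'(u_n)-\alpha_nT_\lambda'(u_n)\to0$ in the dual of $H^1_0(\Omega)$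 has a subsequence that converges in the norm of $H^1_0(\Omega)$ to an element of $\mathcal N_\lambda$. -/

import Mathlib

open MeasureTheory Filter Topology
open scoped ContDiff Gradient

/-- Euclidean space `ℝ^N`. -/
abbrev RN (N : ℕ) : Type := EuclideanSpace ℝ (Fin N)

/-- `φ ∈ C_c^∞(Ω)`: a smooth function on `ℝ^N` whose support is a compact subset of `Ω`. -/
def IsTestFunction {N : ℕ} (Ω : Set (RN N)) (φ : RN N → ℝ) : Prop :=
  ContDiff ℝ ∞ φ ∧ HasCompactSupport φ ∧ tsupport φ ⊆ Ω

/-- `g` is the weak (distributional) gradient of `u` on `ℝ^N`. -/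
def HasWeakGradient {N : ℕ} (u : RN N → ℝ) (g : RN N → RN N) : Prop :=
  ∀ φ : RN N → ℝ, IsTestFunction Set.univ φ → (∫ x, u x • ∇ φ x) = -(∫ x, φ x • g x)

/-- The Hilbert space `L²(Ω) × L²(Ω; ℝ^N)` of pairs (function, gradient), with
`‖(f, g)‖² = ‖f‖² + ‖g‖²`; on pairs `(u, ∇u)` this is the norm of `H¹(Ω)`. -/
abbrev L2Pair {N : ℕ} (Ω : Set (RN N)) : Type :=
  WithLp 2 (Lp ℝ 2 (volume.restrict Ω) × Lp (RN N) 2 (volume.restrict Ω))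

/-- The space `C_c^∞(Ω)`, realized as the set of pairs `(φ, ∇φ)`. -/
def testPairs {N : ℕ} (Ω : Set (RN N)) : Submodule ℝ (L2Pair Ω) where
  carrier := {v | ∃ φ : RN N → ℝ, IsTestFunction Ω φ ∧
    v.fst =ᵐ[volume.restrict Ω] φ ∧ v.snd =ᵐ[volume.restrict Ω] ∇ φ}
  zero_mem' := by
    refine ⟨fun _ => 0, ⟨contDiff_const, HasCompactSupport.zero, ?_⟩, ?_, ?_⟩
    · simp [tsupport]
    · exact Lp.coeFn_zero _ _ _
    · filter_upwards [Lp.coeFn_zero (RN N) 2 (volume.restrict Ω)] with x hx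
      simpa [gradient] using hx
  add_mem' := by
    rintro v w ⟨φ, ⟨hφ, hφc, hφs⟩, hv1, hv2⟩ ⟨ψ, ⟨hψ, hψc, hψs⟩, hw1, hw2⟩
    refine ⟨φ + ψ, ⟨hφ.add hψ, hφc.add hψc, ?_⟩, ?_, ?_⟩
    · exact (tsupport_add φ ψ).trans (Set.union_subset hφs hψs)
    · exact (Lp.coeFn_add v.fst w.fst).trans (hv1.add hw1)
    · filter_upwards [Lp.coeFn_add v.snd w.snd, hv2, hw2] with x h h1 h2
      have e : fderiv ℝ (φ + ψ) x = fderiv ℝ φ x + fderiv ℝ ψ x :=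
        fderiv_add ((hφ.differentiable (by simp)) x) ((hψ.differentiable (by simp)) x)
      have : (v + w).snd = v.snd + w.snd := rfl
      rw [this, h, Pi.add_apply, h1, h2, gradient, gradient, gradient, e, map_add]
  smul_mem' := by
    rintro c v ⟨φ, ⟨hφ, hφc, hφs⟩, hv1, hv2⟩
    refine ⟨c • φ, ⟨hφ.const_smul c, hφc.smul_left (f := fun _ => c), ?_⟩, ?_, ?_⟩
    · exact (tsupport_smul_subset_right (fun _ => c) φ).trans hφs
    · exact (Lp.coeFn_smul c v.fst).trans (hv1.const_smul c)
    · filter_upwards [Lp.coeFn_smul c v.snd, hv2] with x h h1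
      have e : fderiv ℝ (c • φ) x = c • fderiv ℝ φ x :=
        fderiv_const_smul ((hφ.differentiable (by simp)) x) c
      have : (c • v).snd = c • v.snd := rfl
      rw [this, h, Pi.smul_apply, h1, gradient, gradient, e]
      simp

/-- The Sobolev space `H₀¹(Ω)`: the closure of `C_c^∞(Ω)` in the norm of `H¹(Ω)`. An element
is carried by the pair consisting of the function and its weak gradient. -/
abbrev H01 {N : ℕ} (Ω : Set (RN N)) : Type := (testPairs Ω).topologicalClosure

/-- The function underlying an element of `H₀¹(Ω)`. -/
noncomputable def H01.fn {N : ℕ} {Ω : Set (RN N)} (u : H01 Ω) : RN N → ℝ :=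
  (u : L2Pair Ω).fst

/-- The weak gradient `∇u` of an element of `H₀¹(Ω)`. -/
noncomputable def H01.grad {N : ℕ} {Ω : Set (RN N)} (u : H01 Ω) : RN N → RN N :=
  (u : L2Pair Ω).snd

/-- The critical Sobolev exponent `2^* = 2N/(N-2)`. -/
noncomputable def sobolevExp (N : ℕ) : ℝ := 2 * (N : ℝ) / ((N : ℝ) - 2)

/-- The critical Hardy–Littlewood–Sobolev exponent `2^*_μ = (2N-μ)/(N-2)`. -/
noncomputable def hlsExp (N : ℕ) (μ : ℝ) : ℝ := (2 * (N : ℝ) - μ) / ((N : ℝ) - 2)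

/-- The double integral `∫_A ∫_A |u(x)|^{2^*_μ} |u(y)|^{2^*_μ} / |x-y|^μ dy dx`. -/
noncomputable def choquard {N : ℕ} (μ : ℝ) (A : Set (RN N)) (u : RN N → ℝ) : ℝ :=
  ∫ x in A, ∫ y in A, |u x| ^ hlsExp N μ * |u y| ^ hlsExp N μ / ‖x - y‖ ^ μ

/-- `S_{H,L}`: the infimum of `∫ |∇u|²` over all `u ∈ D^{1,2}(ℝ^N)` (that is, `u ∈ L^{2^*}` with
weak gradient `g = ∇u ∈ L²`) whose double integral over `ℝ^N × ℝ^N` equals `1`. -/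
noncomputable def SHL (N : ℕ) (μ : ℝ) : ℝ :=
  sInf {t : ℝ | ∃ (u : RN N → ℝ) (g : RN N → RN N),
    MemLp u (ENNReal.ofReal (sobolevExp N)) volume ∧ MemLp g 2 volume ∧ HasWeakGradient u g ∧
    choquard μ Set.univ u = 1 ∧ t = ∫ x, ‖g x‖ ^ 2}

/-- `λ₁`, the first eigenvalue of `-Δ` on `Ω` with zero Dirichlet boundary data, as the infimum
of `∫_Ω |∇u|²` over `u ∈ H₀¹(Ω)` with `∫_Ω |u|² = 1`. -/
noncomputable def firstEigenvalue {N : ℕ} (Ω : Set (RN N)) : ℝ :=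
  sInf {t : ℝ | ∃ u : H01 Ω, (∫ x in Ω, |u.fn x| ^ 2) = 1 ∧ t = ∫ x in Ω, ‖u.grad x‖ ^ 2}

/-- The energy functional `J_λ : H₀¹(Ω) → ℝ`. -/
noncomputable def energy {N : ℕ} (Ω : Set (RN N)) (μ lam q : ℝ) (u : H01 Ω) : ℝ :=
  1 / 2 * (∫ x in Ω, ‖u.grad x‖ ^ 2)
    - lam / q * (∫ x in Ω, |u.fn x| ^ q)
    - 1 / (2 * hlsExp N μ) * choquard μ Ω u.fn

/-- The Nehari manifold of `J_λ`: all `u ≠ 0` with `⟨J_λ'(u), u⟩ = 0`. -/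
def nehari {N : ℕ} (Ω : Set (RN N)) (μ lam q : ℝ) : Set (H01 Ω) :=
  {u | u ≠ 0 ∧ fderiv ℝ (energy Ω μ lam q) u u = 0}

/-- The functional `T_λ(u) = ‖∇u‖² - λ ∫ |u|^q - ∫∫ …` that cuts out the Nehari manifold. -/
noncomputable def nehariFunctional {N : ℕ} (Ω : Set (RN N)) (μ lam q : ℝ) (u : H01 Ω) : ℝ :=
  (∫ x in Ω, ‖u.grad x‖ ^ 2) - lam * (∫ x in Ω, |u.fn x| ^ q) - choquard μ Ω u.fn

/-- The Palais–Smale condition of a functional `F` at level `c`: every sequence with `F(u_n) → c`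
and `F'(u_n) → 0` in the dual space has a (norm-)convergent subsequence. -/
def PalaisSmale {X : Type*} [NormedAddCommGroup X] [NormedSpace ℝ X] (F : X → ℝ) (c : ℝ) : Prop :=
  ∀ u : ℕ → X, Tendsto (fun n => F (u n)) atTop (𝓝 c) →
    Tendsto (fun n => fderiv ℝ F (u n)) atTop (𝓝 0) →
    ∃ (u₀ : X) (k : ℕ → ℕ), StrictMono k ∧ Tendsto (fun n => u (k n)) atTop (𝓝 u₀)

/-- The Palais–Smale condition at level `c` of a functional `F` constrained to a set `M` cut out
by a functional `T`: every sequence in `M` with `F(u_n) → c` and `F'(u_n) - α_n T'(u_n) → 0` in the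
dual space for some real multipliers `α_n` has a subsequence that converges in `M`. -/
def ConstrainedPalaisSmale {X : Type*} [NormedAddCommGroup X] [NormedSpace ℝ X]
    (F T : X → ℝ) (M : Set X) (c : ℝ) : Prop :=
  ∀ u : ℕ → X, (∀ n, u n ∈ M) → Tendsto (fun n => F (u n)) atTop (𝓝 c) →
    (∃ α : ℕ → ℝ, Tendsto (fun n => fderiv ℝ F (u n) - α n • fderiv ℝ T (u n)) atTop (𝓝 0)) →
    ∃ u₀ ∈ M, ∃ k : ℕ → ℕ, StrictMono k ∧ Tendsto (fun n => u (k n)) atTop (𝓝 u₀)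

/-- The signed power `sign t * |t| ^ r`. -/
noncomputable def spow (r t : ℝ) : ℝ := (max t 0) ^ r - (max (-t) 0) ^ r

theorem continuous_spow {r : ℝ} (hr : 0 < r) : Continuous (spow r) := by
  unfold spow
  exact ((continuous_id.max continuous_const).rpow_const fun _ => Or.inr hr.le).sub
    ((continuous_neg.max continuous_const).rpow_const fun _ => Or.inr hr.le)

theorem spow_of_nonneg {r t : ℝ} (hr : 0 < r) (ht : 0 ≤ t) : spow r t = t ^ r := by
  simp [spow, ht, Real.zero_rpow hr.ne']

theorem spow_of_nonpos {r t : ℝ} (hr : 0 < r) (ht : t ≤ 0) : spow r t = -(-t) ^ r := by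
  simp [spow, ht, Real.zero_rpow hr.ne']

theorem abs_spow {r : ℝ} (hr : 0 < r) (t : ℝ) : |spow r t| = |t| ^ r := by
  rcases le_total 0 t with ht | ht
  · rw [spow_of_nonneg hr ht, abs_of_nonneg ht, abs_of_nonneg (by positivity)]
  · rw [spow_of_nonpos hr ht, abs_of_nonpos ht, abs_neg,
      abs_of_nonneg (Real.rpow_nonneg (by linarith) _)]

theorem spow_mul_self {r : ℝ} (hr : 0 < r) (t : ℝ) : spow r t * t = |t| ^ (r + 1) := by
  rcases le_total 0 t with ht | ht
  · rw [spow_of_nonneg hr ht, abs_of_nonneg ht, Real.rpow_add_one' ht (by linarith)]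
  · rw [spow_of_nonpos hr ht, abs_of_nonpos ht,
      Real.rpow_add_one' (by linarith) (by linarith)]
    ring

theorem spow_mul {r c : ℝ} (hc : 0 ≤ c) (t : ℝ) : spow r (c * t) = c ^ r * spow r t := by
  have h1 : max (c * t) 0 = c * max t 0 := by rw [mul_max_of_nonneg _ _ hc, mul_zero]
  have h2 : max (-(c * t)) 0 = c * max (-t) 0 := by
    rw [mul_max_of_nonneg _ _ hc, mul_zero, mul_neg]
  rw [spow, spow, h1, h2, Real.mul_rpow hc (le_max_right _ _),
    Real.mul_rpow hc (le_max_right _ _)]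
  ring

/-- The tangent line inequality for the convex function `|t| ^ p`. -/
theorem mul_spow_mul_sub_le {p : ℝ} (hp : 1 < p) (a b : ℝ) :
    p * (spow (p - 1) a * (b - a)) ≤ |b| ^ p - |a| ^ p := by
  have hp0 : 0 < p := by linarith
  have h1 : spow (p - 1) a * a = |a| ^ p := by
    rw [spow_mul_self (by linarith)]; simp
  have h2 : spow (p - 1) a * b ≤ |a| ^ (p - 1) * |b| := by
    calc _ ≤ |spow (p - 1) a * b| := le_abs_self _
      _ = _ := by rw [abs_mul, abs_spow (by linarith)]
  have hc : p.HolderConjugate (Real.conjExponent p) := Real.HolderConjugate.conjExponent hp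
  have h3 := Real.young_inequality_of_nonneg (a := |a| ^ (p - 1)) (b := |b|) (by positivity)
    (abs_nonneg _) hc.symm
  rw [← Real.rpow_mul (abs_nonneg _), hc.sub_one_mul_conj] at h3
  have h4 : 1 / Real.conjExponent p = 1 - 1 / p := by
    rw [one_div, one_div, ← hc.one_sub_inv]
  have h5 : |a| ^ p / Real.conjExponent p = |a| ^ p * (1 - 1 / p) := by
    rw [← h4]; ring
  rw [h5] at h3
  have h6 : p * (|a| ^ p * (1 - 1 / p) + |b| ^ p / p) = (p - 1) * |a| ^ p + |b| ^ p := by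
    field_simp
  have h7 := mul_le_mul_of_nonneg_left (h2.trans h3) hp0.le
  rw [h6] at h7
  rw [mul_sub, h1]
  nlinarith

/-- A continuous function on the plane that is positively homogeneous of degree `r` and vanishes
on the first axis is small compared with `|s| ^ r`, up to a multiple of `|b| ^ r`. -/
theorem abs_le_of_homogeneous {r : ℝ} {h : ℝ → ℝ → ℝ}
    (hc : Continuous (fun z : ℝ × ℝ => h z.1 z.2))
    (hh : ∀ t s b : ℝ, 0 < t → h (t * s) (t * b) = t ^ r * h s b)
    (h1 : h 1 0 = 0) (h2 : h (-1) 0 = 0) (h0 : h 0 0 = 0) {ε : ℝ} (hε : 0 < ε) :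
    ∃ C : ℝ, 0 ≤ C ∧ ∀ s b : ℝ, |h s b| ≤ ε * |s| ^ r + C * |b| ^ r := by
  have e1 : ∀ᶠ b in 𝓝 (0 : ℝ), |h 1 b| < ε := by
    have : Tendsto (fun b : ℝ => |h 1 b|) (𝓝 0) (𝓝 |h 1 0|) :=
      ((hc.comp (by fun_prop : Continuous fun b : ℝ => ((1 : ℝ), b))).abs).tendsto 0
    rw [h1, abs_zero] at this
    exact this.eventually_lt_const hε
  have e2 : ∀ᶠ b in 𝓝 (0 : ℝ), |h (-1) b| < ε := by
    have : Tendsto (fun b : ℝ => |h (-1) b|) (𝓝 0) (𝓝 |h (-1) 0|) :=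
      ((hc.comp (by fun_prop : Continuous fun b : ℝ => ((-1 : ℝ), b))).abs).tendsto 0
    rw [h2, abs_zero] at this
    exact this.eventually_lt_const hε
  obtain ⟨δ, hδ, hball⟩ := Metric.eventually_nhds_iff.1 (e1.and e2)
  have hK : IsCompact (Set.Icc (-(1 / δ)) (1 / δ) ×ˢ Set.Icc (-1 : ℝ) 1) :=
    isCompact_Icc.prod isCompact_Icc
  obtain ⟨C, hC⟩ := hK.exists_bound_of_continuousOn hc.continuousOn
  refine ⟨max C 0, le_max_right _ _, fun s b => ?_⟩
  have hs : 0 ≤ |s| ^ r := by positivity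
  have hb : 0 ≤ |b| ^ r := by positivity
  have hC0 : 0 ≤ max C 0 := le_max_right _ _
  by_cases hcase : |b| < δ * |s|
  · have hspos : 0 < |s| := by
      by_contra hcon
      have : |s| = 0 := le_antisymm (not_lt.1 hcon) (abs_nonneg _)
      rw [this] at hcase
      have := abs_nonneg b
      linarith
    have key : |h (s / |s|) (b / |s|)| < ε := by
      have hd : dist (b / |s|) 0 < δ := by
        rw [Real.dist_eq, sub_zero, abs_div, abs_abs, div_lt_iff₀ hspos]; exact hcase
      rcases abs_choice s with e | e
      · have : s / |s| = 1 := by rw [e, div_self]; rw [← e]; exact hspos.ne'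
        rw [this]; exact (hball hd).1
      · have : s / |s| = -1 := by
          rw [e, div_neg, div_self]; intro h; simp [h] at hspos
        rw [this]; exact (hball hd).2
    have := hh |s| (s / |s|) (b / |s|) hspos
    rw [mul_div_cancel₀ _ hspos.ne', mul_div_cancel₀ _ hspos.ne'] at this
    rw [this, abs_mul, abs_of_nonneg hs]
    nlinarith
  · push Not at hcase
    by_cases hb0 : b = 0
    · have hs0 : s = 0 := by
        rw [hb0, abs_zero] at hcase
        have : |s| ≤ 0 := by
          by_contra hcon; push Not at hcon; nlinarith [mul_pos hδ hcon]
        exact abs_eq_zero.1 (le_antisymm this (abs_nonneg _))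
      rw [hb0, hs0, h0, abs_zero]; positivity
    · have hbpos : 0 < |b| := abs_pos.2 hb0
      have key : |h (s / |b|) (b / |b|)| ≤ C := by
        refine hC (s / |b|, b / |b|) ⟨?_, ?_⟩
        · rw [Set.mem_Icc, ← abs_le, abs_div, abs_abs, div_le_div_iff₀ hbpos hδ]
          linarith
        · rw [Set.mem_Icc, ← abs_le, abs_div, abs_abs, div_self hbpos.ne']
      have := hh |b| (s / |b|) (b / |b|) hbpos
      rw [mul_div_cancel₀ _ hbpos.ne', mul_div_cancel₀ _ hbpos.ne'] at this
      rw [this, abs_mul, abs_of_nonneg hb]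
      nlinarith [le_max_left C 0]

section PowerFunctional

variable {α : Type*} [MeasurableSpace α] {M : Measure α}

instance fact_one_le_ofReal {p : ℝ} [hp : Fact (1 < p)] : Fact (1 ≤ ENNReal.ofReal p) :=
  ⟨by simpa using hp.out.le⟩

instance fact_one_lt_conjExponent {p : ℝ} [hp : Fact (1 < p)] : Fact (1 < p.conjExponent) :=
  ⟨(Real.HolderConjugate.conjExponent hp.out).symm.lt⟩

instance holderConjugate_ofReal {p : ℝ} [hp : Fact (1 < p)] :
    ENNReal.HolderConjugate (ENNReal.ofReal p.conjExponent) (ENNReal.ofReal p) where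
  inv_add_inv_eq_inv := by
    rw [(Real.HolderConjugate.conjExponent hp.out).symm.inv_add_inv_ennreal, inv_one]

theorem memLp_ofReal_iff {p : ℝ} (hp : 0 < p) {f : α → ℝ} (hf : AEStronglyMeasurable f M) :
    MemLp f (ENNReal.ofReal p) M ↔ Integrable (fun x => |f x| ^ p) M := by
  have := integrable_norm_rpow_iff (p := ENNReal.ofReal p) hf (by simpa using hp) (by simp)
  rw [ENNReal.toReal_ofReal hp.le] at this
  exact this.symm

theorem integrable_abs_rpow {p : ℝ} (hp : 0 < p) (F : Lp ℝ (ENNReal.ofReal p) M) :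
    Integrable (fun x => |F x| ^ p) M :=
  (memLp_ofReal_iff hp (Lp.aestronglyMeasurable F)).1 (Lp.memLp F)

theorem norm_rpow_eq_integral {p : ℝ} (hp : 0 < p) (F : Lp ℝ (ENNReal.ofReal p) M) :
    ‖F‖ ^ p = ∫ x, |F x| ^ p ∂M := by
  rw [Lp.norm_def, (Lp.memLp F).eLpNorm_eq_integral_rpow_norm (by simpa using hp) (by simp),
    ENNReal.toReal_ofReal hp.le, ENNReal.toReal_ofReal (by positivity),
    ← Real.rpow_mul (integral_nonneg fun x => by positivity), inv_mul_cancel₀ hp.ne',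
    Real.rpow_one]
  rfl

theorem MeasureTheory.MemLp.spow {p : ℝ} (hp : 1 < p) {f : α → ℝ}
    (hf : MemLp f (ENNReal.ofReal p) M) :
    MemLp (fun x => spow (p - 1) (f x)) (ENNReal.ofReal p.conjExponent) M := by
  have hc : p.HolderConjugate (Real.conjExponent p) := Real.HolderConjugate.conjExponent hp
  refine (memLp_ofReal_iff hc.symm.pos
    ((continuous_spow (by linarith)).comp_aestronglyMeasurable hf.1)).2 ?_
  refine ((memLp_ofReal_iff hc.pos hf.1).1 hf).congr (.of_forall fun x => ?_)
  simp only
  rw [abs_spow (by linarith), ← Real.rpow_mul (abs_nonneg _), hc.sub_one_mul_conj]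

/-- The superposition operator `F ↦ sign F * |F| ^ (p - 1)` from `L^p` to the dual exponent. -/
noncomputable def lpSpow {p : ℝ} [hp : Fact (1 < p)] (F : Lp ℝ (ENNReal.ofReal p) M) :
    Lp ℝ (ENNReal.ofReal p.conjExponent) M :=
  ((Lp.memLp F).spow hp.out).toLp _

theorem coeFn_lpSpow {p : ℝ} [hp : Fact (1 < p)] (F : Lp ℝ (ENNReal.ofReal p) M) :
    lpSpow F =ᵐ[M] fun x => spow (p - 1) (F x) :=
  MemLp.coeFn_toLp _

/-- The duality pairing between `L^{p'}` and `L^p`. -/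
noncomputable def dualPairing (p : ℝ) [Fact (1 < p)] (M : Measure α) :
    Lp ℝ (ENNReal.ofReal p.conjExponent) M →L[ℝ] Lp ℝ (ENNReal.ofReal p) M →L[ℝ] ℝ :=
  (ContinuousLinearMap.mul ℝ ℝ).lpPairing M (ENNReal.ofReal p.conjExponent) (ENNReal.ofReal p)

theorem dualPairing_lpSpow {p : ℝ} [hp : Fact (1 < p)] (F G : Lp ℝ (ENNReal.ofReal p) M) :
    dualPairing p M (lpSpow F) G = ∫ x, spow (p - 1) (F x) * G x ∂M := by
  rw [dualPairing, ContinuousLinearMap.lpPairing_eq_integral]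
  refine integral_congr_ae ?_
  filter_upwards [coeFn_lpSpow F] with x hx
  simp [hx]

theorem integrable_spow_mul {p : ℝ} [hp : Fact (1 < p)] (F G : Lp ℝ (ENNReal.ofReal p) M) :
    Integrable (fun x => spow (p - 1) (F x) * G x) M :=
  ((Lp.memLp F).spow hp.out).integrable_mul (Lp.memLp G)

theorem dualPairing_lpSpow_self {p : ℝ} [hp : Fact (1 < p)] (F : Lp ℝ (ENNReal.ofReal p) M) :
    dualPairing p M (lpSpow F) F = ‖F‖ ^ p := by
  rw [dualPairing_lpSpow, norm_rpow_eq_integral (by linarith [hp.out])]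
  refine integral_congr_ae (.of_forall fun x => ?_)
  simp only
  rw [spow_mul_self (by linarith [hp.out])]; simp

theorem dualPairing_le {p : ℝ} [hp : Fact (1 < p)] (F G : Lp ℝ (ENNReal.ofReal p) M) :
    p * dualPairing p M (lpSpow F) (G - F) ≤ ‖G‖ ^ p - ‖F‖ ^ p := by
  have hp0 : 0 < p := by linarith [hp.out]
  rw [dualPairing_lpSpow, norm_rpow_eq_integral hp0, norm_rpow_eq_integral hp0,
    ← integral_sub (integrable_abs_rpow hp0 _) (integrable_abs_rpow hp0 _),
    ← integral_const_mul]
  refine integral_mono_ae ((integrable_spow_mul F (G - F)).const_mul p)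
    ((integrable_abs_rpow hp0 _).sub (integrable_abs_rpow hp0 _)) ?_
  filter_upwards [Lp.coeFn_sub G F] with x hx
  simp only [hx, Pi.sub_apply]
  exact mul_spow_mul_sub_le hp.out _ _

theorem norm_lpSpow {p : ℝ} [hp : Fact (1 < p)] (F : Lp ℝ (ENNReal.ofReal p) M) :
    ‖lpSpow F‖ = ‖F‖ ^ (p - 1) := by
  have hc : p.HolderConjugate (Real.conjExponent p) := Real.HolderConjugate.conjExponent hp.out
  have h1 : ‖lpSpow F‖ ^ p.conjExponent = ‖F‖ ^ p := by
    rw [norm_rpow_eq_integral hc.symm.pos, norm_rpow_eq_integral hc.pos]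
    refine integral_congr_ae ?_
    filter_upwards [coeFn_lpSpow F] with x hx
    rw [hx, abs_spow (by linarith [hp.out]), ← Real.rpow_mul (abs_nonneg _), hc.sub_one_mul_conj]
  rw [← Real.rpow_left_inj (norm_nonneg _) (by positivity) hc.symm.ne_zero, h1,
    ← Real.rpow_mul (norm_nonneg _), hc.sub_one_mul_conj]

theorem continuous_lpSpow {p : ℝ} [hp : Fact (1 < p)] :
    Continuous (lpSpow : Lp ℝ (ENNReal.ofReal p) M → _) := by
  have hp1 : 0 < p - 1 := by linarith [hp.out]
  rw [continuous_iff_continuousAt]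
  intro F
  rw [ContinuousAt, tendsto_iff_norm_sub_tendsto_zero]
  have key : ∀ ε > 0, ∃ C : ℝ, 0 ≤ C ∧ ∀ G : Lp ℝ (ENNReal.ofReal p) M,
      ‖lpSpow G - lpSpow F‖ ≤ ε * ‖F‖ ^ (p - 1) + C * ‖G - F‖ ^ (p - 1) := by
    intro ε hε
    obtain ⟨C, hC0, hC⟩ := abs_le_of_homogeneous (r := p - 1)
      (h := fun s b => spow (p - 1) (s + b) - spow (p - 1) s)
      (((continuous_spow hp1).comp (continuous_fst.add continuous_snd)).sub
        ((continuous_spow hp1).comp continuous_fst))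
      (fun t s b ht => by
        simp only [← mul_add]; rw [spow_mul ht.le, spow_mul ht.le]; ring) (by simp) (by simp)
        (by simp) hε
    refine ⟨C, hC0, fun G => ?_⟩
    rw [← norm_lpSpow F, ← norm_lpSpow (G - F), ← Real.norm_of_nonneg hε.le,
      ← Real.norm_of_nonneg hC0, ← norm_smul, ← norm_smul, ← norm_abs_eq_norm (ε • lpSpow F),
      ← norm_abs_eq_norm (C • lpSpow (G - F))]
    refine le_trans ?_ (norm_add_le _ _)
    refine Lp.norm_le_norm_of_ae_le ?_
    filter_upwards [Lp.coeFn_sub (lpSpow G) (lpSpow F), coeFn_lpSpow G, coeFn_lpSpow F,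
      coeFn_lpSpow (G - F), Lp.coeFn_sub G F,
      Lp.coeFn_add |ε • lpSpow F| |C • lpSpow (G - F)|, Lp.coeFn_abs (ε • lpSpow F),
      Lp.coeFn_abs (C • lpSpow (G - F)), Lp.coeFn_smul ε (lpSpow F),
      Lp.coeFn_smul C (lpSpow (G - F))] with x a1 a2 a3 a4 a5 a6 a7 a8 a9 a10
    rw [a1, a6]
    simp only [Pi.sub_apply, Pi.add_apply, a2, a3, a4, a7, a8, a9, a10, Pi.smul_apply,
      smul_eq_mul, abs_mul, abs_spow hp1, a5, Real.norm_eq_abs, abs_of_nonneg hC0,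
      abs_of_pos hε]
    have := hC (F x) (G x - F x)
    rw [add_sub_cancel] at this
    exact this.trans (le_abs_self _)
  rw [Metric.tendsto_nhds]
  intro η hη
  obtain ⟨C, hC0, hC⟩ := key (η / 2 / (‖F‖ ^ (p - 1) + 1)) (by positivity)
  have ht : Tendsto (fun G : Lp ℝ (ENNReal.ofReal p) M => C * ‖G - F‖ ^ (p - 1)) (𝓝 F) (𝓝 0) := by
    have : Continuous (fun G : Lp ℝ (ENNReal.ofReal p) M => C * ‖G - F‖ ^ (p - 1)) :=
      continuous_const.mul ((by fun_prop : Continuous fun G : Lp ℝ (ENNReal.ofReal p) M =>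
        ‖G - F‖).rpow_const fun _ => Or.inr hp1.le)
    simpa [Real.zero_rpow hp1.ne'] using this.tendsto F
  filter_upwards [ht.eventually_lt_const (half_pos hη)] with G hG
  rw [dist_zero_right, norm_norm]
  refine (hC G).trans_lt ?_
  have : η / 2 / (‖F‖ ^ (p - 1) + 1) * ‖F‖ ^ (p - 1) ≤ η / 2 := by
    rw [div_mul_eq_mul_div, div_le_iff₀ (by positivity)]
    nlinarith [show 0 ≤ ‖F‖ ^ (p - 1) by positivity]
  linarith

theorem hasFDerivAt_norm_rpow_Lp {p : ℝ} [hp : Fact (1 < p)] (F : Lp ℝ (ENNReal.ofReal p) M) :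
    HasFDerivAt (fun F : Lp ℝ (ENNReal.ofReal p) M => ‖F‖ ^ p)
      (p • dualPairing p M (lpSpow F)) F := by
  have hp0 : 0 < p := by linarith [hp.out]
  rw [hasFDerivAt_iff_isLittleO, Asymptotics.isLittleO_iff]
  intro ε hε
  have hcont : Continuous fun G : Lp ℝ (ENNReal.ofReal p) M =>
      ‖dualPairing p M (lpSpow G) - dualPairing p M (lpSpow F)‖ :=
    (((dualPairing p M).continuous.comp continuous_lpSpow).sub continuous_const).norm
  have ht := hcont.tendsto F
  simp only [sub_self, norm_zero] at ht
  filter_upwards [ht.eventually_lt_const (div_pos hε hp0)] with G hG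
  have h1 := dualPairing_le F G
  have h2 := dualPairing_le G F
  have h3 : dualPairing p M (lpSpow G) (F - G) = - dualPairing p M (lpSpow G) (G - F) := by
    rw [← map_neg, neg_sub]
  rw [h3] at h2
  simp only [_root_.smul_apply, smul_eq_mul]
  rw [Real.norm_eq_abs, abs_of_nonneg (by linarith)]
  have h4 := (dualPairing p M (lpSpow G) - dualPairing p M (lpSpow F)).le_opNorm (G - F)
  have h5 := (le_abs_self _).trans h4
  rw [_root_.sub_apply] at h5
  have h6 : p * (‖dualPairing p M (lpSpow G) - dualPairing p M (lpSpow F)‖ * ‖G - F‖)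
      ≤ ε * ‖G - F‖ := by
    rw [← mul_assoc]
    refine mul_le_mul_of_nonneg_right ?_ (norm_nonneg _)
    rw [lt_div_iff₀ hp0] at hG; linarith
  nlinarith [mul_le_mul_of_nonneg_left h5 hp0.le]

theorem contDiff_norm_rpow_Lp {p : ℝ} [hp : Fact (1 < p)] :
    ContDiff ℝ 1 (fun F : Lp ℝ (ENNReal.ofReal p) M => ‖F‖ ^ p) := by
  rw [contDiff_one_iff_hasFDerivAt]
  exact ⟨_, (((dualPairing p M).continuous.comp continuous_lpSpow).const_smul p),
    fun F => hasFDerivAt_norm_rpow_Lp F⟩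

/-- The Brezis–Lieb argument: a homogeneous perturbation vanishing on the first axis has
vanishing integrals along bounded sequences that converge almost everywhere. -/
theorem tendsto_integral_of_homogeneous {p : ℝ} [hp : Fact (1 < p)] {h : ℝ → ℝ → ℝ}
    (hc : Continuous (fun z : ℝ × ℝ => h z.1 z.2))
    (hh : ∀ t s b : ℝ, 0 < t → h (t * s) (t * b) = t ^ p * h s b)
    (h1 : h 1 0 = 0) (h2 : h (-1) 0 = 0) (h0 : ∀ b, h 0 b = 0)
    {F : ℕ → Lp ℝ (ENNReal.ofReal p) M} {U : Lp ℝ (ENNReal.ofReal p) M} {R : ℝ}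
    (hR : ∀ n, ‖F n‖ ≤ R) (hF : ∀ᵐ x ∂M, Tendsto (fun n => F n x) atTop (𝓝 (U x))) :
    Tendsto (fun n => ∫ x, h (F n x - U x) (U x) ∂M) atTop (𝓝 0) := by
  have hp0 : 0 < p := by linarith [hp.out]
  have hmeas : ∀ n, AEStronglyMeasurable (fun x => h (F n x - U x) (U x)) M := fun n =>
    hc.comp_aestronglyMeasurable (f := fun x => (F n x - U x, U x))
      (((Lp.aestronglyMeasurable _).sub (Lp.aestronglyMeasurable _)).prodMk
        (Lp.aestronglyMeasurable _))
  have hsub : ∀ n, Integrable (fun x => |F n x - U x| ^ p) M := fun n =>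
    (memLp_ofReal_iff hp0 ((Lp.aestronglyMeasurable _).sub (Lp.aestronglyMeasurable _))).1
      ((Lp.memLp (F n)).sub (Lp.memLp U))
  have hsubI : ∀ n, ∫ x, |F n x - U x| ^ p ∂M ≤ (R + ‖U‖) ^ p := fun n => by
    have : ∫ x, |F n x - U x| ^ p ∂M = ‖F n - U‖ ^ p := by
      rw [norm_rpow_eq_integral hp0]
      refine integral_congr_ae ?_
      filter_upwards [Lp.coeFn_sub (F n) U] with x hx
      rw [hx]; rfl
    rw [this]
    refine Real.rpow_le_rpow (norm_nonneg _) ?_ hp0.le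
    exact (norm_sub_le _ _).trans (by gcongr; exact hR n)
  have hU := integrable_abs_rpow hp0 U
  rw [Metric.tendsto_atTop']
  intro η hη
  have hRpos : 0 ≤ (R + ‖U‖) ^ p := by
    have := (norm_nonneg _).trans (hR 0)
    positivity
  set ε := η / 2 / ((R + ‖U‖) ^ p + 1) with hεdef
  have hε : 0 < ε := by positivity
  obtain ⟨C, hC0, hC⟩ := abs_le_of_homogeneous hc hh h1 h2 (h0 0) hε
  have hDCT : Tendsto (fun n => ∫ x, max (|h (F n x - U x) (U x)| - ε * |F n x - U x| ^ p) 0 ∂M)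
      atTop (𝓝 (∫ x, (0 : ℝ) ∂M)) := by
    refine tendsto_integral_of_dominated_convergence (fun x => C * |U x| ^ p) ?_
      (hU.const_mul C) ?_ ?_
    · intro n
      exact (((hmeas n).norm.aemeasurable.sub
        ((hsub n).aestronglyMeasurable.const_mul ε).aemeasurable).max
        aemeasurable_const).aestronglyMeasurable
    · intro n
      refine .of_forall fun x => ?_
      rw [Real.norm_eq_abs, abs_of_nonneg (le_max_right _ _)]
      refine max_le ?_ (by positivity)
      linarith [hC (F n x - U x) (U x)]
    · filter_upwards [hF] with x hx
      have hcont : Continuous (fun a : ℝ => max (|h (a - U x) (U x)| - ε * |a - U x| ^ p) 0) := by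
        refine Continuous.max (Continuous.sub ?_ ?_) continuous_const
        · exact (hc.comp (by fun_prop : Continuous fun a : ℝ => (a - U x, U x))).abs
        · exact continuous_const.mul ((by fun_prop : Continuous fun a : ℝ => |a - U x|).rpow_const
            fun _ => Or.inr hp0.le)
      have := (hcont.tendsto (U x)).comp hx
      simpa [h0, Real.zero_rpow hp0.ne', Function.comp_def] using this
  rw [integral_zero] at hDCT
  obtain ⟨n₀, hn₀⟩ := eventually_atTop.1 (hDCT.eventually_lt_const (half_pos hη))
  refine ⟨n₀, fun n hn => ?_⟩
  rw [dist_zero_right]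
  have hmaxint : Integrable
      (fun x => max (|h (F n x - U x) (U x)| - ε * |F n x - U x| ^ p) 0) M := by
    refine (hU.const_mul C).mono' (((hmeas n).norm.aemeasurable.sub
        ((hsub n).aestronglyMeasurable.const_mul ε).aemeasurable).max
        aemeasurable_const).aestronglyMeasurable (.of_forall fun x => ?_)
    rw [Real.norm_eq_abs, abs_of_nonneg (le_max_right _ _)]
    refine max_le ?_ (by positivity)
    linarith [hC (F n x - U x) (U x)]
  calc ‖∫ x, h (F n x - U x) (U x) ∂M‖ ≤ ∫ x, |h (F n x - U x) (U x)| ∂M :=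
        norm_integral_le_integral_norm _
    _ ≤ ∫ x, (max (|h (F n x - U x) (U x)| - ε * |F n x - U x| ^ p) 0
          + ε * |F n x - U x| ^ p) ∂M := by
        refine integral_mono_of_nonneg (.of_forall fun x => abs_nonneg _)
          (hmaxint.add ((hsub n).const_mul ε)) (.of_forall fun x => ?_)
        simp only
        linarith [le_max_left (|h (F n x - U x) (U x)| - ε * |F n x - U x| ^ p) 0]
    _ = ∫ x, max (|h (F n x - U x) (U x)| - ε * |F n x - U x| ^ p) 0 ∂M
          + ε * ∫ x, |F n x - U x| ^ p ∂M := by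
        rw [integral_add hmaxint ((hsub n).const_mul ε), integral_const_mul]
    _ < η / 2 + η / 2 := by
        refine add_lt_add_of_lt_of_le (hn₀ n hn.le) ?_
        refine (mul_le_mul_of_nonneg_left (hsubI n) hε.le).trans ?_
        rw [hεdef, div_mul_eq_mul_div, div_le_iff₀ (by positivity)]
        nlinarith
    _ = η := by ring

/-- The Brezis–Lieb lemma. -/
theorem tendsto_norm_rpow_sub {p : ℝ} [hp : Fact (1 < p)]
    {F : ℕ → Lp ℝ (ENNReal.ofReal p) M} {U : Lp ℝ (ENNReal.ofReal p) M} {R : ℝ}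
    (hR : ∀ n, ‖F n‖ ≤ R) (hF : ∀ᵐ x ∂M, Tendsto (fun n => F n x) atTop (𝓝 (U x))) :
    Tendsto (fun n => ‖F n‖ ^ p - ‖F n - U‖ ^ p) atTop (𝓝 (‖U‖ ^ p)) := by
  have hp0 : 0 < p := by linarith [hp.out]
  have hcont : Continuous fun t : ℝ => |t| ^ p :=
    continuous_abs.rpow_const fun _ => Or.inr hp0.le
  have := tendsto_integral_of_homogeneous (h := fun s b => |s + b| ^ p - |s| ^ p - |b| ^ p)
    (((hcont.comp (continuous_fst.add continuous_snd)).sub (hcont.comp continuous_fst)).sub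
      (hcont.comp continuous_snd))
    (fun t s b ht => by
      simp only [← mul_add, abs_mul, abs_of_pos ht]
      rw [Real.mul_rpow ht.le (abs_nonneg _), Real.mul_rpow ht.le (abs_nonneg _),
        Real.mul_rpow ht.le (abs_nonneg _)]
      ring) (by simp [Real.zero_rpow hp0.ne']) (by simp [Real.zero_rpow hp0.ne'])
      (by simp [Real.zero_rpow hp0.ne']) hR hF
  rw [← tendsto_sub_nhds_zero_iff]
  refine this.congr fun n => ?_
  rw [norm_rpow_eq_integral hp0, norm_rpow_eq_integral hp0, norm_rpow_eq_integral hp0,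
    ← integral_sub (integrable_abs_rpow hp0 _) (integrable_abs_rpow hp0 _),
    ← integral_sub (f := fun x => |F n x| ^ p - |(F n - U) x| ^ p)
      ((integrable_abs_rpow hp0 _).sub (integrable_abs_rpow hp0 _)) (integrable_abs_rpow hp0 _)]
  refine integral_congr_ae ?_
  filter_upwards [Lp.coeFn_sub (F n) U] with x hx
  simp only [sub_add_cancel, hx, Pi.sub_apply]

theorem tendsto_dualPairing_lpSpow {p : ℝ} [hp : Fact (1 < p)]
    {F : ℕ → Lp ℝ (ENNReal.ofReal p) M} {U : Lp ℝ (ENNReal.ofReal p) M} {R : ℝ}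
    (hR : ∀ n, ‖F n‖ ≤ R) (hF : ∀ᵐ x ∂M, Tendsto (fun n => F n x) atTop (𝓝 (U x))) :
    Tendsto (fun n => dualPairing p M (lpSpow (F n)) U) atTop (𝓝 (‖U‖ ^ p)) := by
  have hp0 : 0 < p := by linarith [hp.out]
  have hp1 : 0 < p - 1 := by linarith [hp.out]
  have := tendsto_integral_of_homogeneous
    (h := fun s b => (spow (p - 1) (s + b) - spow (p - 1) b) * b)
    ((((continuous_spow hp1).comp (continuous_fst.add continuous_snd)).sub
      ((continuous_spow hp1).comp continuous_snd)).mul continuous_snd)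
    (fun t s b ht => by
      simp only [← mul_add]
      rw [spow_mul ht.le, spow_mul ht.le]
      have : t ^ p = t ^ (p - 1) * t := by
        rw [← Real.rpow_add_one ht.ne']; simp
      rw [this]; ring) (by simp) (by simp) (by simp) hR hF
  rw [← tendsto_sub_nhds_zero_iff]
  refine this.congr fun n => ?_
  rw [← dualPairing_lpSpow_self U, dualPairing_lpSpow, dualPairing_lpSpow,
    ← integral_sub (integrable_spow_mul _ _) (integrable_spow_mul _ _)]
  refine integral_congr_ae (.of_forall fun x => ?_)
  simp only [sub_add_cancel]
  ring

end PowerFunctional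

section HardyLittlewoodSobolev

open scoped ENNReal

variable {N : ℕ}

/-- The Riesz kernel `|x - y| ^ (-μ)`. -/
noncomputable def rieszKernel (μ : ℝ) (x y : RN N) : ℝ≥0∞ := ENNReal.ofReal (‖x - y‖ ^ (-μ))

theorem measurable_rieszKernel (μ : ℝ) :
    Measurable (fun z : RN N × RN N => rieszKernel μ z.1 z.2) := by
  unfold rieszKernel
  fun_prop

theorem measurable_rieszKernel_left (μ : ℝ) (x : RN N) : Measurable (rieszKernel μ x) := by
  unfold rieszKernel
  fun_prop

theorem rieszKernel_comm (μ : ℝ) (x y : RN N) : rieszKernel μ x y = rieszKernel μ y x := by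
  rw [rieszKernel, rieszKernel, norm_sub_rev]

theorem lintegral_ball_rpow_le (hN : 0 < N) {μ : ℝ} (hμ : μ < N) :
    ∃ c : ℝ≥0∞, c ≠ ⊤ ∧ ∀ (x : RN N) (R : ℝ), 0 < R →
      ∫⁻ y in Metric.ball x R, rieszKernel μ x y ≤ c * ENNReal.ofReal (R ^ ((N : ℝ) - μ)) := by
  have : Nonempty (Fin N) := ⟨⟨0, hN⟩⟩
  have hfr : Module.finrank ℝ (RN N) = N := by simp
  refine ⟨ENNReal.ofReal (N * volume.real (Metric.ball (0 : RN N) 1) * (1 / ((N : ℝ) - μ))),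
    ENNReal.ofReal_ne_top, fun x R hR => ?_⟩
  have hN1 : ((N - 1 : ℕ) : ℝ) = (N : ℝ) - 1 := by rw [Nat.cast_sub (by omega)]; simp
  have hpow : ∀ y : ℝ, 0 < y → y ^ (N - 1) * y ^ (-μ) = y ^ ((N : ℝ) - 1 - μ) := fun y hy => by
    rw [← Real.rpow_natCast, hN1, ← Real.rpow_add hy]; ring_nf
  set f : ℝ → ℝ := (Set.Iio R).indicator (fun y => y ^ (-μ)) with hf
  have hind : (fun y : ℝ => y ^ (N - 1) • f y) =
      (Set.Iio R).indicator (fun y => y ^ (N - 1) * y ^ (-μ)) := by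
    ext y; by_cases h : y ∈ Set.Iio R <;> simp [hf, h]
  have hint : IntegrableOn (fun y : ℝ => y ^ ((N : ℝ) - 1 - μ)) (Set.Ioo 0 R) := by
    rw [← integrableOn_Ioc_iff_integrableOn_Ioo]
    exact (intervalIntegrable_iff_integrableOn_Ioc_of_le hR.le).1
      (intervalIntegral.intervalIntegrable_rpow' (by linarith))
  have hval : ∫ y in Set.Ioi (0 : ℝ), y ^ (N - 1) • f y = R ^ ((N : ℝ) - μ) / ((N : ℝ) - μ) := by
    rw [hind, setIntegral_indicator measurableSet_Iio, Set.Ioi_inter_Iio,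
      setIntegral_congr_fun measurableSet_Ioo (fun y hy => hpow y hy.1),
      ← integral_Ioc_eq_integral_Ioo, ← intervalIntegral.integral_of_le hR.le,
      integral_rpow (Or.inl (by linarith))]
    rw [Real.zero_rpow (by linarith)]
    ring_nf
  have hintf : Integrable (fun z : RN N => f ‖z‖) := by
    rw [integrable_fun_norm_addHaar volume, hfr, hind, integrableOn_indicator_iff measurableSet_Iio,
      Set.inter_comm, Set.Ioi_inter_Iio]
    exact hint.congr_fun (fun y hy => (hpow y hy.1).symm) measurableSet_Ioo
  have hf0 : ∀ z : RN N, 0 ≤ f ‖z‖ := fun z =>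
    Set.indicator_apply_nonneg fun _ => by positivity
  have e1 : ∫⁻ y in Metric.ball x R, rieszKernel μ x y =
      ∫⁻ y, ENNReal.ofReal (f ‖y - x‖) := by
    rw [← lintegral_indicator measurableSet_ball]
    refine lintegral_congr fun y => ?_
    by_cases h : y ∈ Metric.ball x R
    · have h' : ‖y - x‖ < R := by simpa [dist_eq_norm] using h
      simp [h, hf, h', rieszKernel, norm_sub_rev x y]
    · have h' : ¬ ‖y - x‖ < R := by simpa [dist_eq_norm] using h
      simp [h, hf, h']
  rw [e1, lintegral_sub_right_eq_self (fun y : RN N => ENNReal.ofReal (f ‖y‖)) x,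
    ← ofReal_integral_eq_lintegral_ofReal hintf (.of_forall hf0),
    integral_fun_norm_addHaar, hfr, hval, ← ENNReal.ofReal_mul (by
      have : (0 : ℝ) < N - μ := by linarith
      positivity)]
  refine le_of_eq ?_
  congr 1
  simp only [nsmul_eq_mul, smul_eq_mul]
  ring

theorem lintegral_compl_ball_rpow_le (hN : 0 < N) :
    ∃ c : ℝ≥0∞, c ≠ ⊤ ∧ ∀ (x : RN N) (R : ℝ), 0 < R →
      ∫⁻ y in (Metric.ball x R)ᶜ, rieszKernel (2 * N) x y ≤
        c * ENNReal.ofReal (R ^ (-(N : ℝ))) := by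
  have : Nonempty (Fin N) := ⟨⟨0, hN⟩⟩
  have hfr : Module.finrank ℝ (RN N) = N := by simp
  have hNR : (0 : ℝ) < N := by exact_mod_cast hN
  refine ⟨ENNReal.ofReal (N * volume.real (Metric.ball (0 : RN N) 1) * (1 / (N : ℝ))),
    ENNReal.ofReal_ne_top, fun x R hR => ?_⟩
  have hN1 : ((N - 1 : ℕ) : ℝ) = (N : ℝ) - 1 := by rw [Nat.cast_sub (by omega)]; simp
  have hpow : ∀ y : ℝ, 0 < y → y ^ (N - 1) * y ^ (-(2 * N : ℝ)) = y ^ (-(N : ℝ) - 1) :=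
    fun y hy => by rw [← Real.rpow_natCast, hN1, ← Real.rpow_add hy]; ring_nf
  set f : ℝ → ℝ := (Set.Ici R).indicator (fun y => y ^ (-(2 * N : ℝ))) with hf
  have hind : (fun y : ℝ => y ^ (N - 1) • f y) =
      (Set.Ici R).indicator (fun y => y ^ (N - 1) * y ^ (-(2 * N : ℝ))) := by
    ext y; by_cases h : y ∈ Set.Ici R <;> simp [hf, h]
  have hset : Set.Ioi 0 ∩ Set.Ici R = Set.Ici R :=
    Set.inter_eq_right.2 fun y hy => hR.trans_le hy
  have hint : IntegrableOn (fun y : ℝ => y ^ (-(N : ℝ) - 1)) (Set.Ici R) := by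
    rw [integrableOn_Ici_iff_integrableOn_Ioi]
    exact integrableOn_Ioi_rpow_of_lt (by linarith) hR
  have hval : ∫ y in Set.Ioi (0 : ℝ), y ^ (N - 1) • f y = R ^ (-(N : ℝ)) / N := by
    rw [hind, setIntegral_indicator measurableSet_Ici, hset,
      setIntegral_congr_fun measurableSet_Ici (fun y hy => hpow y (hR.trans_le hy)),
      integral_Ici_eq_integral_Ioi, integral_Ioi_rpow_of_lt (by linarith) hR]
    ring_nf
  have hintf : Integrable (fun z : RN N => f ‖z‖) := by
    rw [integrable_fun_norm_addHaar volume, hfr, hind, integrableOn_indicator_iff measurableSet_Ici,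
      Set.inter_comm, hset]
    exact hint.congr_fun (fun y hy => (hpow y (hR.trans_le hy)).symm) measurableSet_Ici
  have hf0 : ∀ z : RN N, 0 ≤ f ‖z‖ := fun z =>
    Set.indicator_apply_nonneg fun _ => by positivity
  have e1 : ∫⁻ y in (Metric.ball x R)ᶜ, rieszKernel (2 * N) x y =
      ∫⁻ y, ENNReal.ofReal (f ‖y - x‖) := by
    rw [← lintegral_indicator measurableSet_ball.compl]
    refine lintegral_congr fun y => ?_
    by_cases h : y ∈ (Metric.ball x R)ᶜ
    · have h' : R ≤ ‖y - x‖ := by simpa [dist_eq_norm] using h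
      rw [Set.indicator_of_mem h]
      simp [hf, h', rieszKernel, norm_sub_rev x y]
    · have h' : ¬ R ≤ ‖y - x‖ := by simpa [dist_eq_norm] using h
      rw [Set.indicator_of_notMem h]
      simp [hf, h']
  rw [e1, lintegral_sub_right_eq_self (fun y : RN N => ENNReal.ofReal (f ‖y‖)) x,
    ← ofReal_integral_eq_lintegral_ofReal hintf (.of_forall hf0),
    integral_fun_norm_addHaar, hfr, hval, ← ENNReal.ofReal_mul (by positivity)]
  refine le_of_eq ?_
  congr 1
  simp only [nsmul_eq_mul, smul_eq_mul]
  ring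

/-- The Hardy–Littlewood–Sobolev exponent `2N/(2N-μ)`. -/
noncomputable def rieszExp (N : ℕ) (μ : ℝ) : ℝ := 2 * N / (2 * N - μ)

theorem rieszExp_holderConjugate (hN : 0 < N) {μ : ℝ} (hμ0 : 0 < μ) (hμ : μ < N) :
    (rieszExp N μ).HolderConjugate (2 * N / μ) := by
  have hNR : (0 : ℝ) < N := by exact_mod_cast hN
  have h1 : 0 < 2 * (N : ℝ) - μ := by linarith
  rw [Real.holderConjugate_iff, rieszExp]
  constructor
  · rw [lt_div_iff₀ h1]; linarith
  · rw [inv_div, inv_div, ← add_div]; field_simp; ring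

theorem lintegral_riesz_truncated_le (hN : 0 < N) {μ : ℝ} (hμ0 : 0 < μ) (hμ : μ < N) :
    ∃ c : ℝ≥0∞, c ≠ ⊤ ∧ ∀ (ν : Measure (RN N)), ν ≤ volume → ∀ (g : RN N → ℝ≥0∞), Measurable g →
      ∫⁻ y, g y ^ rieszExp N μ ∂ν ≤ 1 → ∀ (x : RN N) (a : ℝ≥0∞) (R : ℝ), 0 < R →
      ∫⁻ y, {y | g y ≤ a}.indicator (fun y => g y * rieszKernel μ x y) y ∂ν ≤
        c * (a * ENNReal.ofReal (R ^ ((N : ℝ) - μ)) + ENNReal.ofReal (R ^ (-(μ / 2)))) := by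
  have hNR : (0 : ℝ) < N := by exact_mod_cast hN
  obtain ⟨c₁, hc₁, h₁⟩ := lintegral_ball_rpow_le hN hμ
  obtain ⟨c₂, hc₂, h₂⟩ := lintegral_compl_ball_rpow_le hN
  have hconj := rieszExp_holderConjugate hN hμ0 hμ
  have hexp : 0 ≤ μ / (2 * N) := by positivity
  refine ⟨c₁ + c₂ ^ (μ / (2 * N)), 
    ENNReal.add_ne_top.2 ⟨hc₁, ENNReal.rpow_ne_top_of_nonneg hexp hc₂⟩, fun ν hν g hg hg1 x a R hR => ?_⟩
  have hk : Measurable (rieszKernel μ x) := measurable_rieszKernel_left μ x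
  have hk2 : ∀ y, rieszKernel μ x y ^ (2 * N / μ) = rieszKernel (2 * N) x y := fun y => by
    rw [rieszKernel, rieszKernel, ENNReal.ofReal_rpow_of_nonneg (by positivity) (by positivity),
      ← Real.rpow_mul (norm_nonneg _)]
    rw [show -μ * (2 * N / μ) = -(2 * N : ℝ) by field_simp]
  have hle : ∀ y, {y | g y ≤ a}.indicator (fun y => g y * rieszKernel μ x y) y ≤
      (Metric.ball x R).indicator (fun y => a * rieszKernel μ x y) y +
        g y * (Metric.ball x R)ᶜ.indicator (rieszKernel μ x) y := fun y => by
    by_cases hya : g y ≤ a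
    · rw [Set.indicator_of_mem (by exact hya)]
      by_cases hb : y ∈ Metric.ball x R
      · rw [Set.indicator_of_mem hb, Set.indicator_of_notMem (by simpa using hb), mul_zero, add_zero]
        gcongr
      · rw [Set.indicator_of_notMem hb, Set.indicator_of_mem (by simpa using hb), zero_add]
    · rw [Set.indicator_of_notMem (by exact hya)]; exact zero_le
  have hA : ∫⁻ y, (Metric.ball x R).indicator (fun y => a * rieszKernel μ x y) y ∂ν ≤
      a * (c₁ * ENNReal.ofReal (R ^ ((N : ℝ) - μ))) := by
    rw [lintegral_indicator measurableSet_ball, lintegral_const_mul _ hk]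
    gcongr
    exact (lintegral_mono' (Measure.restrict_mono le_rfl hν) le_rfl).trans (h₁ x R hR)
  have hB : ∫⁻ y, g y * (Metric.ball x R)ᶜ.indicator (rieszKernel μ x) y ∂ν ≤
      c₂ ^ (μ / (2 * N)) * ENNReal.ofReal (R ^ (-(μ / 2))) := by
    have := ENNReal.lintegral_mul_le_Lp_mul_Lq ν hconj hg.aemeasurable
      (hk.indicator (measurableSet_ball (x := x) (ε := R)).compl).aemeasurable
    simp only [Pi.mul_apply] at this
    refine this.trans ?_
    have e1 : (∫⁻ y, g y ^ rieszExp N μ ∂ν) ^ (1 / rieszExp N μ) ≤ 1 :=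
      ENNReal.rpow_le_one hg1 hconj.one_div_nonneg
    have e2 : ∫⁻ y, (Metric.ball x R)ᶜ.indicator (rieszKernel μ x) y ^ (2 * N / μ) ∂ν ≤
        c₂ * ENNReal.ofReal (R ^ (-(N : ℝ))) := by
      have : ∀ y, (Metric.ball x R)ᶜ.indicator (rieszKernel μ x) y ^ (2 * N / μ) =
          (Metric.ball x R)ᶜ.indicator (rieszKernel (2 * N) x) y := fun y => by
        by_cases hb : y ∈ (Metric.ball x R)ᶜ
        · rw [Set.indicator_of_mem hb, Set.indicator_of_mem hb, hk2]
        · rw [Set.indicator_of_notMem hb, Set.indicator_of_notMem hb,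
            ENNReal.zero_rpow_of_pos (by positivity)]
      simp_rw [this]
      rw [lintegral_indicator measurableSet_ball.compl]
      exact (lintegral_mono' (Measure.restrict_mono le_rfl hν) le_rfl).trans (h₂ x R hR)
    calc _ ≤ 1 * (c₂ * ENNReal.ofReal (R ^ (-(N : ℝ)))) ^ (μ / (2 * N)) := by
          rw [one_div_div]
          gcongr
      _ = _ := by
          rw [one_mul, ENNReal.mul_rpow_of_nonneg _ _ hexp,
            ENNReal.ofReal_rpow_of_nonneg (by positivity) hexp, ← Real.rpow_mul hR.le,
            show -(N : ℝ) * (μ / (2 * N)) = -(μ / 2) by field_simp]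
  calc _ ≤ ∫⁻ y, ((Metric.ball x R).indicator (fun y => a * rieszKernel μ x y) y +
        g y * (Metric.ball x R)ᶜ.indicator (rieszKernel μ x) y) ∂ν := lintegral_mono hle
    _ ≤ a * (c₁ * ENNReal.ofReal (R ^ ((N : ℝ) - μ))) +
        c₂ ^ (μ / (2 * N)) * ENNReal.ofReal (R ^ (-(μ / 2))) := by
      have hm : Measurable fun y =>
          (Metric.ball x R).indicator (fun y => a * rieszKernel μ x y) y :=
        (hk.const_mul a).indicator measurableSet_ball
      rw [lintegral_add_left hm]
      exact add_le_add hA hB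
    _ ≤ (c₁ + c₂ ^ (μ / (2 * N))) * (a * ENNReal.ofReal (R ^ ((N : ℝ) - μ))) +
        (c₁ + c₂ ^ (μ / (2 * N))) * ENNReal.ofReal (R ^ (-(μ / 2))) := by
      rw [mul_left_comm]
      gcongr
      · exact le_self_add
      · exact le_add_self
    _ = _ := by rw [mul_add]

theorem lintegral_lintegral_riesz_truncated_le (hN : 0 < N) {μ : ℝ} (hμ0 : 0 < μ) (hμ : μ < N) :
    ∃ c : ℝ≥0∞, c ≠ ⊤ ∧ ∀ (ν : Measure (RN N)), ν ≤ volume → ∀ (f g : RN N → ℝ≥0∞),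
      Measurable f → Measurable g →
      ∫⁻ y, f y ^ rieszExp N μ ∂ν ≤ 1 → ∫⁻ y, g y ^ rieszExp N μ ∂ν ≤ 1 →
      ∫⁻ x, f x * ∫⁻ y, {y | g y ≤ f x}.indicator (fun y => g y * rieszKernel μ x y) y ∂ν ∂ν
        ≤ c := by
  have hNR : (0 : ℝ) < N := by exact_mod_cast hN
  have h2 : 0 < 2 * (N : ℝ) - μ := by linarith
  obtain ⟨c, hc, h⟩ := lintegral_riesz_truncated_le hN hμ0 hμ
  have hr : 0 < rieszExp N μ := by unfold rieszExp; positivity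
  refine ⟨c * 2, ENNReal.mul_ne_top hc (by simp), fun ν hν f g hf hg hf1 hg1 => ?_⟩
  have hfin : ∀ᵐ x ∂ν, f x ^ rieszExp N μ < ⊤ :=
    ae_lt_top (hf.pow_const _) (hf1.trans_lt (by simp)).ne
  calc _ ≤ ∫⁻ x, (c * 2) * f x ^ rieszExp N μ ∂ν := by
        refine lintegral_mono_ae ?_
        filter_upwards [hfin] with x hx
        by_cases h0 : f x = 0
        · simp [h0]
        have htop : f x ≠ ⊤ := by
          intro ht; rw [ht, ENNReal.top_rpow_of_pos hr] at hx; exact hx.ne rfl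
        obtain ⟨t, ht0, ht⟩ : ∃ t : ℝ, 0 < t ∧ f x = ENNReal.ofReal t :=
          ⟨(f x).toReal, ENNReal.toReal_pos h0 htop, (ENNReal.ofReal_toReal htop).symm⟩
        have key := h ν hν g hg hg1 x (f x) (t ^ (-(2 / (2 * N - μ)))) (by positivity)
        have e1 : t * (t ^ (-(2 / (2 * N - μ)))) ^ ((N : ℝ) - μ) = t ^ (μ / (2 * N - μ)) := by
          rw [← Real.rpow_mul ht0.le, ← Real.rpow_one_add' ht0.le]
          · congr 1; field_simp; ring
          · have : 1 + -(2 / (2 * N - μ)) * (N - μ) = μ / (2 * N - μ) := by field_simp; ring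
            rw [this]; positivity
        have e2 : (t ^ (-(2 / (2 * N - μ)))) ^ (-(μ / 2)) = t ^ (μ / (2 * N - μ)) := by
          rw [← Real.rpow_mul ht0.le]; congr 1; field_simp
        rw [e2, ht, ← ENNReal.ofReal_mul ht0.le, e1, ← two_mul] at key
        rw [ht]
        refine (mul_le_mul_right key _).trans (le_of_eq ?_)
        have e3 : ENNReal.ofReal t ^ rieszExp N μ =
            ENNReal.ofReal t * ENNReal.ofReal (t ^ (μ / (2 * N - μ))) := by
          rw [ENNReal.ofReal_rpow_of_pos ht0, ← ENNReal.ofReal_mul ht0.le,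
            ← Real.rpow_one_add' ht0.le (by positivity)]
          congr 2
          rw [rieszExp]; field_simp; ring
        rw [e3]; ring
    _ = c * 2 * ∫⁻ x, f x ^ rieszExp N μ ∂ν := lintegral_const_mul _ (hf.pow_const _)
    _ ≤ c * 2 := mul_le_of_le_one_right' hf1

/-- The Hardy–Littlewood–Sobolev inequality in the diagonal case. -/
theorem hardy_littlewood_sobolev (hN : 0 < N) {μ : ℝ} (hμ0 : 0 < μ) (hμ : μ < N) :
    ∃ c : ℝ≥0∞, c ≠ ⊤ ∧ ∀ (ν : Measure (RN N)) [SFinite ν], ν ≤ volume →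
      ∀ (f g : RN N → ℝ≥0∞), Measurable f → Measurable g →
      ∫⁻ y, f y ^ rieszExp N μ ∂ν ≠ ⊤ → ∫⁻ y, g y ^ rieszExp N μ ∂ν ≠ ⊤ →
      ∫⁻ x, ∫⁻ y, f x * g y * rieszKernel μ x y ∂ν ∂ν ≤
        c * ((∫⁻ y, f y ^ rieszExp N μ ∂ν) ^ (1 / rieszExp N μ) *
          (∫⁻ y, g y ^ rieszExp N μ ∂ν) ^ (1 / rieszExp N μ)) := by
  obtain ⟨c, hc, h⟩ := lintegral_lintegral_riesz_truncated_le hN hμ0 hμ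
  have hr : 0 < rieszExp N μ := (rieszExp_holderConjugate hN hμ0 hμ).pos
  refine ⟨c + c, by simp [hc], fun ν _ hν => ?_⟩
  have hnorm : ∀ f g : RN N → ℝ≥0∞, Measurable f → Measurable g →
      ∫⁻ y, f y ^ rieszExp N μ ∂ν ≤ 1 → ∫⁻ y, g y ^ rieszExp N μ ∂ν ≤ 1 →
      ∫⁻ x, ∫⁻ y, f x * g y * rieszKernel μ x y ∂ν ∂ν ≤ c + c := by
    intro f g hf hg hf1 hg1
    have hk := measurable_rieszKernel (N := N) μ
    have hsub : ∀ {u v : RN N → ℝ≥0∞}, Measurable u → Measurable v → Measurable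
        (fun z : RN N × RN N => u z.1 * {y | v y ≤ u z.1}.indicator
          (fun y => v y * rieszKernel μ z.1 y) z.2) := fun {u v} hu hv => by
      have : Measurable (fun z : RN N × RN N => {z : RN N × RN N | v z.2 ≤ u z.1}.indicator
          (fun z => v z.2 * rieszKernel μ z.1 z.2) z) :=
        ((hv.comp measurable_snd).mul hk).indicator
          (measurableSet_le (hv.comp measurable_snd) (hu.comp measurable_fst))
      exact (hu.comp measurable_fst).mul this
    have hmul : ∀ {u v : RN N → ℝ≥0∞}, Measurable v → ∀ x, u x *
        ∫⁻ y, {y | v y ≤ u x}.indicator (fun y => v y * rieszKernel μ x y) y ∂ν =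
        ∫⁻ y, u x * {y | v y ≤ u x}.indicator (fun y => v y * rieszKernel μ x y) y ∂ν :=
      fun {u v} hv x => by
        refine (lintegral_const_mul _ ?_).symm
        exact (hv.mul (hk.comp (measurable_const.prodMk measurable_id))).indicator
          (measurableSet_le hv measurable_const)
    have A := h ν hν f g hf hg hf1 hg1
    have B := h ν hν g f hg hf hg1 hf1
    simp_rw [hmul hg] at A
    simp_rw [hmul hf] at B
    rw [lintegral_lintegral_swap (hsub hg hf).aemeasurable] at B
    refine le_trans ?_ (add_le_add A B)
    rw [← lintegral_add_left (hsub hf hg).lintegral_prod_right']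
    refine lintegral_mono fun x => ?_
    have hx : Measurable fun y => f x * {y | g y ≤ f x}.indicator
        (fun y => g y * rieszKernel μ x y) y :=
      (hsub hf hg).comp (measurable_const.prodMk measurable_id)
    dsimp only
    rw [← lintegral_add_left hx]
    refine lintegral_mono fun y => ?_
    rcases le_total (g y) (f x) with hxy | hxy
    · refine le_trans (le_of_eq ?_) le_self_add
      rw [Set.indicator_of_mem (by exact hxy), mul_assoc]
    · refine le_trans (le_of_eq ?_) le_add_self
      rw [Set.indicator_of_mem (by exact hxy), rieszKernel_comm]
      ring
  intro f g hf hg hfI hgI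
  have hzero : ∀ {u : RN N → ℝ≥0∞}, Measurable u → ∫⁻ y, u y ^ rieszExp N μ ∂ν = 0 →
      ∀ᵐ y ∂ν, u y = 0 := fun {u} hu h0 => by
    rw [lintegral_eq_zero_iff (hu.pow_const _)] at h0
    filter_upwards [h0] with y hy
    exact (ENNReal.rpow_eq_zero_iff_of_pos hr).1 hy
  by_cases hf0 : ∫⁻ y, f y ^ rieszExp N μ ∂ν = 0
  · have : ∀ᵐ x ∂ν, ∫⁻ y, f x * g y * rieszKernel μ x y ∂ν = 0 := by
      filter_upwards [hzero hf hf0] with x hx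
      simp [hx]
    rw [lintegral_congr_ae this]; simp
  by_cases hg0 : ∫⁻ y, g y ^ rieszExp N μ ∂ν = 0
  · have : ∀ x, ∫⁻ y, f x * g y * rieszKernel μ x y ∂ν = 0 := fun x => by
      rw [← lintegral_zero (μ := ν)]
      refine lintegral_congr_ae ?_
      filter_upwards [hzero hg hg0] with y hy
      simp [hy]
    simp [this]
  set F := (∫⁻ y, f y ^ rieszExp N μ ∂ν) ^ (1 / rieszExp N μ) with hF
  set G := (∫⁻ y, g y ^ rieszExp N μ ∂ν) ^ (1 / rieszExp N μ) with hG
  have hscale : ∀ {u : RN N → ℝ≥0∞} {U : ℝ≥0∞}, Measurable u →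
      U = (∫⁻ y, u y ^ rieszExp N μ ∂ν) ^ (1 / rieszExp N μ) →
      ∫⁻ y, u y ^ rieszExp N μ ∂ν ≠ 0 → ∫⁻ y, u y ^ rieszExp N μ ∂ν ≠ ⊤ →
      ∫⁻ y, (U⁻¹ * u y) ^ rieszExp N μ ∂ν ≤ 1 := fun {u U} hu hU h0 htop => by
    simp_rw [ENNReal.mul_rpow_of_nonneg _ _ hr.le]
    rw [lintegral_const_mul _ (hu.pow_const _), hU, ENNReal.inv_rpow, ← ENNReal.rpow_mul,
      one_div_mul_cancel hr.ne', ENNReal.rpow_one, ENNReal.inv_mul_cancel h0 htop]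
  have hF0 : F ≠ 0 := by
    rw [hF, Ne, ENNReal.rpow_eq_zero_iff_of_pos (by positivity)]; exact hf0
  have hG0 : G ≠ 0 := by
    rw [hG, Ne, ENNReal.rpow_eq_zero_iff_of_pos (by positivity)]; exact hg0
  have hFt : F ≠ ⊤ := ENNReal.rpow_ne_top_of_nonneg (by positivity) hfI
  have hGt : G ≠ ⊤ := ENNReal.rpow_ne_top_of_nonneg (by positivity) hgI
  have key := hnorm (fun x => F⁻¹ * f x) (fun y => G⁻¹ * g y) (hf.const_mul _) (hg.const_mul _)
    (hscale hf hF hf0 hfI) (hscale hg hG hg0 hgI)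
  have hk := measurable_rieszKernel (N := N) μ
  have hfg : Measurable (fun z : RN N × RN N => f z.1 * g z.2 * rieszKernel μ z.1 z.2) :=
    ((hf.comp measurable_fst).mul (hg.comp measurable_snd)).mul hk
  have e : ∀ x y, F⁻¹ * f x * (G⁻¹ * g y) * rieszKernel μ x y =
      (F * G)⁻¹ * (f x * g y * rieszKernel μ x y) := fun x y => by
    rw [ENNReal.mul_inv (Or.inl hF0) (Or.inl hFt)]; ring
  simp_rw [e] at key
  have e2 : ∀ x, ∫⁻ y, (F * G)⁻¹ * (f x * g y * rieszKernel μ x y) ∂ν =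
      (F * G)⁻¹ * ∫⁻ y, f x * g y * rieszKernel μ x y ∂ν := fun x =>
    lintegral_const_mul _ (hfg.comp (measurable_const.prodMk measurable_id))
  simp_rw [e2] at key
  rw [lintegral_const_mul _ hfg.lintegral_prod_right',
    ENNReal.inv_mul_le_iff (mul_ne_zero hF0 hG0) (ENNReal.mul_ne_top hFt hGt)] at key
  rwa [mul_comm] at key

end HardyLittlewoodSobolev

section SobolevSpace

variable {N : ℕ} {Ω : Set (RN N)}

namespace H01

/-- The embedding of `H₀¹(Ω)` into `L²(Ω)`. -/
noncomputable def fnL (Ω : Set (RN N)) : H01 Ω →L[ℝ] Lp ℝ 2 (volume.restrict Ω) :=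
  (WithLp.fstL 2 ℝ (Lp ℝ 2 (volume.restrict Ω)) (Lp (RN N) 2 (volume.restrict Ω))).comp
    (testPairs Ω).topologicalClosure.subtypeL

/-- The weak gradient as a continuous linear map. -/
noncomputable def gradL (Ω : Set (RN N)) : H01 Ω →L[ℝ] Lp (RN N) 2 (volume.restrict Ω) :=
  (WithLp.sndL 2 ℝ (Lp ℝ 2 (volume.restrict Ω)) (Lp (RN N) 2 (volume.restrict Ω))).comp
    (testPairs Ω).topologicalClosure.subtypeL

theorem coe_fnL (u : H01 Ω) : (fnL Ω u : RN N → ℝ) = u.fn := rfl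

theorem coe_gradL (u : H01 Ω) : (gradL Ω u : RN N → RN N) = u.grad := rfl

theorem norm_sq (u : H01 Ω) : ‖u‖ ^ 2 = ‖fnL Ω u‖ ^ 2 + ‖gradL Ω u‖ ^ 2 :=
  WithLp.prod_norm_sq_eq_of_L2 (u : L2Pair Ω)

theorem norm_gradL_le (u : H01 Ω) : ‖gradL Ω u‖ ≤ ‖u‖ := by
  refine le_of_sq_le_sq ?_ (norm_nonneg _)
  rw [norm_sq]; nlinarith [sq_nonneg ‖fnL Ω u‖]

theorem norm_fnL_le (u : H01 Ω) : ‖fnL Ω u‖ ≤ ‖u‖ := by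
  refine le_of_sq_le_sq ?_ (norm_nonneg _)
  rw [norm_sq]; nlinarith [sq_nonneg ‖gradL Ω u‖]

theorem integral_grad_sq (u : H01 Ω) : ∫ x in Ω, ‖u.grad x‖ ^ 2 = ‖gradL Ω u‖ ^ 2 := by
  rw [← real_inner_self_eq_norm_sq, L2.inner_def]
  simp only [real_inner_self_eq_norm_sq, coe_gradL]

theorem integral_fn_sq (u : H01 Ω) : ∫ x in Ω, |u.fn x| ^ 2 = ‖fnL Ω u‖ ^ 2 := by
  rw [← real_inner_self_eq_norm_sq, L2.inner_def]
  simp only [real_inner_self_eq_norm_sq, coe_fnL, Real.norm_eq_abs]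

theorem fn_add (u v : H01 Ω) : (u + v).fn =ᵐ[volume.restrict Ω] u.fn + v.fn := by
  have := Lp.coeFn_add (fnL Ω u) (fnL Ω v)
  rwa [← map_add] at this

theorem fn_smul (c : ℝ) (u : H01 Ω) : (c • u).fn =ᵐ[volume.restrict Ω] c • u.fn := by
  have := Lp.coeFn_smul c (fnL Ω u)
  rwa [← map_smul] at this

theorem stronglyMeasurable_fn (u : H01 Ω) : StronglyMeasurable u.fn :=
  Lp.stronglyMeasurable (fnL Ω u)

theorem memLp_fn (u : H01 Ω) : MemLp u.fn 2 (volume.restrict Ω) := Lp.memLp (fnL Ω u)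

theorem memLp_grad (u : H01 Ω) : MemLp u.grad 2 (volume.restrict Ω) := Lp.memLp (gradL Ω u)

/-- The element `v` of `H₀¹(Ω)` is represented by the test function `φ`. -/
def IsTest (v : H01 Ω) (φ : RN N → ℝ) : Prop :=
  IsTestFunction Ω φ ∧ v.fn =ᵐ[volume.restrict Ω] φ ∧ v.grad =ᵐ[volume.restrict Ω] ∇ φ

theorem exists_isTest_norm_sub_lt (u : H01 Ω) {ε : ℝ} (hε : 0 < ε) :
    ∃ (v : H01 Ω) (φ : RN N → ℝ), IsTest v φ ∧ ‖u - v‖ < ε := by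
  have hu : (u : L2Pair Ω) ∈ closure (testPairs Ω : Set (L2Pair Ω)) := u.2
  obtain ⟨v, ⟨φ, h1, h2, h3⟩, hv⟩ := Metric.mem_closure_iff.1 hu ε hε
  have hvm : v ∈ testPairs Ω := ⟨φ, h1, h2, h3⟩
  refine ⟨⟨v, (testPairs Ω).le_topologicalClosure hvm⟩, φ, ⟨h1, h2, h3⟩, ?_⟩
  rw [dist_eq_norm] at hv
  exact hv

theorem exists_isTest_tendsto (u : H01 Ω) :
    ∃ (v : ℕ → H01 Ω) (φ : ℕ → RN N → ℝ), (∀ n, IsTest (v n) (φ n)) ∧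
      Tendsto v atTop (𝓝 u) := by
  have h : ∀ n : ℕ, ∃ (v : H01 Ω) (φ : RN N → ℝ), IsTest v φ ∧ ‖u - v‖ < 1 / ((n : ℝ) + 1) :=
    fun n => exists_isTest_norm_sub_lt u (by positivity)
  choose v φ h1 h2 using h
  refine ⟨v, φ, h1, ?_⟩
  rw [tendsto_iff_norm_sub_tendsto_zero]
  refine squeeze_zero (fun n => norm_nonneg _) (fun n => ?_)
    tendsto_one_div_add_atTop_nhds_zero_nat
  rw [norm_sub_rev]; exact (h2 n).le

theorem norm_gradient (φ : RN N → ℝ) (x : RN N) : ‖∇ φ x‖ = ‖fderiv ℝ φ x‖ := by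
  simp [gradient]

theorem support_gradient_subset (φ : RN N → ℝ) : Function.support (∇ φ) ⊆ tsupport φ := by
  intro x hx
  refine support_fderiv_subset ℝ ?_
  simp only [Function.mem_support, gradient] at hx ⊢
  intro h; exact hx (by rw [h]; simp)

theorem continuous_gradient {φ : RN N → ℝ} (hφ : ContDiff ℝ ∞ φ) : Continuous (∇ φ) := by
  unfold gradient
  exact (InnerProductSpace.toDual ℝ (RN N)).symm.continuous.comp
    (hφ.continuous_fderiv (by simp))

theorem hasCompactSupport_gradient {φ : RN N → ℝ} (hφ : HasCompactSupport φ) :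
    HasCompactSupport (∇ φ) :=
  hφ.mono' (support_gradient_subset φ)

theorem IsTest.eLpNorm_grad {v : H01 Ω} {φ : RN N → ℝ} (h : IsTest v φ) :
    eLpNorm (∇ φ) 2 volume = ‖gradL Ω v‖ₑ := by
  rw [← eLpNorm_restrict_eq_of_support_subset (s := Ω), ← eLpNorm_congr_ae h.2.2, Lp.enorm_def]
  · rfl
  · exact (support_gradient_subset φ).trans h.1.2.2

theorem IsTest.eLpNorm_fn {v : H01 Ω} {φ : RN N → ℝ} (h : IsTest v φ) :
    eLpNorm φ 2 volume = ‖fnL Ω v‖ₑ := by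
  rw [← eLpNorm_restrict_eq_of_support_subset (s := Ω), ← eLpNorm_congr_ae h.2.1, Lp.enorm_def]
  · rfl
  · exact (subset_tsupport φ).trans h.1.2.2

theorem exists_ae_tendsto_subseq {v : ℕ → H01 Ω} {u : H01 Ω}
    (h : Tendsto (fun n => fnL Ω (v n)) atTop (𝓝 (fnL Ω u))) :
    ∃ k : ℕ → ℕ, StrictMono k ∧
      ∀ᵐ x ∂(volume.restrict Ω), Tendsto (fun n => (v (k n)).fn x) atTop (𝓝 (u.fn x)) :=
  (tendstoInMeasure_of_tendsto_Lp h).exists_seq_tendsto_ae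

theorem sobolevExp_pos (hN : 3 ≤ N) : 0 < sobolevExp N := by
  have : (3 : ℝ) ≤ N := by exact_mod_cast hN
  unfold sobolevExp
  have : (0 : ℝ) < N - 2 := by linarith
  positivity

/-- The Sobolev inequality on `H₀¹(Ω)`. -/
theorem sobolev (hN : 3 ≤ N) :
    ∃ C : NNReal, ∀ (Ω : Set (RN N)) (u : H01 Ω),
      eLpNorm u.fn (ENNReal.ofReal (sobolevExp N)) (volume.restrict Ω) ≤ C * ‖gradL Ω u‖ₑ := by
  have hNR : (3 : ℝ) ≤ N := by exact_mod_cast hN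
  have hfr : Module.finrank ℝ (RN N) = N := by simp
  refine ⟨eLpNormLESNormFDerivOfEqInnerConst (volume : Measure (RN N)) 2, fun Ω u => ?_⟩
  set C := eLpNormLESNormFDerivOfEqInnerConst (volume : Measure (RN N)) 2
  have htest : ∀ (v : H01 Ω) (φ : RN N → ℝ), IsTest v φ →
      eLpNorm v.fn (ENNReal.ofReal (sobolevExp N)) (volume.restrict Ω) ≤ C * ‖gradL Ω v‖ₑ := by
    intro v φ h
    have key := eLpNorm_le_eLpNorm_fderiv_of_eq_inner (volume : Measure (RN N)) (u := φ)
      (h.1.1.of_le (by simp)) h.1.2.1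
      (p := 2) (p' := (sobolevExp N).toNNReal) (by norm_num) (by rw [hfr]; omega) (by
        rw [Real.coe_toNNReal _ (sobolevExp_pos hN).le, hfr, sobolevExp]
        have h2 : (N : ℝ) - 2 ≠ 0 := by linarith
        have h0 : (N : ℝ) ≠ 0 := by linarith
        push_cast
        field_simp)
    have e : eLpNorm (fderiv ℝ φ) 2 volume = eLpNorm (∇ φ) 2 volume :=
      eLpNorm_congr_norm_ae (.of_forall fun x => (norm_gradient φ x).symm)
    rw [← h.eLpNorm_grad, ← e, eLpNorm_congr_ae h.2.1]
    exact (eLpNorm_mono_measure _ Measure.restrict_le_self).trans (by exact_mod_cast key)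
  obtain ⟨v, φ, hv, hlim⟩ := exists_isTest_tendsto u
  obtain ⟨k, hk, hae⟩ := exists_ae_tendsto_subseq (((fnL Ω).continuous.tendsto u).comp hlim)
  have hlimk := hlim.comp hk.tendsto_atTop
  refine (Lp.eLpNorm_lim_le_liminf_eLpNorm (fun n => (memLp_fn (v (k n))).1) u.fn hae).trans ?_
  have ht : Tendsto (fun n => (C : ENNReal) * ‖gradL Ω (v (k n))‖ₑ) atTop
      (𝓝 (C * ‖gradL Ω u‖ₑ)) :=
    ENNReal.Tendsto.const_mul (((gradL Ω).continuous.enorm.tendsto u).comp hlimk)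
      (Or.inr ENNReal.coe_ne_top)
  rw [← ht.liminf_eq]
  exact liminf_le_liminf (.of_forall fun n => htest _ _ (hv _))

theorem memLp_sobolevExp (hN : 3 ≤ N) (u : H01 Ω) :
    MemLp u.fn (ENNReal.ofReal (sobolevExp N)) (volume.restrict Ω) := by
  obtain ⟨C, hC⟩ := sobolev hN
  exact ⟨(memLp_fn u).1, (hC Ω u).trans_lt (ENNReal.mul_lt_top ENNReal.coe_lt_top enorm_lt_top)⟩

theorem isFiniteMeasure_restrict (hΩ : Bornology.IsBounded Ω) :
    IsFiniteMeasure ((volume : Measure (RN N)).restrict Ω) :=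
  ⟨by simpa using hΩ.measure_lt_top⟩

theorem memLp_of_le (hN : 3 ≤ N) (hΩ : Bornology.IsBounded Ω) {s : ℝ} (hs : s ≤ sobolevExp N)
    (u : H01 Ω) : MemLp u.fn (ENNReal.ofReal s) (volume.restrict Ω) := by
  have := isFiniteMeasure_restrict hΩ
  exact (memLp_sobolevExp hN u).mono_exponent (ENNReal.ofReal_le_ofReal hs)

/-- The Sobolev embeddings `H₀¹(Ω) → L^s(Ω)`. -/
theorem exists_embedding (hN : 3 ≤ N) (hΩ : Bornology.IsBounded Ω) {s : ℝ} [hs1 : Fact (1 < s)]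
    (hs : s ≤ sobolevExp N) :
    ∃ ι : H01 Ω →L[ℝ] Lp ℝ (ENNReal.ofReal s) (volume.restrict Ω),
      ∀ u, ι u =ᵐ[volume.restrict Ω] u.fn := by
  have hfin := isFiniteMeasure_restrict hΩ
  obtain ⟨C, hC⟩ := sobolev hN
  set K : ENNReal := (volume.restrict Ω) Set.univ ^ (1 / (ENNReal.ofReal s).toReal -
    1 / (ENNReal.ofReal (sobolevExp N)).toReal) with hK
  have hKtop : K ≠ ⊤ := by
    refine ENNReal.rpow_ne_top_of_nonneg ?_ (measure_ne_top _ _)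
    rw [ENNReal.toReal_ofReal (by linarith [hs1.out]),
      ENNReal.toReal_ofReal (by linarith [hs1.out]), sub_nonneg]
    exact one_div_le_one_div_of_le (by linarith [hs1.out]) hs
  let L : H01 Ω →ₗ[ℝ] Lp ℝ (ENNReal.ofReal s) (volume.restrict Ω) :=
    { toFun := fun u => (memLp_of_le hN hΩ hs u).toLp _
      map_add' := fun u v => by
        rw [← MemLp.toLp_add, MemLp.toLp_eq_toLp_iff]
        exact fn_add u v
      map_smul' := fun c u => by
        rw [RingHom.id_apply, ← MemLp.toLp_const_smul, MemLp.toLp_eq_toLp_iff]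
        exact fn_smul c u }
  refine ⟨L.mkContinuous (C * K.toReal) fun u => ?_,
    fun u => (memLp_of_le hN hΩ hs u).coeFn_toLp⟩
  have h1 : eLpNorm u.fn (ENNReal.ofReal s) (volume.restrict Ω) ≤ C * ‖gradL Ω u‖ₑ * K :=
    (eLpNorm_le_eLpNorm_mul_rpow_measure_univ (ENNReal.ofReal_le_ofReal hs)
      (memLp_fn u).1).trans (by gcongr; exact hC Ω u)
  have h2 := ENNReal.toReal_mono (ENNReal.mul_ne_top
    (ENNReal.mul_ne_top ENNReal.coe_ne_top enorm_ne_top) hKtop) h1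
  rw [ENNReal.toReal_mul, ENNReal.toReal_mul, toReal_enorm, ENNReal.coe_toReal] at h2
  change ‖(memLp_of_le hN hΩ hs u).toLp _‖ ≤ _
  rw [Lp.norm_toLp]
  refine h2.trans ?_
  rw [mul_right_comm]
  gcongr
  exact norm_gradL_le u

end H01

end SobolevSpace

section Rellich

variable {N : ℕ} {Ω : Set (RN N)}

theorem sq_lintegral_le {α : Type*} [MeasurableSpace α] {P : Measure α} [IsProbabilityMeasure P]
    {h : α → ENNReal} (hh : AEMeasurable h P) : (∫⁻ x, h x ∂P) ^ 2 ≤ ∫⁻ x, h x ^ 2 ∂P := by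
  have := ENNReal.lintegral_mul_le_Lp_mul_Lq P Real.HolderConjugate.two_two hh
    (aemeasurable_const (b := (1 : ENNReal)))
  simp only [Pi.mul_apply, mul_one, one_pow, ENNReal.one_rpow, lintegral_const, measure_univ,
    ENNReal.rpow_two] at this
  calc (∫⁻ x, h x ∂P) ^ 2 ≤ ((∫⁻ x, h x ^ 2 ∂P) ^ (1 / 2 : ℝ)) ^ 2 := by gcongr
    _ = _ := by
      rw [← ENNReal.rpow_natCast, ← ENNReal.rpow_mul]; simp

theorem lintegral_enorm_sq_eq {α E : Type*} [MeasurableSpace α] {P : Measure α}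
    [NormedAddCommGroup E] (f : α → E) : ∫⁻ x, ‖f x‖ₑ ^ 2 ∂P = eLpNorm f 2 P ^ 2 := by
  have := eLpNorm_nnreal_pow_eq_lintegral (f := f) (μ := P) (p := 2) two_ne_zero
  simp only [NNReal.coe_ofNat, ENNReal.rpow_two, ENNReal.coe_ofNat] at this
  exact this.symm

theorem lintegral_translate_sub_sq_le {φ : RN N → ℝ} (hφ : ContDiff ℝ ∞ φ) (z : RN N) :
    ∫⁻ x, ‖φ (x + z) - φ x‖ₑ ^ 2 ≤ ‖z‖ₑ ^ 2 * ∫⁻ x, ‖∇ φ x‖ₑ ^ 2 := by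
  have hP : IsProbabilityMeasure ((volume : Measure ℝ).restrict (Set.Ioc 0 1)) := ⟨by simp⟩
  have hcont : Continuous (fderiv ℝ φ) := hφ.continuous_fderiv (by simp)
  have hdiff : Differentiable ℝ φ := hφ.differentiable (by simp)
  have hg := H01.continuous_gradient hφ
  have hpt : ∀ x, ‖φ (x + z) - φ x‖ₑ ^ 2 ≤
      ∫⁻ t in Set.Ioc (0 : ℝ) 1, ‖z‖ₑ ^ 2 * ‖∇ φ (x + t • z)‖ₑ ^ 2 := fun x => by
    have hder : ∀ t : ℝ, HasDerivAt (fun t : ℝ => φ (x + t • z)) (fderiv ℝ φ (x + t • z) z) t :=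
      fun t => by
        have h1 : HasDerivAt (fun t : ℝ => x + t • z) z t := by
          simpa using ((hasDerivAt_id t).smul_const z).const_add x
        exact (hdiff _).hasFDerivAt.comp_hasDerivAt t h1
    have hcd : Continuous fun t : ℝ => fderiv ℝ φ (x + t • z) z :=
      (hcont.comp (by fun_prop)).clm_apply continuous_const
    have hint : φ (x + z) - φ x = ∫ t in Set.Ioc (0 : ℝ) 1, fderiv ℝ φ (x + t • z) z := by
      rw [← intervalIntegral.integral_of_le zero_le_one,
        intervalIntegral.integral_eq_sub_of_hasDerivAt (fun t _ => hder t)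
          (hcd.intervalIntegrable _ _)]
      simp
    rw [hint]
    calc _ ≤ (∫⁻ t in Set.Ioc (0 : ℝ) 1, ‖fderiv ℝ φ (x + t • z) z‖ₑ) ^ 2 := by
          gcongr; exact enorm_integral_le_lintegral_enorm _
      _ ≤ ∫⁻ t in Set.Ioc (0 : ℝ) 1, ‖fderiv ℝ φ (x + t • z) z‖ₑ ^ 2 :=
          sq_lintegral_le hcd.measurable.enorm.aemeasurable
      _ ≤ _ := by
          refine lintegral_mono fun t => ?_
          rw [← mul_pow]
          gcongr
          rw [← ofReal_norm, ← ofReal_norm, ← ofReal_norm, ← ENNReal.ofReal_mul (norm_nonneg _),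
            H01.norm_gradient, mul_comm]
          exact ENNReal.ofReal_le_ofReal (ContinuousLinearMap.le_opNorm _ _)
  calc _ ≤ ∫⁻ x, ∫⁻ t in Set.Ioc (0 : ℝ) 1, ‖z‖ₑ ^ 2 * ‖∇ φ (x + t • z)‖ₑ ^ 2 :=
        lintegral_mono hpt
    _ = ∫⁻ t in Set.Ioc (0 : ℝ) 1, ∫⁻ x, ‖z‖ₑ ^ 2 * ‖∇ φ (x + t • z)‖ₑ ^ 2 := by
        refine lintegral_lintegral_swap (Measurable.aemeasurable ?_)
        refine Measurable.const_mul (Measurable.pow_const ?_ _) _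
        exact (hg.comp (by fun_prop : Continuous fun w : RN N × ℝ =>
          w.1 + w.2 • z)).measurable.enorm
    _ = ∫⁻ t in Set.Ioc (0 : ℝ) 1, ‖z‖ₑ ^ 2 * ∫⁻ x, ‖∇ φ x‖ₑ ^ 2 := by
        refine lintegral_congr fun t => ?_
        have hm : Measurable fun x => ‖∇ φ (x + t • z)‖ₑ ^ 2 :=
          (hg.comp (by fun_prop : Continuous fun x : RN N => x + t • z)).measurable.enorm.pow_const _
        rw [lintegral_const_mul _ hm,
          lintegral_add_right_eq_self (fun x => ‖∇ φ x‖ₑ ^ 2)]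
    _ = _ := by simp

/-- The mean value of `φ` over the ball of radius `ε` around `x`. -/
noncomputable def ballAverage (ε : ℝ) (φ : RN N → ℝ) (x : RN N) : ℝ :=
  ∫ z, φ (x + z) ∂(ProbabilityTheory.cond volume (Metric.ball (0 : RN N) ε))

theorem isProbabilityMeasure_cond_ball {ε : ℝ} (hε : 0 < ε) :
    IsProbabilityMeasure (ProbabilityTheory.cond volume (Metric.ball (0 : RN N) ε)) :=
  ProbabilityTheory.cond_isProbabilityMeasure_of_finite
    (Metric.measure_ball_pos volume _ hε).ne' measure_ball_lt_top.ne

theorem integrable_translate_cond {ε : ℝ} (hε : 0 < ε) {φ : RN N → ℝ} (hφ : Continuous φ)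
    (hc : HasCompactSupport φ) (x : RN N) : Integrable (fun z => φ (x + z))
      (ProbabilityTheory.cond volume (Metric.ball (0 : RN N) ε)) := by
  have := isProbabilityMeasure_cond_ball (N := N) hε
  obtain ⟨C, hC⟩ := hφ.bounded_above_of_compact_support hc
  exact (integrable_const C).mono' (hφ.comp (by fun_prop)).aestronglyMeasurable
    (.of_forall fun z => hC _)

theorem measurable_ballAverage (ε : ℝ) {φ : RN N → ℝ} (hφ : Continuous φ) :
    Measurable (ballAverage ε φ) := by
  have : Continuous (fun w : RN N × RN N => φ (w.1 + w.2)) := by fun_prop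
  exact (this.stronglyMeasurable.integral_prod_right).measurable

theorem lintegral_sub_ballAverage_sq_le {ε : ℝ} (hε : 0 < ε) {φ : RN N → ℝ}
    (hφ : ContDiff ℝ ∞ φ) (hc : HasCompactSupport φ) :
    ∫⁻ x, ‖φ x - ballAverage ε φ x‖ₑ ^ 2 ≤ ENNReal.ofReal ε ^ 2 * ∫⁻ x, ‖∇ φ x‖ₑ ^ 2 := by
  set P := ProbabilityTheory.cond volume (Metric.ball (0 : RN N) ε) with hP
  have hPp : IsProbabilityMeasure P := isProbabilityMeasure_cond_ball hε
  have hcont := hφ.continuous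
  have hpt : ∀ x, ‖φ x - ballAverage ε φ x‖ₑ ^ 2 ≤ ∫⁻ z, ‖φ (x + z) - φ x‖ₑ ^ 2 ∂P := fun x => by
    have h1 : ballAverage ε φ x - φ x = ∫ z, (φ (x + z) - φ x) ∂P := by
      rw [integral_sub (integrable_translate_cond hε hcont hc x) (integrable_const _)]
      simp [ballAverage]
    rw [← enorm_neg, neg_sub, h1]
    calc _ ≤ (∫⁻ z, ‖φ (x + z) - φ x‖ₑ ∂P) ^ 2 := by
          gcongr; exact enorm_integral_le_lintegral_enorm _
      _ ≤ _ := sq_lintegral_le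
          (by fun_prop : Continuous fun z => φ (x + z) - φ x).measurable.enorm.aemeasurable
  calc _ ≤ ∫⁻ x, ∫⁻ z, ‖φ (x + z) - φ x‖ₑ ^ 2 ∂P := lintegral_mono hpt
    _ = ∫⁻ z, (∫⁻ x, ‖φ (x + z) - φ x‖ₑ ^ 2) ∂P := by
        refine lintegral_lintegral_swap (Measurable.aemeasurable ?_)
        exact (by fun_prop : Continuous fun w : RN N × RN N =>
          φ (w.1 + w.2) - φ w.1).measurable.enorm.pow_const _
    _ ≤ ∫⁻ z, (ENNReal.ofReal ε ^ 2 * ∫⁻ x, ‖∇ φ x‖ₑ ^ 2) ∂P := by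
        refine lintegral_mono_ae ?_
        filter_upwards [ProbabilityTheory.ae_cond_mem (μ := volume)
          (measurableSet_ball (x := (0 : RN N)) (ε := ε))] with z hz
        refine (lintegral_translate_sub_sq_le hφ z).trans ?_
        gcongr
        rw [← ofReal_norm]
        exact ENNReal.ofReal_le_ofReal (by simpa using (mem_ball_zero_iff.1 hz).le)
    _ = _ := by simp

theorem enorm_ballAverage_sq_le {ε : ℝ} (hε : 0 < ε) {φ : RN N → ℝ} (hφ : Continuous φ)
    (x : RN N) : ‖ballAverage ε φ x‖ₑ ^ 2 ≤
      (volume (Metric.ball (0 : RN N) ε))⁻¹ * ∫⁻ x, ‖φ x‖ₑ ^ 2 := by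
  have hPp := isProbabilityMeasure_cond_ball (N := N) hε
  calc _ ≤ (∫⁻ z, ‖φ (x + z)‖ₑ ∂(ProbabilityTheory.cond volume (Metric.ball (0 : RN N) ε))) ^ 2 := by
        gcongr; exact enorm_integral_le_lintegral_enorm _
    _ ≤ ∫⁻ z, ‖φ (x + z)‖ₑ ^ 2 ∂(ProbabilityTheory.cond volume (Metric.ball (0 : RN N) ε)) :=
        sq_lintegral_le (by fun_prop : Continuous fun z => φ (x + z)).measurable.enorm.aemeasurable
    _ ≤ _ := by
        rw [ProbabilityTheory.cond, lintegral_smul_measure, smul_eq_mul]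
        refine mul_le_mul_right ?_ _
        refine (lintegral_mono' Measure.restrict_le_self le_rfl).trans (le_of_eq ?_)
        exact lintegral_add_left_eq_self (fun z => ‖φ z‖ₑ ^ 2) x

theorem ballAverage_eq_zero {ε : ℝ} {φ : RN N → ℝ} (hφ : tsupport φ ⊆ Ω) {x : RN N}
    (hx : x ∉ Metric.thickening ε Ω) : ballAverage ε φ x = 0 := by
  refine integral_eq_zero_of_ae ?_
  filter_upwards [ProbabilityTheory.ae_cond_mem (μ := volume)
    (measurableSet_ball (x := (0 : RN N)) (ε := ε))] with z hz
  by_contra hne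
  refine hx (Metric.mem_thickening_iff.2 ⟨x + z, hφ (subset_tsupport _ hne), ?_⟩)
  simpa using hz

theorem exists_ballAverage_eq {ε : ℝ} (x : RN N) :
    ∃ ℓ : H01 Ω →L[ℝ] ℝ, ∀ v φ, H01.IsTest v φ → ballAverage ε φ x = ℓ v := by
  have hfin : (volume.restrict Ω) (Metric.ball x ε) ≠ ⊤ :=
    ((Measure.restrict_le_self _).trans_lt measure_ball_lt_top).ne
  refine ⟨((volume (Metric.ball (0 : RN N) ε))⁻¹.toReal •
    innerSL ℝ (indicatorConstLp 2 measurableSet_ball hfin (1 : ℝ))).comp (H01.fnL Ω),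
    fun v φ h => ?_⟩
  simp only [ContinuousLinearMap.comp_apply, _root_.smul_apply, innerSL_apply_apply, smul_eq_mul]
  rw [L2.inner_indicatorConstLp_one, ballAverage, ProbabilityTheory.cond, integral_smul_measure,
    smul_eq_mul]
  congr 1
  have e1 : ∫ y in Metric.ball x ε, H01.fnL Ω v y ∂(volume.restrict Ω) =
      ∫ y in Metric.ball x ε, φ y := by
    rw [setIntegral_congr_ae measurableSet_ball (g := φ)
      (by filter_upwards [h.2.1] with y hy _ using hy),
      Measure.restrict_restrict measurableSet_ball]
    refine (setIntegral_eq_of_subset_of_forall_sdiff_eq_zero measurableSet_ball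
      Set.inter_subset_left fun y hy => ?_).symm
    by_contra hne
    exact hy.2 ⟨hy.1, h.1.2.2 (subset_tsupport _ hne)⟩
  rw [e1, ← integral_indicator measurableSet_ball, ← integral_indicator measurableSet_ball,
    
    ← integral_add_left_eq_self ((Metric.ball x ε).indicator φ) x]
  refine integral_congr_ae (.of_forall fun z => ?_)
  simp [Set.indicator]

theorem tendsto_lintegral_ballAverage (hΩb : Bornology.IsBounded Ω)
    {ε : ℝ} (hε : 0 < ε) {v : ℕ → H01 Ω} {φ : ℕ → RN N → ℝ} (hv : ∀ n, H01.IsTest (v n) (φ n))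
    {R : ℝ} (hR : ∀ n, ‖v n‖ ≤ R)
    (hw : ∀ ℓ : H01 Ω →L[ℝ] ℝ, Tendsto (fun n => ℓ (v n)) atTop (𝓝 0)) :
    Tendsto (fun n => ∫⁻ x, ‖ballAverage ε (φ n) x‖ₑ ^ 2) atTop (𝓝 0) := by
  set B := (volume (Metric.ball (0 : RN N) ε))⁻¹ * ENNReal.ofReal R ^ 2 with hB
  have hBtop : B ≠ ⊤ := ENNReal.mul_ne_top
    (ENNReal.inv_ne_top.2 (Metric.measure_ball_pos volume _ hε).ne') (by simp)
  rw [← lintegral_zero (μ := (volume : Measure (RN N)))]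
  refine tendsto_lintegral_of_dominated_convergence
    ((Metric.thickening ε Ω).indicator fun _ => B)
    (fun n => (measurable_ballAverage ε (hv n).1.1.continuous).enorm.pow_const _)
    (fun n => .of_forall fun x => ?_) ?_ (.of_forall fun x => ?_)
  · by_cases hx : x ∈ Metric.thickening ε Ω
    · rw [Set.indicator_of_mem hx]
      refine (enorm_ballAverage_sq_le hε (hv n).1.1.continuous x).trans ?_
      rw [lintegral_enorm_sq_eq, (hv n).eLpNorm_fn, hB]
      gcongr
      rw [← ofReal_norm]
      exact ENNReal.ofReal_le_ofReal ((H01.norm_fnL_le _).trans (hR n))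
    · change ‖ballAverage ε (φ n) x‖ₑ ^ 2 ≤ _
      rw [ballAverage_eq_zero (hv n).1.2.2 hx]; simp
  · rw [lintegral_indicator Metric.isOpen_thickening.measurableSet, lintegral_const]
    refine ENNReal.mul_ne_top hBtop ?_
    simpa using hΩb.thickening.measure_lt_top.ne
  · obtain ⟨ℓ, hℓ⟩ := exists_ballAverage_eq (ε := ε) x
    have h1 : Tendsto (fun n => ballAverage ε (φ n) x) atTop (𝓝 0) :=
      (hw ℓ).congr fun n => (hℓ _ _ (hv n)).symm
    have h2 := (ENNReal.continuous_pow 2).tendsto _ |>.comp h1.enorm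
    simpa [Function.comp_def] using h2

theorem tendsto_fnL_of_isTest (hΩb : Bornology.IsBounded Ω)
    {v : ℕ → H01 Ω} {φ : ℕ → RN N → ℝ} (hv : ∀ n, H01.IsTest (v n) (φ n))
    {R : ℝ} (hR : ∀ n, ‖v n‖ ≤ R)
    (hw : ∀ ℓ : H01 Ω →L[ℝ] ℝ, Tendsto (fun n => ℓ (v n)) atTop (𝓝 0)) :
    Tendsto (fun n => ‖H01.fnL Ω (v n)‖) atTop (𝓝 0) := by
  have hR0 : 0 ≤ R := (norm_nonneg _).trans (hR 0)
  have key : ∀ ε : ℝ, 0 < ε → ∀ᶠ n in atTop,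
      ‖H01.fnL Ω (v n)‖ ^ 2 ≤ 2 * (ε ^ 2 * R ^ 2) + 2 * ε := by
    intro ε hε
    have ht := tendsto_lintegral_ballAverage hΩb hε hv hR hw
    filter_upwards [ht.eventually_lt_const (ENNReal.ofReal_pos.2 hε)] with n hn
    have hc := (hv n).1.1.continuous
    have hb := measurable_ballAverage ε hc
    have h1 : ∫⁻ x, ‖φ n x‖ₑ ^ 2 ≤ 2 * (∫⁻ x, ‖φ n x - ballAverage ε (φ n) x‖ₑ ^ 2) +
        2 * ∫⁻ x, ‖ballAverage ε (φ n) x‖ₑ ^ 2 := by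
      have hm : Measurable fun x => ‖φ n x - ballAverage ε (φ n) x‖ₑ ^ 2 :=
        (hc.measurable.sub hb).enorm.pow_const _
      rw [← lintegral_const_mul _ hm, ← lintegral_const_mul _ (hb.enorm.pow_const _),
        ← lintegral_add_left (hm.const_mul _)]
      refine lintegral_mono fun x => ?_
      have : ∀ a b : ℝ, ‖a‖ₑ ^ 2 ≤ 2 * ‖a - b‖ₑ ^ 2 + 2 * ‖b‖ₑ ^ 2 := fun a b => by
        simp only [← ofReal_norm, ← ENNReal.ofReal_pow (norm_nonneg _)]
        rw [← ENNReal.ofReal_ofNat 2, ← ENNReal.ofReal_mul (by norm_num),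
          ← ENNReal.ofReal_mul (by norm_num), ← ENNReal.ofReal_add (by positivity) (by positivity)]
        refine ENNReal.ofReal_le_ofReal ?_
        simp only [Real.norm_eq_abs, sq_abs]
        nlinarith [sq_nonneg (a - 2 * b)]
      exact this _ _
    have h2 := lintegral_sub_ballAverage_sq_le hε (hv n).1.1 (hv n).1.2.1
    rw [lintegral_enorm_sq_eq, (hv n).eLpNorm_fn] at h1
    rw [lintegral_enorm_sq_eq (∇ (φ n)), (hv n).eLpNorm_grad] at h2
    have h3 : ‖H01.fnL Ω (v n)‖ₑ ^ 2 ≤ ENNReal.ofReal (2 * (ε ^ 2 * R ^ 2) + 2 * ε) := by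
      rw [ENNReal.ofReal_add (by positivity) (by positivity), ENNReal.ofReal_mul zero_le_two,
        ENNReal.ofReal_mul zero_le_two, ENNReal.ofReal_mul (sq_nonneg _),
        ENNReal.ofReal_pow hε.le, ENNReal.ofReal_pow hR0, ENNReal.ofReal_ofNat]
      refine h1.trans (add_le_add (mul_le_mul_right (h2.trans ?_) _) (mul_le_mul_right hn.le _))
      refine mul_le_mul_right (pow_le_pow_left' ?_ 2) _
      rw [← ofReal_norm]
      exact ENNReal.ofReal_le_ofReal ((H01.norm_gradL_le _).trans (hR n))
    rw [← ofReal_norm, ← ENNReal.ofReal_pow (norm_nonneg _)] at h3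
    exact (ENNReal.ofReal_le_ofReal_iff (by positivity)).1 h3
  have hsq : Tendsto (fun n => ‖H01.fnL Ω (v n)‖ ^ 2) atTop (𝓝 0) := by
    rw [Metric.tendsto_nhds]
    intro η hη
    have hlim : Tendsto (fun ε : ℝ => 2 * (ε ^ 2 * R ^ 2) + 2 * ε) (𝓝[>] 0) (𝓝 0) := by
      have : Continuous (fun ε : ℝ => 2 * (ε ^ 2 * R ^ 2) + 2 * ε) := by fun_prop
      simpa using (this.tendsto 0).mono_left nhdsWithin_le_nhds
    obtain ⟨ε, hε1, hε⟩ := ((hlim.eventually_lt_const hη).and self_mem_nhdsWithin).exists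
    filter_upwards [key ε hε] with n hn
    rw [Real.dist_eq, sub_zero, abs_of_nonneg (by positivity)]
    exact hn.trans_lt hε1
  have := hsq.sqrt
  simpa [Real.sqrt_sq (norm_nonneg _)] using this

/-- Rellich's theorem: weakly null sequences of `H₀¹(Ω)` converge to zero in `L²(Ω)`. -/
theorem rellich (hΩb : Bornology.IsBounded Ω)
    {w : ℕ → H01 Ω} {R : ℝ} (hR : ∀ n, ‖w n‖ ≤ R)
    (hw : ∀ ℓ : H01 Ω →L[ℝ] ℝ, Tendsto (fun n => ℓ (w n)) atTop (𝓝 0)) :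
    Tendsto (fun n => H01.fnL Ω (w n)) atTop (𝓝 0) := by
  have h : ∀ n : ℕ, ∃ (v : H01 Ω) (φ : RN N → ℝ), H01.IsTest v φ ∧
      ‖w n - v‖ < 1 / ((n : ℝ) + 1) :=
    fun n => H01.exists_isTest_norm_sub_lt (w n) (by positivity)
  choose v φ h1 h2 using h
  have hdiff : Tendsto (fun n => w n - v n) atTop (𝓝 0) :=
    squeeze_zero_norm (fun n => (h2 n).le) tendsto_one_div_add_atTop_nhds_zero_nat
  have hv : Tendsto (fun n => ‖H01.fnL Ω (v n)‖) atTop (𝓝 0) := by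
    refine tendsto_fnL_of_isTest hΩb h1 (R := R + 1) (fun n => ?_) fun ℓ => ?_
    · have : ‖v n‖ ≤ ‖w n‖ + ‖w n - v n‖ := by
        rw [add_comm, ← norm_sub_rev (v n)]
        simpa using norm_add_le (v n - w n) (w n)
      have h3 : 1 / ((n : ℝ) + 1) ≤ 1 := by
        rw [div_le_one (by positivity)]; linarith [(Nat.cast_nonneg n : (0 : ℝ) ≤ n)]
      linarith [hR n, (h2 n).le]
    · have := (hw ℓ).sub ((ℓ.continuous.tendsto 0).comp hdiff)
      simpa [Function.comp_def] using this
  have h3 := (((H01.fnL Ω).continuous.tendsto 0).comp hdiff).add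
    (tendsto_zero_iff_norm_tendsto_zero.2 hv)
  simpa [Function.comp_def] using h3

end Rellich

section Tensor

variable {N : ℕ} {Ω : Set (RN N)}

theorem one_lt_hlsExp (hN : 3 ≤ N) {μ : ℝ} (hμ : μ < N) : 1 < hlsExp N μ := by
  have hNR : (3 : ℝ) ≤ N := by exact_mod_cast hN
  rw [hlsExp, lt_div_iff₀ (by linarith)]; linarith

theorem hlsExp_lt_sobolevExp (hN : 3 ≤ N) {μ : ℝ} (hμ0 : 0 < μ) : hlsExp N μ < sobolevExp N := by
  have hNR : (3 : ℝ) ≤ N := by exact_mod_cast hN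
  rw [hlsExp, sobolevExp]
  exact div_lt_div_of_pos_right (by linarith) (by linarith)

theorem hlsExp_mul_rieszExp (hN : 3 ≤ N) {μ : ℝ} (hμ : μ < N) :
    hlsExp N μ * rieszExp N μ = sobolevExp N := by
  have hNR : (3 : ℝ) ≤ N := by exact_mod_cast hN
  have h1 : 2 * (N : ℝ) - μ ≠ 0 := by linarith
  have h2 : (N : ℝ) - 2 ≠ 0 := by linarith
  rw [hlsExp, rieszExp, sobolevExp]
  field_simp

theorem lintegral_enorm_rpow_eq {α : Type*} [MeasurableSpace α] {P : Measure α} {p : ℝ}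
    (hp : 0 < p) (f : α → ℝ) :
    ∫⁻ x, ‖f x‖ₑ ^ p ∂P = eLpNorm f (ENNReal.ofReal p) P ^ p := by
  rw [eLpNorm_eq_lintegral_rpow_enorm_toReal (by simpa using hp) (by simp),
    ENNReal.toReal_ofReal hp.le, ← ENNReal.rpow_mul, one_div_mul_cancel hp.ne', ENNReal.rpow_one]

theorem rpow_le_interpolate {s S : ℝ} (hs : 1 < s) (hS : s < S) {δ : ℝ} (hδ : 0 < δ) :
    ∃ C : ℝ, 0 ≤ C ∧ ∀ a : ℝ, 0 ≤ a → a ^ s ≤ δ * a ^ S + C * a := by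
  obtain ⟨m, hm, hmδ⟩ : ∃ m : ℝ, 0 < m ∧ m ^ (s - S) = δ :=
    ⟨δ ^ (s - S)⁻¹, by positivity, Real.rpow_inv_rpow hδ.le (by linarith)⟩
  refine ⟨m ^ (s - 1), by positivity, fun a ha => ?_⟩
  rcases le_total a m with h | h
  · have h1 : a ^ s = a ^ (s - 1) * a := by
      rw [← Real.rpow_add_one' ha (by linarith)]; simp
    have h2 : a ^ (s - 1) ≤ m ^ (s - 1) := Real.rpow_le_rpow ha h (by linarith)
    rw [h1]
    have : 0 ≤ δ * a ^ S := by positivity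
    nlinarith
  · have ha' : 0 < a := hm.trans_le h
    have h1 : a ^ s = a ^ (s - S) * a ^ S := by rw [← Real.rpow_add ha']; simp
    have h2 : a ^ (s - S) ≤ m ^ (s - S) := Real.rpow_le_rpow_of_nonpos hm h (by linarith)
    rw [h1, ← hmδ]
    have : 0 ≤ m ^ (s - 1) * a := by positivity
    have h3 : 0 ≤ a ^ S := by positivity
    nlinarith

/-- The subcritical embeddings are compact. -/
theorem tendsto_embedding (hN : 3 ≤ N) (hΩ : Bornology.IsBounded Ω) {s : ℝ} [hs1 : Fact (1 < s)]
    (hs : s < sobolevExp N) {ι : H01 Ω →L[ℝ] Lp ℝ (ENNReal.ofReal s) (volume.restrict Ω)}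
    (hι : ∀ u, ι u =ᵐ[volume.restrict Ω] u.fn) {w : ℕ → H01 Ω} {R : ℝ} (hR : ∀ n, ‖w n‖ ≤ R)
    (hw : Tendsto (fun n => H01.fnL Ω (w n)) atTop (𝓝 0)) :
    Tendsto (fun n => ι (w n)) atTop (𝓝 0) := by
  have hfin := H01.isFiniteMeasure_restrict hΩ
  have hs0 : 0 < s := by linarith [hs1.out]
  have : Fact (1 < sobolevExp N) := ⟨hs1.out.trans hs⟩
  have hS0 := H01.sobolevExp_pos hN
  have hR0 : 0 ≤ R := (norm_nonneg _).trans (hR 0)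
  obtain ⟨j, hj⟩ := H01.exists_embedding hN hΩ (le_refl (sobolevExp N))
  have hL1 : Tendsto (fun n => ∫ x in Ω, |(w n).fn x|) atTop (𝓝 0) := by
    have hb : ∀ n, ∫ x in Ω, |(w n).fn x| ≤
        ‖H01.fnL Ω (w n)‖ * (volume.restrict Ω).real Set.univ ^ (1 / 2 : ℝ) := fun n => by
      have h1 := eLpNorm_le_eLpNorm_mul_rpow_measure_univ (p := 1) (q := 2)
        (by norm_num) (H01.memLp_fn (w n)).1
      have h2 := ENNReal.toReal_mono (ENNReal.mul_ne_top (H01.memLp_fn (w n)).2.ne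
        (ENNReal.rpow_ne_top_of_nonneg (by norm_num) (measure_ne_top _ _))) h1
      rw [ENNReal.toReal_mul, ← ENNReal.toReal_rpow] at h2
      have h3 : (eLpNorm (w n).fn 1 (volume.restrict Ω)).toReal = ∫ x in Ω, |(w n).fn x| := by
        rw [eLpNorm_one_eq_lintegral_enorm, ← integral_norm_eq_lintegral_enorm
          (H01.memLp_fn (w n)).1]
        rfl
      rw [h3] at h2
      refine h2.trans (le_of_eq ?_)
      congr 2
      norm_num
    refine squeeze_zero (fun n => integral_nonneg fun x => abs_nonneg _) hb ?_
    simpa using hw.norm.mul_const _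
  have hpow : Tendsto (fun n => ‖ι (w n)‖ ^ s) atTop (𝓝 0) := by
    rw [Metric.tendsto_nhds]
    intro η hη
    set D := (‖j‖ * R) ^ sobolevExp N with hD
    have hD0 : 0 ≤ D := by positivity
    obtain ⟨C, hC0, hC⟩ := rpow_le_interpolate hs1.out hs
      (δ := η / 2 / (D + 1)) (by positivity)
    have hC1 : Tendsto (fun n => C * ∫ x in Ω, |(w n).fn x|) atTop (𝓝 0) := by
      simpa using hL1.const_mul C
    filter_upwards [hC1.eventually_lt_const (half_pos hη)] with n hn
    rw [Real.dist_eq, sub_zero, abs_of_nonneg (by positivity)]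
    have hi1 : Integrable (fun x => |(w n).fn x|) (volume.restrict Ω) :=
      ((H01.memLp_fn (w n)).integrable (by norm_num)).abs
    have hiS := integrable_abs_rpow hS0 (j (w n))
    have hjD : ‖j (w n)‖ ^ sobolevExp N ≤ D := by
      refine Real.rpow_le_rpow (norm_nonneg _) ?_ hS0.le
      exact (j.le_opNorm _).trans (by gcongr; exact hR n)
    calc ‖ι (w n)‖ ^ s = ∫ x in Ω, |ι (w n) x| ^ s := norm_rpow_eq_integral hs0 _
      _ ≤ ∫ x in Ω, (η / 2 / (D + 1) * |j (w n) x| ^ sobolevExp N + C * |(w n).fn x|) := by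
          refine integral_mono_ae (integrable_abs_rpow hs0 _)
            ((hiS.const_mul _).add (hi1.const_mul _)) ?_
          filter_upwards [hι (w n), hj (w n)] with x h1 h2
          simp only [h1, h2]
          exact hC _ (abs_nonneg _)
      _ = η / 2 / (D + 1) * ‖j (w n)‖ ^ sobolevExp N + C * ∫ x in Ω, |(w n).fn x| := by
          rw [integral_add (hiS.const_mul _) (hi1.const_mul _), integral_const_mul,
            integral_const_mul, norm_rpow_eq_integral hS0]
      _ < η / 2 + η / 2 := by
          refine add_lt_add_of_le_of_lt ?_ hn
          rw [div_mul_eq_mul_div, div_le_iff₀ (by positivity)]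
          nlinarith
      _ = η := by ring
  have h1 := hpow.rpow_const (p := s⁻¹) (Or.inr (by positivity))
  rw [Real.zero_rpow (by positivity)] at h1
  rw [tendsto_zero_iff_norm_tendsto_zero]
  refine h1.congr fun n => ?_
  rw [Real.rpow_rpow_inv (norm_nonneg _) hs0.ne']

/-- The measure `|x - y| ^ (-μ) dν(x) dν(y)`. -/
noncomputable def rieszMeasure (μ : ℝ) (ν : Measure (RN N)) : Measure (RN N × RN N) :=
  (ν.prod ν).withDensity fun z => rieszKernel μ z.1 z.2

theorem lintegral_rieszMeasure (μ : ℝ) (ν : Measure (RN N)) [SFinite ν]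
    {F : RN N × RN N → ENNReal} (hF : Measurable F) :
    ∫⁻ z, F z ∂(rieszMeasure μ ν) = ∫⁻ x, ∫⁻ y, F (x, y) * rieszKernel μ x y ∂ν ∂ν := by
  rw [rieszMeasure, lintegral_withDensity_eq_lintegral_mul _ (measurable_rieszKernel μ) hF,
    lintegral_prod _ ((measurable_rieszKernel μ).mul hF).aemeasurable]
  simp only [Pi.mul_apply, mul_comm]

theorem ae_rieszMeasure_fst {μ : ℝ} {ν : Measure (RN N)} [SFinite ν] {P : RN N → Prop}
    (h : ∀ᵐ x ∂ν, P x) : ∀ᵐ z ∂(rieszMeasure μ ν), P z.1 :=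
  (withDensity_absolutelyContinuous _ _).ae_le (Measure.quasiMeasurePreserving_fst.ae h)

theorem ae_rieszMeasure_snd {μ : ℝ} {ν : Measure (RN N)} [SFinite ν] {P : RN N → Prop}
    (h : ∀ᵐ x ∂ν, P x) : ∀ᵐ z ∂(rieszMeasure μ ν), P z.2 :=
  (withDensity_absolutelyContinuous _ _).ae_le (Measure.quasiMeasurePreserving_snd.ae h)

theorem lintegral_tensor_rpow {μ p : ℝ} (hp : 0 < p) (ν : Measure (RN N)) [SFinite ν]
    {u v : RN N → ℝ} (hu : Measurable u) (hv : Measurable v) :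
    eLpNorm (fun z : RN N × RN N => u z.1 * v z.2) (ENNReal.ofReal p) (rieszMeasure μ ν) ^ p =
      ∫⁻ x, ∫⁻ y, ‖u x‖ₑ ^ p * ‖v y‖ₑ ^ p * rieszKernel μ x y ∂ν ∂ν := by
  rw [← lintegral_enorm_rpow_eq hp, lintegral_rieszMeasure]
  · simp only [enorm_mul, ENNReal.mul_rpow_of_nonneg _ _ hp.le]
  · exact (((hu.comp measurable_fst).mul (hv.comp measurable_snd)).enorm.pow_const _)

theorem exists_eLpNorm_tensor_le (hN : 3 ≤ N) {μ : ℝ} (hμ0 : 0 < μ) (hμ : μ < N) :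
    ∃ C : ENNReal, C ≠ ⊤ ∧ ∀ (ν : Measure (RN N)) [SFinite ν], ν ≤ volume →
      ∀ u v : RN N → ℝ, Measurable u → Measurable v →
      MemLp u (ENNReal.ofReal (sobolevExp N)) ν → MemLp v (ENNReal.ofReal (sobolevExp N)) ν →
      eLpNorm (fun z : RN N × RN N => u z.1 * v z.2) (ENNReal.ofReal (hlsExp N μ))
        (rieszMeasure μ ν) ≤ C * (eLpNorm u (ENNReal.ofReal (sobolevExp N)) ν *
          eLpNorm v (ENNReal.ofReal (sobolevExp N)) ν) := by
  obtain ⟨c, hc, h⟩ := hardy_littlewood_sobolev (by omega : 0 < N) hμ0 hμ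
  have hp : 0 < hlsExp N μ := by linarith [one_lt_hlsExp hN hμ]
  have hr : 0 < rieszExp N μ := (rieszExp_holderConjugate (by omega) hμ0 hμ).pos
  have hS := H01.sobolevExp_pos hN
  refine ⟨c ^ (1 / hlsExp N μ), ENNReal.rpow_ne_top_of_nonneg (by positivity) hc,
    fun ν _ hν u v hu hv hum hvm => ?_⟩
  have e1 : ∀ f : RN N → ℝ, ∫⁻ x, (‖f x‖ₑ ^ hlsExp N μ) ^ rieszExp N μ ∂ν =
      eLpNorm f (ENNReal.ofReal (sobolevExp N)) ν ^ sobolevExp N := fun f => by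
    rw [← lintegral_enorm_rpow_eq hS]
    simp only [← ENNReal.rpow_mul, hlsExp_mul_rieszExp hN hμ]
  have e2 : ∀ f : RN N → ℝ, (eLpNorm f (ENNReal.ofReal (sobolevExp N)) ν ^ sobolevExp N) ^
      (1 / rieszExp N μ) = eLpNorm f (ENNReal.ofReal (sobolevExp N)) ν ^ hlsExp N μ := fun f => by
    rw [← ENNReal.rpow_mul, ← hlsExp_mul_rieszExp hN hμ, mul_assoc, mul_one_div_cancel hr.ne',
      mul_one]
  have key := h ν hν (fun x => ‖u x‖ₑ ^ hlsExp N μ) (fun x => ‖v x‖ₑ ^ hlsExp N μ)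
    (hu.enorm.pow_const _) (hv.enorm.pow_const _)
    (by rw [e1]; exact ENNReal.rpow_ne_top_of_nonneg hS.le hum.2.ne)
    (by rw [e1]; exact ENNReal.rpow_ne_top_of_nonneg hS.le hvm.2.ne)
  rw [e1, e1, e2, e2, ← lintegral_tensor_rpow hp ν hu hv] at key
  have := ENNReal.rpow_le_rpow key (by positivity : 0 ≤ 1 / hlsExp N μ)
  rw [← ENNReal.rpow_mul, mul_one_div_cancel hp.ne', ENNReal.rpow_one,
    ENNReal.mul_rpow_of_nonneg _ _ (by positivity), ENNReal.mul_rpow_of_nonneg _ _ (by positivity),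
    ← ENNReal.rpow_mul, ← ENNReal.rpow_mul, mul_one_div_cancel hp.ne', ENNReal.rpow_one,
    ENNReal.rpow_one] at this
  exact this

theorem choquard_eq_integral {μ : ℝ} (A : Set (RN N)) {f : RN N → ℝ}
    (hI : Integrable (fun z : RN N × RN N => |f z.1 * f z.2| ^ hlsExp N μ)
      (rieszMeasure μ (volume.restrict A))) :
    choquard μ A f =
      ∫ z, |f z.1 * f z.2| ^ hlsExp N μ ∂(rieszMeasure μ (volume.restrict A)) := by
  have hlt : ∀ᵐ z ∂((volume.restrict A).prod (volume.restrict A)),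
      rieszKernel μ (z : RN N × RN N).1 z.2 < ⊤ :=
    .of_forall fun z => ENNReal.ofReal_lt_top
  rw [rieszMeasure, integrable_withDensity_iff_integrable_smul' (measurable_rieszKernel μ) hlt] at hI
  rw [rieszMeasure, integral_withDensity_eq_integral_toReal_smul (measurable_rieszKernel μ) hlt,
    integral_prod _ hI, choquard]
  refine integral_congr_ae (.of_forall fun x => integral_congr_ae (.of_forall fun y => ?_))
  simp only [smul_eq_mul, rieszKernel]
  rw [ENNReal.toReal_ofReal (by positivity), abs_mul,
    Real.mul_rpow (abs_nonneg _) (abs_nonneg _), Real.rpow_neg (norm_nonneg _)]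
  ring

theorem memLp_tensor (hN : 3 ≤ N) {μ : ℝ} (hμ0 : 0 < μ) (hμ : μ < N) {ν : Measure (RN N)}
    [SFinite ν] (hν : ν ≤ volume) {u v : RN N → ℝ} (hu : Measurable u) (hv : Measurable v)
    (hum : MemLp u (ENNReal.ofReal (sobolevExp N)) ν)
    (hvm : MemLp v (ENNReal.ofReal (sobolevExp N)) ν) :
    MemLp (fun z : RN N × RN N => u z.1 * v z.2) (ENNReal.ofReal (hlsExp N μ))
      (rieszMeasure μ ν) := by
  obtain ⟨C, hC, h⟩ := exists_eLpNorm_tensor_le hN hμ0 hμ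
  refine ⟨((hu.comp measurable_fst).mul (hv.comp measurable_snd)).aestronglyMeasurable, ?_⟩
  exact (h ν hν u v hu hv hum hvm).trans_lt
    (ENNReal.mul_lt_top hC.lt_top (ENNReal.mul_lt_top hum.2 hvm.2))

/-- Bounded bilinear maps between normed spaces. -/
abbrev BilinMap (X Z : Type*) [NormedAddCommGroup X] [NormedSpace ℝ X] [NormedAddCommGroup Z]
    [NormedSpace ℝ Z] : Type _ := X →L[ℝ] X →L[ℝ] Z

/-- The tensor product `(u, v) ↦ u(x) v(y)` as a bounded bilinear map into `L^p` of the measure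
`|x - y| ^ (-μ) dx dy`. -/
theorem exists_tensor (hN : 3 ≤ N) {μ : ℝ} (hμ0 : 0 < μ) (hμ : μ < N) (Ω : Set (RN N))
    [Fact (1 < hlsExp N μ)] :
    ∃ T : BilinMap (H01 Ω)
        (Lp ℝ (ENNReal.ofReal (hlsExp N μ)) (rieszMeasure μ (volume.restrict Ω))),
      ∀ u v, T u v =ᵐ[rieszMeasure μ (volume.restrict Ω)] fun z => u.fn z.1 * v.fn z.2 := by
  have hm : ∀ u v : H01 Ω, MemLp (fun z : RN N × RN N => u.fn z.1 * v.fn z.2)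
      (ENNReal.ofReal (hlsExp N μ)) (rieszMeasure μ (volume.restrict Ω)) := fun u v =>
    memLp_tensor hN hμ0 hμ Measure.restrict_le_self u.stronglyMeasurable_fn.measurable
      v.stronglyMeasurable_fn.measurable (H01.memLp_sobolevExp hN u) (H01.memLp_sobolevExp hN v)
  obtain ⟨C, hC, h⟩ := exists_eLpNorm_tensor_le hN hμ0 hμ
  obtain ⟨K, hK⟩ := H01.sobolev hN
  let L : H01 Ω →ₗ[ℝ] H01 Ω →ₗ[ℝ]
      Lp ℝ (ENNReal.ofReal (hlsExp N μ)) (rieszMeasure μ (volume.restrict Ω)) :=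
    LinearMap.mk₂ ℝ (fun u v => (hm u v).toLp _)
      (fun u u' v => by
        rw [← MemLp.toLp_add, MemLp.toLp_eq_toLp_iff]
        filter_upwards [ae_rieszMeasure_fst (H01.fn_add u u')] with z hz
        simp only [hz, Pi.add_apply]; ring)
      (fun c u v => by
        rw [← MemLp.toLp_const_smul, MemLp.toLp_eq_toLp_iff]
        filter_upwards [ae_rieszMeasure_fst (H01.fn_smul c u)] with z hz
        simp only [hz, Pi.smul_apply, smul_eq_mul]; ring)
      (fun u v v' => by
        rw [← MemLp.toLp_add, MemLp.toLp_eq_toLp_iff]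
        filter_upwards [ae_rieszMeasure_snd (H01.fn_add v v')] with z hz
        simp only [hz, Pi.add_apply]; ring)
      (fun c u v => by
        rw [← MemLp.toLp_const_smul, MemLp.toLp_eq_toLp_iff]
        filter_upwards [ae_rieszMeasure_snd (H01.fn_smul c v)] with z hz
        simp only [hz, Pi.smul_apply, smul_eq_mul]; ring)
  refine ⟨L.mkContinuous₂ (C.toReal * K * K) fun u v => ?_, fun u v => (hm u v).coeFn_toLp⟩
  change ‖(hm u v).toLp _‖ ≤ _
  rw [Lp.norm_toLp]
  have h1 := (h (volume.restrict Ω) Measure.restrict_le_self u.fn v.fn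
    u.stronglyMeasurable_fn.measurable v.stronglyMeasurable_fn.measurable
    (H01.memLp_sobolevExp hN u) (H01.memLp_sobolevExp hN v)).trans
    (mul_le_mul_right (mul_le_mul' (hK Ω u) (hK Ω v)) C)
  have h2 := ENNReal.toReal_mono (ENNReal.mul_ne_top hC (ENNReal.mul_ne_top
    (ENNReal.mul_ne_top ENNReal.coe_ne_top enorm_ne_top)
    (ENNReal.mul_ne_top ENNReal.coe_ne_top enorm_ne_top))) h1
  simp only [ENNReal.toReal_mul, ENNReal.coe_toReal, toReal_enorm] at h2
  calc _ ≤ C.toReal * (K * ‖H01.gradL Ω u‖ * (K * ‖H01.gradL Ω v‖)) := h2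
    _ ≤ C.toReal * (K * ‖u‖ * (K * ‖v‖)) := by
        gcongr
        · exact H01.norm_gradL_le u
        · exact H01.norm_gradL_le v
    _ = _ := by ring

theorem tendsto_bilinMap_of_dense {X Z : Type*} [NormedAddCommGroup X] [NormedSpace ℝ X]
    [NormedAddCommGroup Z] [NormedSpace ℝ Z] (T : BilinMap X Z) {w : ℕ → X} {R : ℝ}
    (hR : ∀ n, ‖w n‖ ≤ R) (u : X)
    (h : ∀ ε > 0, ∃ v, ‖u - v‖ < ε ∧ Tendsto (fun n => ‖T (w n) v‖) atTop (𝓝 0)) :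
    Tendsto (fun n => T (w n) u) atTop (𝓝 0) := by
  have hR0 : 0 ≤ R := (norm_nonneg _).trans (hR 0)
  rw [tendsto_zero_iff_norm_tendsto_zero, Metric.tendsto_nhds]
  intro η hη
  obtain ⟨v, huv, ht⟩ := h (η / 2 / (‖T‖ * R + 1)) (by positivity)
  filter_upwards [ht.eventually_lt_const (half_pos hη)] with n hn
  rw [dist_zero_right, norm_norm]
  have h1 : T (w n) u = T (w n) (u - v) + T (w n) v := by rw [← map_add, sub_add_cancel]
  have h2 : ‖T (w n) (u - v)‖ ≤ η / 2 := by
    refine (T.le_opNorm₂ _ _).trans ?_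
    calc ‖T‖ * ‖w n‖ * ‖u - v‖ ≤ ‖T‖ * R * (η / 2 / (‖T‖ * R + 1)) := by
          gcongr
          exact hR n
      _ ≤ η / 2 := by
          rw [mul_div_assoc', div_le_iff₀ (by positivity)]
          nlinarith [show 0 ≤ ‖T‖ * R by positivity]
  rw [h1]
  linarith [norm_add_le (T (w n) (u - v)) (T (w n) v)]

theorem eLpNorm_tensor_comm {p : ℝ} (hp : 0 < p) (μ : ℝ) (ν : Measure (RN N)) [SFinite ν]
    {u v : RN N → ℝ} (hu : Measurable u) (hv : Measurable v) :
    eLpNorm (fun z : RN N × RN N => u z.1 * v z.2) (ENNReal.ofReal p) (rieszMeasure μ ν) =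
      eLpNorm (fun z : RN N × RN N => v z.1 * u z.2) (ENNReal.ofReal p) (rieszMeasure μ ν) := by
  refine ENNReal.rpow_left_injective hp.ne' ?_
  simp only
  rw [lintegral_tensor_rpow hp ν hu hv, lintegral_tensor_rpow hp ν hv hu,
    lintegral_lintegral_swap]
  · refine lintegral_congr fun x => lintegral_congr fun y => ?_
    rw [rieszKernel_comm, mul_comm (‖u y‖ₑ ^ _)]
  · exact (((hu.comp measurable_fst).enorm.pow_const _).mul
      ((hv.comp measurable_snd).enorm.pow_const _)).mul
      (measurable_rieszKernel μ) |>.aemeasurable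

theorem exists_eLpNorm_tensor_le_of_bounded (hN : 0 < N) {μ p B : ℝ} (hμ : μ < N) (hp : 0 < p)
    (hΩm : MeasurableSet Ω) (hΩ : Bornology.IsBounded Ω) :
    ∃ C : ENNReal, C ≠ ⊤ ∧ ∀ w v : RN N → ℝ, Measurable w → Measurable v →
      (∀ᵐ y ∂(volume.restrict Ω), ‖v y‖ ≤ B) →
      eLpNorm (fun z : RN N × RN N => w z.1 * v z.2) (ENNReal.ofReal p)
        (rieszMeasure μ (volume.restrict Ω)) ≤
        C * eLpNorm w (ENNReal.ofReal p) (volume.restrict Ω) := by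
  obtain ⟨c, hc, hball⟩ := lintegral_ball_rpow_le hN hμ
  obtain ⟨ρ, hρ, hsub⟩ : ∃ ρ : ℝ, 0 < ρ ∧ ∀ x ∈ Ω, Ω ⊆ Metric.ball x ρ :=
    ⟨Metric.diam Ω + 1, by positivity, fun x hx y hy => by
      rw [Metric.mem_ball]
      exact (Metric.dist_le_diam_of_mem hΩ hy hx).trans_lt (by linarith)⟩
  obtain ⟨D, hD⟩ : ∃ D, D = ENNReal.ofReal B ^ p *
    (c * ENNReal.ofReal (ρ ^ ((N : ℝ) - μ))) := ⟨_, rfl⟩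
  have hDtop : D ≠ ⊤ := by
    rw [hD]
    exact ENNReal.mul_ne_top
      (ENNReal.rpow_ne_top_of_nonneg hp.le ENNReal.ofReal_ne_top)
      (ENNReal.mul_ne_top hc ENNReal.ofReal_ne_top)
  refine ⟨D ^ (1 / p), ENNReal.rpow_ne_top_of_nonneg (by positivity) hDtop,
    fun w v hw hv hB => ?_⟩
  have h1 : eLpNorm (fun z : RN N × RN N => w z.1 * v z.2) (ENNReal.ofReal p)
        (rieszMeasure μ (volume.restrict Ω)) ^ p ≤
      D * eLpNorm w (ENNReal.ofReal p) (volume.restrict Ω) ^ p := by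
    rw [lintegral_tensor_rpow hp _ hw hv, ← lintegral_enorm_rpow_eq hp,
      ← lintegral_const_mul _ (hw.enorm.pow_const _)]
    refine lintegral_mono_ae ?_
    filter_upwards [ae_restrict_mem hΩm] with x hx
    have hin : ∀ᵐ y ∂(volume.restrict Ω), ‖w x‖ₑ ^ p * ‖v y‖ₑ ^ p *
        rieszKernel μ x y ≤ ‖w x‖ₑ ^ p * ENNReal.ofReal B ^ p * rieszKernel μ x y := by
      filter_upwards [hB] with y hy
      gcongr
      rw [← ofReal_norm]
      exact ENNReal.ofReal_le_ofReal hy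
    refine (lintegral_mono_ae hin).trans ?_
    rw [lintegral_const_mul _ (measurable_rieszKernel_left μ x), hD]
    have hin2 : ∫⁻ y in Ω, rieszKernel μ x y ≤ c * ENNReal.ofReal (ρ ^ ((N : ℝ) - μ)) :=
      (lintegral_mono_set (hsub x hx)).trans (hball x ρ hρ)
    refine (mul_le_mul_right hin2 _).trans (le_of_eq ?_)
    ring
  have h2 := ENNReal.rpow_le_rpow h1 (by positivity : 0 ≤ 1 / p)
  rwa [← ENNReal.rpow_mul, mul_one_div_cancel hp.ne', ENNReal.rpow_one,
    ENNReal.mul_rpow_of_nonneg _ _ (by positivity), ← ENNReal.rpow_mul,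
    mul_one_div_cancel hp.ne', ENNReal.rpow_one] at h2

section TensorMap

variable {μ : ℝ} [hp : Fact (1 < hlsExp N μ)] {T : BilinMap (H01 Ω)
    (Lp ℝ (ENNReal.ofReal (hlsExp N μ)) (rieszMeasure μ (volume.restrict Ω)))}

theorem choquard_eq_norm_tensor
    (hT : ∀ u v, T u v =ᵐ[rieszMeasure μ (volume.restrict Ω)] fun z => u.fn z.1 * v.fn z.2)
    (u : H01 Ω) : choquard μ Ω u.fn = ‖T u u‖ ^ hlsExp N μ := by
  have hp0 : 0 < hlsExp N μ := by linarith [hp.out]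
  have e : (fun z => |T u u z| ^ hlsExp N μ) =ᵐ[rieszMeasure μ (volume.restrict Ω)]
      fun z => |u.fn z.1 * u.fn z.2| ^ hlsExp N μ := by
    filter_upwards [hT u u] with z hz
    rw [hz]
  rw [norm_rpow_eq_integral hp0, integral_congr_ae e]
  exact choquard_eq_integral Ω ((integrable_abs_rpow hp0 (T u u)).congr e)

theorem norm_tensor_eq
    (hT : ∀ u v, T u v =ᵐ[rieszMeasure μ (volume.restrict Ω)] fun z => u.fn z.1 * v.fn z.2)
    (u v : H01 Ω) : ‖T u v‖ = (eLpNorm (fun z : RN N × RN N => u.fn z.1 * v.fn z.2)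
      (ENNReal.ofReal (hlsExp N μ)) (rieszMeasure μ (volume.restrict Ω))).toReal := by
  rw [Lp.norm_def (T u v), eLpNorm_congr_ae (hT u v)]

theorem norm_tensor_comm
    (hT : ∀ u v, T u v =ᵐ[rieszMeasure μ (volume.restrict Ω)] fun z => u.fn z.1 * v.fn z.2)
    (u v : H01 Ω) : ‖T u v‖ = ‖T v u‖ := by
  rw [norm_tensor_eq hT u v, norm_tensor_eq hT v u, eLpNorm_tensor_comm (by linarith [hp.out]) _ _
    u.stronglyMeasurable_fn.measurable v.stronglyMeasurable_fn.measurable]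

theorem tendsto_tensor_left (hN : 3 ≤ N) (hμ0 : 0 < μ) (hμ : μ < N) (hΩm : MeasurableSet Ω)
    (hΩ : Bornology.IsBounded Ω)
    (hT : ∀ u v, T u v =ᵐ[rieszMeasure μ (volume.restrict Ω)] fun z => u.fn z.1 * v.fn z.2)
    {w : ℕ → H01 Ω} {R : ℝ} (hR : ∀ n, ‖w n‖ ≤ R)
    (hw : Tendsto (fun n => H01.fnL Ω (w n)) atTop (𝓝 0)) (u : H01 Ω) :
    Tendsto (fun n => T (w n) u) atTop (𝓝 0) := by
  obtain ⟨ι, hι⟩ := H01.exists_embedding (s := hlsExp N μ) hN hΩ (hlsExp_lt_sobolevExp hN hμ0).le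
  have hιw := (tendsto_embedding hN hΩ (hlsExp_lt_sobolevExp hN hμ0) hι hR hw).norm
  rw [norm_zero] at hιw
  have hιn : ∀ n, ‖ι (w n)‖ =
      (eLpNorm (w n).fn (ENNReal.ofReal (hlsExp N μ)) (volume.restrict Ω)).toReal := fun n => by
    rw [Lp.norm_def, eLpNorm_congr_ae (hι (w n))]
  simp only [hιn] at hιw
  refine tendsto_bilinMap_of_dense T hR u fun ε hε => ?_
  obtain ⟨v, φ, hv, huv⟩ := H01.exists_isTest_norm_sub_lt u hε
  refine ⟨v, huv, ?_⟩
  simp only [norm_tensor_eq hT]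
  obtain ⟨B, hB⟩ := hv.1.1.continuous.bounded_above_of_compact_support hv.1.2.1
  obtain ⟨C, hC, h⟩ := exists_eLpNorm_tensor_le_of_bounded (B := B) (by omega : 0 < N) hμ
    (by linarith [hp.out] : 0 < hlsExp N μ) hΩm hΩ
  refine squeeze_zero (fun n => ENNReal.toReal_nonneg) (fun n => ?_)
    (by simpa using hιw.const_mul C.toReal)
  rw [← ENNReal.toReal_mul]
  refine ENNReal.toReal_mono (ENNReal.mul_ne_top hC ?_) (h _ _
    (w n).stronglyMeasurable_fn.measurable v.stronglyMeasurable_fn.measurable ?_)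
  · exact (H01.memLp_of_le hN hΩ (hlsExp_lt_sobolevExp hN hμ0).le (w n)).2.ne
  · filter_upwards [hv.2.1] with y hy
    rw [hy]; exact hB y

end TensorMap

end Tensor

section SharpConstant

variable {N : ℕ} {Ω : Set (RN N)}

theorem inner_gradient_eq (φ : RN N → ℝ) (x e : RN N) : inner ℝ e (∇ φ x) = fderiv ℝ φ x e := by
  rw [real_inner_comm, gradient, InnerProductSpace.toDual_symm_apply]

theorem integral_mul_inner_gradient {φ ψ : RN N → ℝ} (hφ : ContDiff ℝ ∞ φ)
    (hφc : HasCompactSupport φ) (hψ : ContDiff ℝ ∞ ψ) (e : RN N) :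
    ∫ x, ψ x * inner ℝ e (∇ φ x) = -∫ x, φ x * inner ℝ e (∇ ψ x) := by
  simp only [inner_gradient_eq]
  have hd : ∀ {f : RN N → ℝ}, ContDiff ℝ ∞ f → Continuous fun x => fderiv ℝ f x e := fun hf =>
    (hf.continuous_fderiv (by simp)).clm_apply continuous_const
  have h1 : HasCompactSupport fun x => fderiv ℝ φ x e := by
    refine (hφc.fderiv ℝ).mono fun x hx => ?_
    simp only [Function.mem_support] at hx ⊢
    intro h; exact hx (by rw [h]; simp)
  rw [integral_mul_fderiv_eq_neg_fderiv_mul_of_integrable]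
  · simp only [mul_comm]
  · exact ((hd hψ).mul hφ.continuous).integrable_of_hasCompactSupport hφc.mul_left
  · exact (hψ.continuous.mul (hd hφ)).integrable_of_hasCompactSupport h1.mul_left
  · exact (hψ.continuous.mul hφ.continuous).integrable_of_hasCompactSupport hφc.mul_left
  · exact fun x _ => hψ.differentiable (by simp) x
  · exact fun x _ => hφ.differentiable (by simp) x

namespace H01

theorem integral_fn_mul_inner_gradient (v : H01 Ω) {φ : RN N → ℝ} (hφ : ContDiff ℝ ∞ φ)
    (hφc : HasCompactSupport φ) (e : RN N) :
    ∫ x in Ω, v.fn x * inner ℝ e (∇ φ x) = -∫ x in Ω, φ x * inner ℝ e (v.grad x) := by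
  have hg := continuous_gradient hφ
  have ha : MemLp (fun x => inner ℝ e (∇ φ x)) 2 (volume.restrict Ω) := by
    refine MemLp.restrict _ (Continuous.memLp_of_hasCompactSupport (by fun_prop) ?_)
    refine (hasCompactSupport_gradient hφc).mono fun x hx => ?_
    simp only [Function.mem_support] at hx ⊢
    intro h; exact hx (by rw [h]; simp)
  have hb : MemLp (fun x => φ x • e) 2 (volume.restrict Ω) := by
    refine MemLp.restrict _ (Continuous.memLp_of_hasCompactSupport
      (hφ.continuous.smul continuous_const) ?_)
    exact hφc.smul_right
  have e1 : ∀ v : H01 Ω, ∫ x in Ω, v.fn x * inner ℝ e (∇ φ x) =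
      inner ℝ (ha.toLp _) (fnL Ω v) := fun v => by
    rw [L2.inner_def]
    refine integral_congr_ae ?_
    filter_upwards [ha.coeFn_toLp] with x hx
    rw [hx, coe_fnL]
    simp
  have e2 : ∀ v : H01 Ω, ∫ x in Ω, φ x * inner ℝ e (v.grad x) =
      inner ℝ (hb.toLp _) (gradL Ω v) := fun v => by
    rw [L2.inner_def]
    refine integral_congr_ae ?_
    filter_upwards [hb.coeFn_toLp] with x hx
    rw [hx, coe_gradL, real_inner_smul_left]
  obtain ⟨w, ψ, hw, hlim⟩ := exists_isTest_tendsto v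
  have hz : ∀ n, inner ℝ (ha.toLp _) (fnL Ω (w n)) = -inner ℝ (hb.toLp _) (gradL Ω (w n)) := by
    intro n
    rw [← e1, ← e2]
    have h1 : ∫ x in Ω, (w n).fn x * inner ℝ e (∇ φ x) = ∫ x, ψ n x * inner ℝ e (∇ φ x) := by
      rw [← setIntegral_eq_integral_of_forall_compl_eq_zero (s := Ω)
        (f := fun x => ψ n x * inner ℝ e (∇ φ x)) fun x hx => by
        have : ψ n x = 0 := by
          by_contra hne; exact hx ((hw n).1.2.2 (subset_tsupport _ hne))
        rw [this, zero_mul]]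
      refine integral_congr_ae ?_
      filter_upwards [(hw n).2.1] with x hx
      rw [hx]
    have h2 : ∫ x in Ω, φ x * inner ℝ e ((w n).grad x) = ∫ x, φ x * inner ℝ e (∇ (ψ n) x) := by
      rw [← setIntegral_eq_integral_of_forall_compl_eq_zero (s := Ω)
        (f := fun x => φ x * inner ℝ e (∇ (ψ n) x)) fun x hx => by
        have : ∇ (ψ n) x = 0 := by
          by_contra hne; exact hx ((hw n).1.2.2 (support_gradient_subset _ hne))
        rw [this, inner_zero_right, mul_zero]]
      refine integral_congr_ae ?_
      filter_upwards [(hw n).2.2] with x hx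
      rw [hx]
    rw [h1, h2]
    exact integral_mul_inner_gradient hφ hφc (hw n).1.1 e
  have l1 : Tendsto (fun n => inner ℝ (ha.toLp _) (fnL Ω (w n))) atTop
      (𝓝 (inner ℝ (ha.toLp _) (fnL Ω v))) :=
    ((continuous_const.inner (fnL Ω).continuous).tendsto v).comp hlim
  have l2 : Tendsto (fun n => -inner ℝ (hb.toLp _) (gradL Ω (w n))) atTop
      (𝓝 (-inner ℝ (hb.toLp _) (gradL Ω v))) :=
    ((continuous_const.inner (gradL Ω).continuous).neg.tendsto v).comp hlim
  rw [e1, e2]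
  exact tendsto_nhds_unique (l1.congr hz) l2

/-- Extension by zero preserves the weak gradient. -/
theorem hasWeakGradient_indicator (hΩm : MeasurableSet Ω) (v : H01 Ω) :
    HasWeakGradient (Ω.indicator v.fn) (Ω.indicator v.grad) := by
  intro φ hφ
  have hg := continuous_gradient hφ.1
  have e1 : ∫ x, Ω.indicator v.fn x • ∇ φ x = ∫ x in Ω, v.fn x • ∇ φ x := by
    rw [← integral_indicator hΩm]
    refine integral_congr_ae (.of_forall fun x => ?_)
    by_cases hx : x ∈ Ω <;> simp [hx]
  have e2 : ∫ x, φ x • Ω.indicator v.grad x = ∫ x in Ω, φ x • v.grad x := by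
    rw [← integral_indicator hΩm]
    refine integral_congr_ae (.of_forall fun x => ?_)
    by_cases hx : x ∈ Ω <;> simp [hx]
  have i1 : Integrable (fun x => v.fn x • ∇ φ x) (volume.restrict Ω) :=
    memLp_one_iff_integrable.1 <| MemLp.smul (p := 2) (q := 2)
      ((hg.memLp_of_hasCompactSupport (hasCompactSupport_gradient hφ.2.1)).restrict Ω) (memLp_fn v)
  have i2 : Integrable (fun x => φ x • v.grad x) (volume.restrict Ω) :=
    memLp_one_iff_integrable.1 <| MemLp.smul (p := 2) (q := 2) (memLp_grad v)
      ((hφ.1.continuous.memLp_of_hasCompactSupport hφ.2.1).restrict Ω)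
  rw [e1, e2]
  refine ext_inner_left ℝ fun e => ?_
  rw [inner_neg_right, ← integral_inner i1, ← integral_inner i2]
  simp only [real_inner_smul_right]
  exact integral_fn_mul_inner_gradient v hφ.1 hφ.2.1 e

end H01

theorem choquard_univ_indicator {μ : ℝ} (hp : hlsExp N μ ≠ 0) (hΩm : MeasurableSet Ω)
    (f : RN N → ℝ) : choquard μ Set.univ (Ω.indicator f) = choquard μ Ω f := by
  rw [choquard, choquard, Measure.restrict_univ, ← integral_indicator hΩm]
  refine integral_congr_ae (.of_forall fun x => ?_)
  by_cases hx : x ∈ Ω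
  · simp only [hx, Set.indicator_of_mem]
    rw [← integral_indicator hΩm]
    refine integral_congr_ae (.of_forall fun y => ?_)
    by_cases hy : y ∈ Ω <;> simp [hy, Real.zero_rpow hp]
  · simp [hx, Real.zero_rpow hp]

theorem norm_bilinMap_smul_smul {X Z : Type*} [NormedAddCommGroup X] [NormedSpace ℝ X]
    [NormedAddCommGroup Z] [NormedSpace ℝ Z] (T : BilinMap X Z) (c : ℝ) (x : X) :
    ‖T (c • x) (c • x)‖ = c ^ 2 * ‖T x x‖ := by
  rw [map_smul, T.map_smul, _root_.smul_apply, norm_smul, norm_smul, ← mul_assoc,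
    Real.norm_eq_abs, abs_mul_abs_self, sq]

theorem SHL_nonneg (N : ℕ) (μ : ℝ) : 0 ≤ SHL N μ := by
  refine Real.sInf_nonneg ?_
  rintro t ⟨u, g, -, -, -, -, rfl⟩
  exact integral_nonneg fun x => by positivity

theorem SHL_le_of_choquard_eq_one (hN : 3 ≤ N) {μ : ℝ} (hμ : μ < N) (hΩm : MeasurableSet Ω)
    {v : H01 Ω} (hv : choquard μ Ω v.fn = 1) : SHL N μ ≤ ‖H01.gradL Ω v‖ ^ 2 := by
  refine csInf_le ⟨0, ?_⟩ ⟨Ω.indicator v.fn, Ω.indicator v.grad, ?_, ?_,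
    H01.hasWeakGradient_indicator hΩm v, ?_, ?_⟩
  · rintro t ⟨u, g, -, -, -, -, rfl⟩
    exact integral_nonneg fun x => by positivity
  · exact (memLp_indicator_iff_restrict hΩm).2 (H01.memLp_sobolevExp hN v)
  · exact (memLp_indicator_iff_restrict hΩm).2 (H01.memLp_grad v)
  · rw [choquard_univ_indicator (by linarith [one_lt_hlsExp hN hμ]) hΩm, hv]
  · rw [← H01.integral_grad_sq, ← integral_indicator hΩm]
    refine integral_congr_ae (.of_forall fun x => ?_)
    by_cases hx : x ∈ Ω <;> simp [hx]

theorem SHL_mul_norm_tensor_le (hN : 3 ≤ N) {μ : ℝ} (hμ : μ < N) [hp : Fact (1 < hlsExp N μ)]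
    (hΩm : MeasurableSet Ω) {T : BilinMap (H01 Ω)
    (Lp ℝ (ENNReal.ofReal (hlsExp N μ)) (rieszMeasure μ (volume.restrict Ω)))}
    (hT : ∀ u v, T u v =ᵐ[rieszMeasure μ (volume.restrict Ω)] fun z => u.fn z.1 * v.fn z.2)
    (w : H01 Ω) : SHL N μ * ‖T w w‖ ≤ ‖H01.gradL Ω w‖ ^ 2 := by
  rcases (norm_nonneg (T w w)).eq_or_lt with h0 | hpos
  · rw [← h0, mul_zero]; positivity
  have hs : 0 < √‖T w w‖ := Real.sqrt_pos.2 hpos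
  have hone : ‖T ((√‖T w w‖)⁻¹ • w) ((√‖T w w‖)⁻¹ • w)‖ = 1 := by
    rw [norm_bilinMap_smul_smul T, inv_pow, Real.sq_sqrt hpos.le, inv_mul_cancel₀ hpos.ne']
  have key := SHL_le_of_choquard_eq_one hN hμ hΩm (v := (√‖T w w‖)⁻¹ • w) (by
    rw [choquard_eq_norm_tensor hT, hone, Real.one_rpow])
  rw [map_smul, norm_smul, norm_inv, Real.norm_of_nonneg hs.le, mul_pow, inv_pow,
    Real.sq_sqrt hpos.le, inv_mul_eq_div, le_div_iff₀ hpos] at key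
  exact key

theorem firstEigenvalue_mul_le (v : H01 Ω) :
    firstEigenvalue Ω * ‖H01.fnL Ω v‖ ^ 2 ≤ ‖H01.gradL Ω v‖ ^ 2 := by
  rcases (norm_nonneg (H01.fnL Ω v)).eq_or_lt with h0 | hpos
  · rw [← h0]; simp only [ne_eq, OfNat.ofNat_ne_zero, not_false_eq_true, zero_pow, mul_zero]
    positivity
  have key : firstEigenvalue Ω ≤ ‖H01.gradL Ω (‖H01.fnL Ω v‖⁻¹ • v)‖ ^ 2 := by
    refine csInf_le ⟨0, ?_⟩ ⟨‖H01.fnL Ω v‖⁻¹ • v, ?_, (H01.integral_grad_sq _).symm⟩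
    · rintro t ⟨u, -, rfl⟩
      exact integral_nonneg fun x => by positivity
    · rw [H01.integral_fn_sq, map_smul, norm_smul, norm_inv, norm_norm,
        inv_mul_cancel₀ hpos.ne', one_pow]
  rw [map_smul, norm_smul, norm_inv, norm_norm, mul_pow, inv_pow, inv_mul_eq_div,
    le_div_iff₀ (by positivity)] at key
  exact key

end SharpConstant

section AbstractPalaisSmale

theorem exists_weakly_convergent_subseq {X : Type*} [NormedAddCommGroup X]
    [InnerProductSpace ℝ X] [CompleteSpace X] [TopologicalSpace.SeparableSpace X]
    {u : ℕ → X} {R : ℝ} (hR : ∀ n, ‖u n‖ ≤ R) :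
    ∃ (x : X) (k : ℕ → ℕ), StrictMono k ∧
      ∀ ℓ : X →L[ℝ] ℝ, Tendsto (fun n => ℓ (u (k n))) atTop (𝓝 (ℓ x)) := by
  have hc := WeakDual.isSeqCompact_closedBall ℝ X 0 R
  obtain ⟨y, -, k, hk, hy⟩ := hc
    (x := fun n => StrongDual.toWeakDual (InnerProductSpace.toDual ℝ X (u n)))
    (fun n => by simpa using hR n)
  refine ⟨(InnerProductSpace.toDual ℝ X).symm (WeakDual.toStrongDual y), k, hk, fun ℓ => ?_⟩
  have h := ((WeakDual.eval_continuous (𝕜 := ℝ) ((InnerProductSpace.toDual ℝ X).symm ℓ)).tendsto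
    y).comp hy
  have e : ∀ z : X, ℓ z = inner ℝ z ((InnerProductSpace.toDual ℝ X).symm ℓ) := fun z => by
    rw [real_inner_comm, InnerProductSpace.toDual_symm_apply]
  simp only [e, InnerProductSpace.toDual_symm_apply]
  exact h

variable {X Y α β : Type*} [NormedAddCommGroup X] [InnerProductSpace ℝ X]
  [NormedAddCommGroup Y] [InnerProductSpace ℝ Y] [MeasurableSpace α] [MeasurableSpace β]
  {ν : Measure α} {M : Measure β} {p q : ℝ} [hp : Fact (1 < p)] [hq : Fact (1 < q)]
  (G : X →L[ℝ] Y) (ι : X →L[ℝ] Lp ℝ (ENNReal.ofReal q) ν)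
  (T : BilinMap X (Lp ℝ (ENNReal.ofReal p) M)) (lam : ℝ)

/-- The functional `a ‖Gu‖² - b ‖ιu‖^q - c ‖u ⊗ u‖^p`. -/
noncomputable def powerFunctional (a b c : ℝ) (u : X) : ℝ :=
  a * ‖G u‖ ^ 2 - b * ‖ι u‖ ^ q - c * ‖T u u‖ ^ p

/-- The derivative of `powerFunctional`. -/
noncomputable def powerFunctionalDeriv (a b c : ℝ) (u : X) : X →L[ℝ] ℝ :=
  (2 * a) • (innerSL ℝ (G u)).comp G - (q * b) • (dualPairing q ν (lpSpow (ι u))).comp ι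
    - (p * c) • (dualPairing p M (lpSpow (T u u))).comp (T u + T.flip u)

theorem powerFunctionalDeriv_apply (a b c : ℝ) (u v : X) :
    powerFunctionalDeriv G ι T a b c u v = 2 * a * inner ℝ (G u) (G v)
      - q * b * dualPairing q ν (lpSpow (ι u)) (ι v)
      - p * c * dualPairing p M (lpSpow (T u u)) (T u v + T v u) := by
  simp [powerFunctionalDeriv]
  ring

theorem powerFunctionalDeriv_self (a b c : ℝ) (u : X) :
    powerFunctionalDeriv G ι T a b c u u = 2 * a * ‖G u‖ ^ 2 - q * b * ‖ι u‖ ^ q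
      - 2 * p * c * ‖T u u‖ ^ p := by
  rw [powerFunctionalDeriv_apply, dualPairing_lpSpow_self, map_add, dualPairing_lpSpow_self,
    real_inner_self_eq_norm_sq]
  ring

theorem hasFDerivAt_powerFunctional (a b c : ℝ) (u : X) :
    HasFDerivAt (powerFunctional G ι T a b c) (powerFunctionalDeriv G ι T a b c u) u := by
  have h1 : HasFDerivAt (fun u => a * ‖G u‖ ^ 2) ((2 * a) • (innerSL ℝ (G u)).comp G) u := by
    have := ((hasStrictFDerivAt_norm_sq (G u)).hasFDerivAt.comp u G.hasFDerivAt).const_mul a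
    refine this.congr_fderiv ?_
    ext v
    simp
    ring
  have h2 : HasFDerivAt (fun u => b * ‖ι u‖ ^ q)
      ((q * b) • (dualPairing q ν (lpSpow (ι u))).comp ι) u := by
    have := ((hasFDerivAt_norm_rpow_Lp (ι u)).comp u ι.hasFDerivAt).const_mul b
    refine this.congr_fderiv ?_
    ext v
    simp
    ring
  have hT : HasFDerivAt (fun u => T u u) (T u + T.flip u) u := by
    have := T.hasFDerivAt_of_bilinear (hasFDerivAt_id u) (hasFDerivAt_id u)
    refine this.congr_fderiv ?_
    ext1 v
    simp
  have h3 : HasFDerivAt (fun u => c * ‖T u u‖ ^ p)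
      ((p * c) • (dualPairing p M (lpSpow (T u u))).comp (T u + T.flip u)) u := by
    have := (HasFDerivAt.comp (f := fun u => T u u) u
      (hasFDerivAt_norm_rpow_Lp (T u u)) hT).const_mul c
    refine this.congr_fderiv ?_
    ext v
    simp
    ring
  exact (h1.sub h2).sub h3

theorem contDiff_powerFunctional (a b c : ℝ) :
    ContDiff ℝ 1 (powerFunctional G ι T a b c) := by
  have hT : ContDiff ℝ 1 (fun u => T u u) :=
    T.isBoundedBilinearMap.contDiff.comp (contDiff_id.prodMk contDiff_id)
  exact ((contDiff_const.mul ((contDiff_norm_sq ℝ).comp G.contDiff)).sub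
    (contDiff_const.mul (contDiff_norm_rpow_Lp.comp ι.contDiff))).sub
    (contDiff_const.mul (contDiff_norm_rpow_Lp.comp hT))

theorem exists_bound_powerFunctionalDeriv (a b c R : ℝ) :
    ∃ L : ℝ, ∀ u, ‖u‖ ≤ R → ‖powerFunctionalDeriv G ι T a b c u‖ ≤ L := by
  refine ⟨|2 * a| * (‖G‖ * R * ‖G‖) + |q * b| * (‖dualPairing q ν‖ * (‖ι‖ * R) ^ (q - 1) * ‖ι‖) +
    |p * c| * (‖dualPairing p M‖ * (‖T‖ * R * R) ^ (p - 1) * (‖T‖ * R + ‖T‖ * R)), fun u hu => ?_⟩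
  have hR : 0 ≤ R := (norm_nonneg u).trans hu
  have hG : ‖G u‖ ≤ ‖G‖ * R := (G.le_opNorm u).trans (by gcongr)
  have hι : ‖ι u‖ ≤ ‖ι‖ * R := (ι.le_opNorm u).trans (by gcongr)
  have hTu : ‖T u‖ ≤ ‖T‖ * R := (T.le_opNorm u).trans (by gcongr)
  have hTf : ‖T.flip u‖ ≤ ‖T‖ * R := by
    have := T.flip.le_opNorm u
    rw [ContinuousLinearMap.opNorm_flip] at this
    exact this.trans (by gcongr)
  have hTuu : ‖T u u‖ ≤ ‖T‖ * R * R := (T.le_opNorm₂ u u).trans (by gcongr)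
  refine (norm_sub_le _ _).trans (add_le_add ((norm_sub_le _ _).trans (add_le_add ?_ ?_)) ?_)
  · rw [norm_smul, Real.norm_eq_abs]
    refine mul_le_mul_of_nonneg_left ((ContinuousLinearMap.opNorm_comp_le _ _).trans ?_)
      (abs_nonneg _)
    rw [innerSL_apply_norm]
    gcongr
  · rw [norm_smul, Real.norm_eq_abs]
    refine mul_le_mul_of_nonneg_left ((ContinuousLinearMap.opNorm_comp_le _ _).trans ?_)
      (abs_nonneg _)
    have := (dualPairing q ν).le_opNorm (lpSpow (ι u))
    rw [norm_lpSpow] at this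
    gcongr
    refine this.trans ?_
    have := Real.rpow_le_rpow (norm_nonneg _) hι (by linarith [hq.out] : 0 ≤ q - 1)
    gcongr
  · rw [norm_smul, Real.norm_eq_abs]
    refine mul_le_mul_of_nonneg_left ((ContinuousLinearMap.opNorm_comp_le _ _).trans ?_)
      (abs_nonneg _)
    have := (dualPairing p M).le_opNorm (lpSpow (T u u))
    rw [norm_lpSpow] at this
    refine mul_le_mul (this.trans ?_) ((norm_add_le _ _).trans (add_le_add hTu hTf))
      (norm_nonneg _) (by positivity)
    have := Real.rpow_le_rpow (norm_nonneg _) hTuu (by linarith [hp.out] : 0 ≤ p - 1)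
    gcongr

/-- The energy `½ ‖Gu‖² - (lam/q) ‖ιu‖^q - (1/2p) ‖u ⊗ u‖^p`. -/
noncomputable def absEnergy (u : X) : ℝ :=
  powerFunctional G ι T (1 / 2) (lam / q) (1 / (2 * p)) u

/-- The Nehari functional `‖Gu‖² - lam ‖ιu‖^q - ‖u ⊗ u‖^p`. -/
noncomputable def absNehari (u : X) : ℝ := powerFunctional G ι T 1 lam 1 u

theorem fderiv_absEnergy (u : X) : fderiv ℝ (absEnergy G ι T lam) u =
    powerFunctionalDeriv G ι T (1 / 2) (lam / q) (1 / (2 * p)) u :=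
  (hasFDerivAt_powerFunctional G ι T _ _ _ u).fderiv

theorem fderiv_absNehari (u : X) :
    fderiv ℝ (absNehari G ι T lam) u = powerFunctionalDeriv G ι T 1 lam 1 u :=
  (hasFDerivAt_powerFunctional G ι T _ _ _ u).fderiv

theorem fderiv_absEnergy_self (u : X) :
    fderiv ℝ (absEnergy G ι T lam) u u = absNehari G ι T lam u := by
  have hp0 : p ≠ 0 := by linarith [hp.out]
  have hq0 : q ≠ 0 := by linarith [hq.out]
  rw [fderiv_absEnergy, powerFunctionalDeriv_self, absNehari, powerFunctional]
  field_simp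

theorem exists_coercive (hlam : 0 ≤ lam) (hq2 : 2 ≤ q)
    (hqθ : q = 2 → ∃ θ < 1, ∀ x, lam * ‖ι x‖ ^ q ≤ θ * ‖G x‖ ^ 2) :
    ∃ κ > 0, ∃ t : ℝ, 0 ≤ t ∧
      ∀ u, κ * ‖G u‖ ^ 2 ≤ absEnergy G ι T lam u - t * absNehari G ι T lam u := by
  have hp1 := hp.out
  simp only [absEnergy, absNehari, powerFunctional]
  rcases hq2.eq_or_lt with h2 | h2
  · obtain ⟨θ, hθ, h⟩ := hqθ h2.symm
    have hpp : 1 / (2 * p) < 1 / 2 := one_div_lt_one_div_of_lt (by norm_num) (by linarith)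
    refine ⟨(1 / 2 - 1 / (2 * p)) * (1 - θ), mul_pos (by linarith) (by linarith), 1 / (2 * p),
      by positivity, fun u => ?_⟩
    have := mul_le_mul_of_nonneg_left (h u) (by linarith : 0 ≤ 1 / 2 - 1 / (2 * p))
    have e : lam / q * ‖ι u‖ ^ q = 1 / 2 * (lam * ‖ι u‖ ^ q) := by
      have : lam / q = lam / 2 := by rw [← h2]
      rw [this]; ring
    rw [e]
    linarith
  · have hqq : 1 / q < 1 / 2 := one_div_lt_one_div_of_lt (by norm_num) h2
    have hpp : 1 / (2 * p) < 1 / 2 := one_div_lt_one_div_of_lt (by norm_num) (by linarith)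
    set t := max (1 / q) (1 / (2 * p)) with ht
    have ht2 : t < 1 / 2 := max_lt hqq hpp
    refine ⟨1 / 2 - t, by linarith, t, le_max_of_le_left (by positivity), fun u => ?_⟩
    have hB : 0 ≤ lam * ‖ι u‖ ^ q := by positivity
    have hD : 0 ≤ ‖T u u‖ ^ p := by positivity
    have h3 := mul_le_mul_of_nonneg_right (le_max_left (1 / q) (1 / (2 * p))) hB
    have h4 := mul_le_mul_of_nonneg_right (le_max_right (1 / q) (1 / (2 * p))) hD
    have h5 : lam / q * ‖ι u‖ ^ q = 1 / q * (lam * ‖ι u‖ ^ q) := by ring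
    rw [h5]
    linarith

theorem bounded_of_sq_le {u : ℕ → ℝ} (hu : ∀ n, 0 ≤ u n) {a b : ℝ}
    (h : ∀ n, u n ^ 2 ≤ a + b * u n) : ∃ R, ∀ n, u n ≤ R :=
  ⟨|a| + |b| + 1, fun n => by
    by_contra hcon
    push Not at hcon
    have h0 := h n
    have h1 : a ≤ |a| := le_abs_self a
    have h2 : b * u n ≤ |b| * u n := mul_le_mul_of_nonneg_right (le_abs_self b) (hu n)
    have h3 := abs_nonneg a
    have h4 := abs_nonneg b
    nlinarith⟩

theorem bounded_of_palaisSmale (hlam : 0 ≤ lam) (hq2 : 2 ≤ q)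
    (hqθ : q = 2 → ∃ θ < 1, ∀ x, lam * ‖ι x‖ ^ q ≤ θ * ‖G x‖ ^ 2)
    {K : ℝ} (hK0 : 0 ≤ K) (hK : ∀ x, ‖x‖ ^ 2 ≤ K * ‖G x‖ ^ 2) {u : ℕ → X} {c b : ℝ}
    (hE : Tendsto (fun n => absEnergy G ι T lam (u n)) atTop (𝓝 c))
    (hT : ∀ n, |absNehari G ι T lam (u n)| ≤ b * ‖u n‖) : ∃ R, ∀ n, ‖u n‖ ≤ R := by
  obtain ⟨κ, hκ, t, ht, h⟩ := exists_coercive G ι T lam hlam hq2 hqθ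
  obtain ⟨C, hC⟩ := hE.bddAbove_range
  have hC' : ∀ n, absEnergy G ι T lam (u n) ≤ C := fun n => hC ⟨n, rfl⟩
  refine bounded_of_sq_le (fun n => norm_nonneg _) (a := K / κ * C) (b := K / κ * (t * b))
    fun n => ?_
  have h1 : κ * ‖G (u n)‖ ^ 2 ≤ C + t * (b * ‖u n‖) := by
    have := mul_le_mul_of_nonneg_left ((neg_abs_le _).trans' (neg_le_neg (hT n))) ht
    linarith [h (u n), hC' n]
  calc ‖u n‖ ^ 2 ≤ K * ‖G (u n)‖ ^ 2 := hK _
    _ = K / κ * (κ * ‖G (u n)‖ ^ 2) := by field_simp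
    _ ≤ K / κ * (C + t * (b * ‖u n‖)) := by gcongr
    _ = _ := by ring

/-- The compactness properties of the lower order terms along weakly null sequences. -/
structure CompactTerms : Prop where
  embedding : ∀ (w : ℕ → X) (R : ℝ), (∀ n, ‖w n‖ ≤ R) →
    (∀ ℓ : X →L[ℝ] ℝ, Tendsto (fun n => ℓ (w n)) atTop (𝓝 0)) →
    Tendsto (fun n => ι (w n)) atTop (𝓝 0)
  tensor : ∀ (w : ℕ → X) (R : ℝ), (∀ n, ‖w n‖ ≤ R) →
    (∀ ℓ : X →L[ℝ] ℝ, Tendsto (fun n => ℓ (w n)) atTop (𝓝 0)) → ∀ u,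
    Tendsto (fun n => T (w n) u) atTop (𝓝 0)
  norm_comm : ∀ u v, ‖T u v‖ = ‖T v u‖
  ae_subseq : ∀ (x : ℕ → X) (u : X) (R : ℝ), (∀ n, ‖x n - u‖ ≤ R) →
    (∀ ℓ : X →L[ℝ] ℝ, Tendsto (fun n => ℓ (x n - u)) atTop (𝓝 0)) →
    ∃ k : ℕ → ℕ, StrictMono k ∧
      ∀ᵐ z ∂M, Tendsto (fun n => T (x (k n)) (x (k n)) z) atTop (𝓝 (T u u z))

variable {G ι T lam}

theorem tendsto_of_energy_lt (hcpt : CompactTerms ι T) (hlam : 0 ≤ lam) (hq2 : 2 ≤ q)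
    (hqθ : q = 2 → ∃ θ < 1, ∀ x, lam * ‖ι x‖ ^ q ≤ θ * ‖G x‖ ^ 2)
    {K : ℝ} (hK : ∀ x, ‖x‖ ^ 2 ≤ K * ‖G x‖ ^ 2)
    {S : ℝ} (hS0 : 0 ≤ S) (hS : ∀ x, S * ‖T x x‖ ≤ ‖G x‖ ^ 2)
    {c : ℝ} (hc : c < (1 / 2 - 1 / (2 * p)) * S ^ (p / (p - 1)))
    {x : ℕ → X} {u : X} {R : ℝ} (hR : ∀ n, ‖x n‖ ≤ R)
    (hw : ∀ ℓ : X →L[ℝ] ℝ, Tendsto (fun n => ℓ (x n)) atTop (𝓝 (ℓ u)))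
    (hae : ∀ᵐ z ∂M, Tendsto (fun n => T (x n) (x n) z) atTop (𝓝 (T u u z)))
    (hE : Tendsto (fun n => absEnergy G ι T lam (x n)) atTop (𝓝 c))
    (hE' : Tendsto (fun n => fderiv ℝ (absEnergy G ι T lam) (x n)) atTop (𝓝 0)) :
    Tendsto x atTop (𝓝 u) := by
  have hp1 := hp.out
  have hp0 : 0 < p := by linarith
  have hq0 : 0 < q := by linarith
  have hR0 : 0 ≤ R := (norm_nonneg _).trans (hR 0)
  set w : ℕ → X := fun n => x n - u with hwdef
  have hwR : ∀ n, ‖w n‖ ≤ R + ‖u‖ := fun n => (norm_sub_le _ _).trans (by linarith [hR n])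
  have hwnull : ∀ ℓ : X →L[ℝ] ℝ, Tendsto (fun n => ℓ (w n)) atTop (𝓝 0) := fun ℓ => by
    simpa [hwdef] using (hw ℓ).sub_const (ℓ u)
  have hιw := hcpt.embedding w _ hwR hwnull
  have hTwu := hcpt.tensor w _ hwR hwnull u
  have hTuw : Tendsto (fun n => T u (w n)) atTop (𝓝 0) := by
    rw [tendsto_zero_iff_norm_tendsto_zero] at hTwu ⊢
    simpa only [hcpt.norm_comm u] using hTwu
  have hxw : ∀ n, x n = u + w n := fun n => by simp [hwdef]
  have hTxx : ∀ n, ‖T (x n) (x n)‖ ≤ ‖T‖ * R * R := fun n =>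
    (T.le_opNorm₂ _ _).trans (by gcongr <;> exact hR n)
  have fG : Tendsto (fun n => inner ℝ (G u) (G (w n))) atTop (𝓝 0) := by
    simpa using hwnull ((innerSL ℝ (G u)).comp G)
  have fA : Tendsto (fun n => ‖G (x n)‖ ^ 2 - ‖G (w n)‖ ^ 2) atTop (𝓝 (‖G u‖ ^ 2)) := by
    have h := (fG.const_mul 2).const_add (‖G u‖ ^ 2)
    simp only [mul_zero, add_zero] at h
    refine h.congr fun n => ?_
    rw [hxw, map_add, norm_add_sq_real]; ring
  have fι : Tendsto (fun n => ι (x n)) atTop (𝓝 (ι u)) := by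
    have h := hιw.const_add (ι u)
    rw [add_zero] at h
    exact h.congr fun n => by rw [hxw, map_add]
  have fB : Tendsto (fun n => ‖ι (x n)‖ ^ q) atTop (𝓝 (‖ι u‖ ^ q)) :=
    fι.norm.rpow_const (Or.inr hq0.le)
  have fD : Tendsto (fun n => ‖T (x n) (x n)‖ ^ p - ‖T (x n) (x n) - T u u‖ ^ p) atTop
      (𝓝 (‖T u u‖ ^ p)) := tendsto_norm_rpow_sub hTxx hae
  have fN : Tendsto (fun n => absNehari G ι T lam (x n)) atTop (𝓝 0) := by
    simp only [← fderiv_absEnergy_self]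
    refine squeeze_zero_norm (fun n => (ContinuousLinearMap.le_opNorm _ _).trans
      (mul_le_mul_of_nonneg_left (hR n) (norm_nonneg _))) ?_
    simpa using hE'.norm.mul_const R
  have fPair : Tendsto (fun n => dualPairing p M (lpSpow (T (x n) (x n)))
      (T (x n) u + T u (x n))) atTop (𝓝 (2 * ‖T u u‖ ^ p)) := by
    have h1 := (tendsto_dualPairing_lpSpow hTxx hae).const_mul 2
    have h2 : Tendsto (fun n => dualPairing p M (lpSpow (T (x n) (x n)))
        (T (w n) u + T u (w n))) atTop (𝓝 0) := by
      refine squeeze_zero_norm (a := fun n => ‖dualPairing p M‖ * (‖T‖ * R * R) ^ (p - 1) *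
        ‖T (w n) u + T u (w n)‖) (fun n => ?_) ?_
      · refine ((dualPairing p M).le_opNorm₂ _ _).trans ?_
        rw [norm_lpSpow]
        have := Real.rpow_le_rpow (norm_nonneg _) (hTxx n) (by linarith : 0 ≤ p - 1)
        gcongr
      · simpa using (hTwu.add hTuw).norm.const_mul _
    have h3 := h1.add h2
    rw [add_zero] at h3
    refine h3.congr fun n => ?_
    have e : T (x n) u + T u (x n) = (2 : ℝ) • T u u + (T (w n) u + T u (w n)) := by
      conv_lhs => rw [hxw n]
      rw [map_add, map_add, _root_.add_apply, two_smul]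
      abel
    rw [e, (dualPairing p M (lpSpow (T (x n) (x n)))).map_add ((2 : ℝ) • T u u),
      ContinuousLinearMap.map_smul, smul_eq_mul]
  have hNu : absNehari G ι T lam u = 0 := by
    have h1 : Tendsto (fun n => fderiv ℝ (absEnergy G ι T lam) (x n) u) atTop (𝓝 0) := by
      refine squeeze_zero_norm (fun n => ContinuousLinearMap.le_opNorm _ _) ?_
      simpa using hE'.norm.mul_const ‖u‖
    have h2 : Tendsto (fun n => inner ℝ (G (x n)) (G u)) atTop (𝓝 (‖G u‖ ^ 2)) := by
      have h := fG.const_add (‖G u‖ ^ 2)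
      rw [add_zero] at h
      refine h.congr fun n => ?_
      rw [hxw, map_add, inner_add_left, real_inner_self_eq_norm_sq, real_inner_comm]
    have h3 : Tendsto (fun n => dualPairing q ν (lpSpow (ι (x n))) (ι u)) atTop
        (𝓝 (‖ι u‖ ^ q)) := by
      rw [← dualPairing_lpSpow_self]
      have hcont : Continuous fun F : Lp ℝ (ENNReal.ofReal q) ν =>
          dualPairing q ν (lpSpow F) (ι u) :=
        (((dualPairing q ν).continuous.comp continuous_lpSpow).clm_apply continuous_const)
      exact (hcont.tendsto _).comp fι
    have h4 := ((h2.const_mul (2 * (1 / 2))).sub (h3.const_mul (q * (lam / q)))).sub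
      (fPair.const_mul (p * (1 / (2 * p))))
    have h5 := tendsto_nhds_unique h1 (h4.congr fun n => by
      rw [fderiv_absEnergy, powerFunctionalDeriv_apply])
    rw [absNehari, powerFunctional, h5]
    field_simp
  obtain ⟨κ, hκ, t, ht, hcoer⟩ := exists_coercive G ι T lam hlam hq2 hqθ
  have hEu : 0 ≤ absEnergy G ι T lam u := by
    have := hcoer u
    rw [hNu, mul_zero, sub_zero] at this
    exact this.trans' (by positivity)
  have hpp : 0 < 1 / 2 - 1 / (2 * p) := by
    have : 1 / (2 * p) < 1 / 2 := one_div_lt_one_div_of_lt (by norm_num) (by linarith)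
    linarith
  set ℓ := (c - absEnergy G ι T lam u) / (1 / 2 - 1 / (2 * p)) with hℓ
  have hℓlt : ℓ < S ^ (p / (p - 1)) := by
    rw [hℓ, div_lt_iff₀ hpp]; linarith
  have g1 : Tendsto (fun n => ‖G (w n)‖ ^ 2 - ‖T (x n) (x n) - T u u‖ ^ p) atTop (𝓝 0) := by
    have h := ((fN.sub fA).add (fB.const_mul lam)).add fD
    have e : 0 - ‖G u‖ ^ 2 + lam * ‖ι u‖ ^ q + ‖T u u‖ ^ p = 0 := by
      rw [absNehari, powerFunctional] at hNu; linarith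
    rw [e] at h
    refine h.congr fun n => ?_
    rw [absNehari, powerFunctional]; ring
  have g2 : Tendsto (fun n => 1 / 2 * ‖G (w n)‖ ^ 2 -
      1 / (2 * p) * ‖T (x n) (x n) - T u u‖ ^ p) atTop (𝓝 (c - absEnergy G ι T lam u)) := by
    have h := ((hE.sub (fA.const_mul (1 / 2))).add (fB.const_mul (lam / q))).add
      (fD.const_mul (1 / (2 * p)))
    have e : c - 1 / 2 * ‖G u‖ ^ 2 + lam / q * ‖ι u‖ ^ q + 1 / (2 * p) * ‖T u u‖ ^ p =
        c - absEnergy G ι T lam u := by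
      rw [absEnergy, powerFunctional]; ring
    rw [e] at h
    refine h.congr fun n => ?_
    rw [absEnergy, powerFunctional]; ring
  have ga : Tendsto (fun n => ‖G (w n)‖ ^ 2) atTop (𝓝 ℓ) := by
    have h := (g2.sub (g1.const_mul (1 / (2 * p)))).div_const (1 / 2 - 1 / (2 * p))
    rw [mul_zero, sub_zero] at h
    refine h.congr fun n => ?_
    rw [div_eq_iff hpp.ne']; ring
  have gd : Tendsto (fun n => ‖T (x n) (x n) - T u u‖ ^ p) atTop (𝓝 ℓ) := by
    simpa using ga.sub g1
  have gW : Tendsto (fun n => ‖T (x n) (x n) - T u u‖) atTop (𝓝 (ℓ ^ p⁻¹)) :=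
    (gd.rpow_const (Or.inr (by positivity))).congr fun n =>
      Real.rpow_rpow_inv (norm_nonneg _) hp0.ne'
  have gT : Tendsto (fun n => ‖T (w n) (w n)‖) atTop (𝓝 (ℓ ^ p⁻¹)) := by
    have h0 : Tendsto (fun n => ‖T (w n) (w n)‖ - ‖T (x n) (x n) - T u u‖) atTop (𝓝 0) := by
      refine squeeze_zero_norm (a := fun n => ‖T (w n) u + T u (w n)‖) (fun n => ?_)
        (by simpa using (hTwu.add hTuw).norm)
      rw [Real.norm_eq_abs]
      refine (abs_norm_sub_norm_le _ _).trans (le_of_eq ?_)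
      rw [← norm_neg]
      congr 1
      conv_lhs => rw [hxw n]
      simp only [map_add, _root_.add_apply]
      abel
    simpa using h0.add gW
  have hℓ0 : 0 ≤ ℓ := ge_of_tendsto' ga fun n => by positivity
  have hSℓ : S * ℓ ^ p⁻¹ ≤ ℓ := le_of_tendsto_of_tendsto' (gT.const_mul S) ga fun n => hS (w n)
  have hzero : ℓ = 0 := by
    by_contra hne
    have hpos : 0 < ℓ := lt_of_le_of_ne hℓ0 (Ne.symm hne)
    have h1 : S ≤ ℓ ^ (1 - p⁻¹) := by
      rw [Real.rpow_sub hpos, Real.rpow_one, le_div_iff₀ (by positivity)]; exact hSℓ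
    have h2 : S ^ (p / (p - 1)) ≤ ℓ := by
      refine (Real.rpow_le_rpow hS0 h1 (div_nonneg hp0.le (by linarith))).trans (le_of_eq ?_)
      rw [← Real.rpow_mul hpos.le]
      have hpm : p - 1 ≠ 0 := by linarith
      have : (1 - p⁻¹) * (p / (p - 1)) = 1 := by field_simp
      rw [this, Real.rpow_one]
    linarith
  rw [hzero] at ga
  have hsq : Tendsto (fun n => ‖w n‖ ^ 2) atTop (𝓝 0) :=
    squeeze_zero (fun n => by positivity) (fun n => hK (w n)) (by simpa using ga.const_mul K)
  have hn := hsq.sqrt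
  simp only [Real.sqrt_sq (norm_nonneg _), Real.sqrt_zero] at hn
  exact tendsto_iff_norm_sub_tendsto_zero.2 hn

theorem palaisSmale_of_bounded [CompleteSpace X] [TopologicalSpace.SeparableSpace X]
    (hcpt : CompactTerms ι T) (hlam : 0 ≤ lam) (hq2 : 2 ≤ q)
    (hqθ : q = 2 → ∃ θ < 1, ∀ x, lam * ‖ι x‖ ^ q ≤ θ * ‖G x‖ ^ 2)
    {K : ℝ} (hK : ∀ x, ‖x‖ ^ 2 ≤ K * ‖G x‖ ^ 2)
    {S : ℝ} (hS0 : 0 ≤ S) (hS : ∀ x, S * ‖T x x‖ ≤ ‖G x‖ ^ 2)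
    {c : ℝ} (hc : c < (1 / 2 - 1 / (2 * p)) * S ^ (p / (p - 1)))
    {x : ℕ → X} {R : ℝ} (hR : ∀ n, ‖x n‖ ≤ R)
    (hE : Tendsto (fun n => absEnergy G ι T lam (x n)) atTop (𝓝 c))
    (hE' : Tendsto (fun n => fderiv ℝ (absEnergy G ι T lam) (x n)) atTop (𝓝 0)) :
    ∃ (u : X) (k : ℕ → ℕ), StrictMono k ∧ Tendsto (fun n => x (k n)) atTop (𝓝 u) := by
  obtain ⟨u, k, hk, hw⟩ := exists_weakly_convergent_subseq hR
  obtain ⟨j, hj, hae⟩ := hcpt.ae_subseq (fun n => x (k n)) u (R + ‖u‖)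
    (fun n => (norm_sub_le _ _).trans (by linarith [hR (k n)]))
    (fun ℓ => by simpa using (hw ℓ).sub_const (ℓ u))
  have hkj : StrictMono (k ∘ j) := hk.comp hj
  refine ⟨u, k ∘ j, hkj, ?_⟩
  exact tendsto_of_energy_lt hcpt hlam hq2 hqθ hK hS0 hS hc (fun n => hR _)
    (fun ℓ => (hw ℓ).comp hj.tendsto_atTop) hae (hE.comp hkj.tendsto_atTop)
    (hE'.comp hkj.tendsto_atTop)

theorem palaisSmale_absEnergy [CompleteSpace X] [TopologicalSpace.SeparableSpace X]
    (hcpt : CompactTerms ι T) (hlam : 0 ≤ lam) (hq2 : 2 ≤ q)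
    (hqθ : q = 2 → ∃ θ < 1, ∀ x, lam * ‖ι x‖ ^ q ≤ θ * ‖G x‖ ^ 2)
    {K : ℝ} (hK0 : 0 ≤ K) (hK : ∀ x, ‖x‖ ^ 2 ≤ K * ‖G x‖ ^ 2)
    {S : ℝ} (hS0 : 0 ≤ S) (hS : ∀ x, S * ‖T x x‖ ≤ ‖G x‖ ^ 2)
    {c : ℝ} (hc : c < (1 / 2 - 1 / (2 * p)) * S ^ (p / (p - 1))) :
    PalaisSmale (absEnergy G ι T lam) c := by
  intro x hE hE'
  obtain ⟨b, hb⟩ := hE'.norm.bddAbove_range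
  obtain ⟨R, hR⟩ := bounded_of_palaisSmale G ι T lam hlam hq2 hqθ hK0 hK hE (b := b) fun n => by
    rw [← fderiv_absEnergy_self, ← Real.norm_eq_abs]
    exact ((fderiv ℝ (absEnergy G ι T lam) (x n)).le_opNorm (x n)).trans
      (mul_le_mul_of_nonneg_right (hb ⟨n, rfl⟩) (norm_nonneg _))
  exact palaisSmale_of_bounded hcpt hlam hq2 hqθ hK hS0 hS hc hR hE hE'

theorem exists_lower_bound_of_absNehari_eq_zero (hlam : 0 ≤ lam) (hq2 : 2 ≤ q)
    (hqθ : q = 2 → ∃ θ < 1, ∀ x, lam * ‖ι x‖ ^ q ≤ θ * ‖G x‖ ^ 2)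
    {K : ℝ} (hK0 : 0 ≤ K) (hK : ∀ x, ‖x‖ ^ 2 ≤ K * ‖G x‖ ^ 2) :
    ∃ δ > 0, ∀ u, u ≠ 0 → absNehari G ι T lam u = 0 → δ ≤ ‖G u‖ ^ 2 := by
  have hp1 := hp.out
  have hnorm : ∀ u, ‖u‖ ≤ √K * ‖G u‖ := fun u => by
    refine le_of_sq_le_sq ?_ (by positivity)
    rw [mul_pow, Real.sq_sqrt hK0]; exact hK u
  have hsq : ∀ (u : X) (r : ℝ), (‖G u‖ ^ 2) ^ (r / 2) = ‖G u‖ ^ r := fun u r => by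
    rw [← Real.rpow_natCast, ← Real.rpow_mul (norm_nonneg _)]
    congr 1; push_cast; ring
  have hD : ∀ u, ‖T u u‖ ^ p ≤ (‖T‖ * √K ^ 2) ^ p * (‖G u‖ ^ 2) ^ p := fun u => by
    rw [← Real.mul_rpow (by positivity) (by positivity)]
    refine Real.rpow_le_rpow (norm_nonneg _) ((T.le_opNorm₂ u u).trans ?_) (by linarith)
    have := mul_le_mul (hnorm u) (hnorm u) (norm_nonneg _) (by positivity)
    calc ‖T‖ * ‖u‖ * ‖u‖ = ‖T‖ * (‖u‖ * ‖u‖) := by ring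
      _ ≤ ‖T‖ * (√K * ‖G u‖ * (√K * ‖G u‖)) := by gcongr
      _ = _ := by ring
  have hB : ∀ u, lam * ‖ι u‖ ^ q ≤ lam * (‖ι‖ * √K) ^ q * (‖G u‖ ^ 2) ^ (q / 2) := fun u => by
    rw [hsq, mul_assoc, ← Real.mul_rpow (by positivity) (norm_nonneg _)]
    refine mul_le_mul_of_nonneg_left (Real.rpow_le_rpow (norm_nonneg _) ?_ (by linarith)) hlam
    refine (ι.le_opNorm u).trans ?_
    rw [mul_assoc]; gcongr; exact hnorm u
  obtain ⟨θ, C₁, r, hθ, hr, hmain⟩ : ∃ θ C₁ r : ℝ, θ < 1 ∧ 1 < r ∧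
      ∀ u, lam * ‖ι u‖ ^ q ≤ θ * ‖G u‖ ^ 2 + C₁ * (‖G u‖ ^ 2) ^ r := by
    rcases hq2.eq_or_lt with h2 | h2
    · obtain ⟨θ, hθ, h⟩ := hqθ h2.symm
      exact ⟨θ, 0, 2, hθ, by norm_num, fun u => by linarith [h u]⟩
    · exact ⟨0, _, q / 2, by norm_num, by linarith, fun u => by
        rw [zero_mul, zero_add]; exact hB u⟩
  set C₂ := (‖T‖ * √K ^ 2) ^ p
  have hlim : Tendsto (fun a : ℝ => C₁ * a ^ (r - 1) + C₂ * a ^ (p - 1)) (𝓝 0) (𝓝 0) := by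
    have hcont : Continuous (fun a : ℝ => C₁ * a ^ (r - 1) + C₂ * a ^ (p - 1)) :=
      (continuous_const.mul (continuous_id.rpow_const fun _ => Or.inr (by linarith))).add
        (continuous_const.mul (continuous_id.rpow_const fun _ => Or.inr (by linarith)))
    have := hcont.tendsto 0
    rwa [Real.zero_rpow (by linarith), Real.zero_rpow (by linarith), mul_zero, mul_zero,
      add_zero] at this
  obtain ⟨δ, hδ, hball⟩ := Metric.eventually_nhds_iff.1
    (hlim.eventually_lt_const (by linarith : 0 < 1 - θ))
  refine ⟨δ, hδ, fun u hu hN => ?_⟩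
  by_contra hcon
  push Not at hcon
  have hA : 0 < ‖G u‖ ^ 2 := by
    by_contra h0
    have h0' : ‖G u‖ ^ 2 = 0 := le_antisymm (not_lt.1 h0) (by positivity)
    have := hK u
    rw [h0', mul_zero] at this
    exact hu (norm_eq_zero.1 (pow_eq_zero_iff two_ne_zero |>.1 (le_antisymm this (by positivity))))
  have h1 := hball (y := ‖G u‖ ^ 2) (by rw [dist_zero_right, Real.norm_of_nonneg hA.le]; exact hcon)
  have h2 : ∀ s : ℝ, (‖G u‖ ^ 2) ^ (s - 1) * ‖G u‖ ^ 2 = (‖G u‖ ^ 2) ^ s := fun s => by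
    rw [← Real.rpow_add_one hA.ne']; simp
  have h3 := mul_lt_mul_of_pos_right h1 hA
  rw [add_mul, mul_assoc, h2, mul_assoc, h2] at h3
  rw [absNehari, powerFunctional] at hN
  linarith [hmain u, hD u]

theorem exists_fderiv_absNehari_le (hlam : 0 ≤ lam) (hq2 : 2 ≤ q)
    (hqθ : q = 2 → ∃ θ < 1, ∀ x, lam * ‖ι x‖ ^ q ≤ θ * ‖G x‖ ^ 2) :
    ∃ κ > 0, ∀ u, absNehari G ι T lam u = 0 →
      fderiv ℝ (absNehari G ι T lam) u u ≤ -(κ * ‖G u‖ ^ 2) := by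
  have hp1 := hp.out
  have hmain : ∀ u, absNehari G ι T lam u = 0 → fderiv ℝ (absNehari G ι T lam) u u =
      (2 - q) * (lam * ‖ι u‖ ^ q) + (2 - 2 * p) * ‖T u u‖ ^ p ∧
      ‖G u‖ ^ 2 = lam * ‖ι u‖ ^ q + ‖T u u‖ ^ p := fun u hu => by
    rw [fderiv_absNehari, powerFunctionalDeriv_self]
    rw [absNehari, powerFunctional] at hu
    constructor
    · linear_combination 2 * hu
    · linear_combination hu
  rcases hq2.eq_or_lt with h2 | h2
  · obtain ⟨θ, hθ, h⟩ := hqθ h2.symm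
    refine ⟨(2 * p - 2) * (1 - θ), mul_pos (by linarith) (by linarith), fun u hu => ?_⟩
    obtain ⟨h3, h4⟩ := hmain u hu
    rw [h3]
    have h5 : (1 - θ) * ‖G u‖ ^ 2 ≤ ‖T u u‖ ^ p := by linarith [h u]
    have h6 := mul_le_mul_of_nonneg_left h5 (by linarith : 0 ≤ 2 * p - 2)
    have h7 : (2 - q) * (lam * ‖ι u‖ ^ q) = 0 := by
      rw [show 2 - q = 0 by linarith, zero_mul]
    rw [h7]
    linarith
  · refine ⟨min (q - 2) (2 * p - 2), lt_min (by linarith) (by linarith), fun u hu => ?_⟩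
    obtain ⟨h3, h4⟩ := hmain u hu
    have hB : 0 ≤ lam * ‖ι u‖ ^ q := by positivity
    have hD : 0 ≤ ‖T u u‖ ^ p := by positivity
    rw [h3, h4]
    have h5 := mul_le_mul_of_nonneg_right (min_le_left (q - 2) (2 * p - 2)) hB
    have h6 := mul_le_mul_of_nonneg_right (min_le_right (q - 2) (2 * p - 2)) hD
    linarith

theorem constrainedPalaisSmale_absEnergy [CompleteSpace X] [TopologicalSpace.SeparableSpace X]
    (hcpt : CompactTerms ι T) (hlam : 0 ≤ lam) (hq2 : 2 ≤ q)
    (hqθ : q = 2 → ∃ θ < 1, ∀ x, lam * ‖ι x‖ ^ q ≤ θ * ‖G x‖ ^ 2)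
    {K : ℝ} (hK0 : 0 ≤ K) (hK : ∀ x, ‖x‖ ^ 2 ≤ K * ‖G x‖ ^ 2)
    {S : ℝ} (hS0 : 0 ≤ S) (hS : ∀ x, S * ‖T x x‖ ≤ ‖G x‖ ^ 2)
    {c : ℝ} (hc : c < (1 / 2 - 1 / (2 * p)) * S ^ (p / (p - 1))) :
    ConstrainedPalaisSmale (absEnergy G ι T lam) (absNehari G ι T lam)
      {u | u ≠ 0 ∧ fderiv ℝ (absEnergy G ι T lam) u u = 0} c := by
  rintro x hx hE ⟨a, ha⟩
  have hN : ∀ n, absNehari G ι T lam (x n) = 0 := fun n => by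
    rw [← fderiv_absEnergy_self]; exact (hx n).2
  obtain ⟨R, hR⟩ := bounded_of_palaisSmale G ι T lam hlam hq2 hqθ hK0 hK hE (b := 0) fun n => by
    rw [hN n]; simp
  obtain ⟨δ, hδ, hlow⟩ := exists_lower_bound_of_absNehari_eq_zero (T := T) hlam hq2 hqθ hK0 hK
  obtain ⟨κ, hκ, hneg⟩ := exists_fderiv_absNehari_le (T := T) hlam hq2 hqθ
  obtain ⟨L, hL⟩ := exists_bound_powerFunctionalDeriv G ι T 1 lam 1 R
  have ha0 : Tendsto a atTop (𝓝 0) := by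
    refine squeeze_zero_norm (a := fun n => ‖fderiv ℝ (absEnergy G ι T lam) (x n) -
      a n • fderiv ℝ (absNehari G ι T lam) (x n)‖ * R / (κ * δ)) (fun n => ?_) ?_
    · rw [le_div_iff₀ (by positivity)]
      have h1 : (fderiv ℝ (absEnergy G ι T lam) (x n) -
          a n • fderiv ℝ (absNehari G ι T lam) (x n)) (x n) =
          -(a n * fderiv ℝ (absNehari G ι T lam) (x n) (x n)) := by
        rw [_root_.sub_apply, _root_.smul_apply, (hx n).2, zero_sub, smul_eq_mul]
      have h2 := (ContinuousLinearMap.le_opNorm (fderiv ℝ (absEnergy G ι T lam) (x n) -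
          a n • fderiv ℝ (absNehari G ι T lam) (x n)) (x n)).trans
          (mul_le_mul_of_nonneg_left (hR n) (norm_nonneg _))
      rw [h1, norm_neg, norm_mul] at h2
      refine le_trans (mul_le_mul_of_nonneg_left ?_ (norm_nonneg _)) h2
      have h3 := hneg (x n) (hN n)
      have h4 := mul_le_mul_of_nonneg_left (hlow (x n) (hx n).1 (hN n)) hκ.le
      rw [Real.norm_eq_abs]
      exact le_trans (by linarith) (neg_le_abs _)
    · simpa using (ha.norm.mul_const R).div_const (κ * δ)
  have hE' : Tendsto (fun n => fderiv ℝ (absEnergy G ι T lam) (x n)) atTop (𝓝 0) := by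
    have h1 : Tendsto (fun n => a n • fderiv ℝ (absNehari G ι T lam) (x n)) atTop (𝓝 0) := by
      refine squeeze_zero_norm (a := fun n => ‖a n‖ * L) (fun n => ?_)
        (by simpa using ha0.norm.mul_const L)
      rw [norm_smul, fderiv_absNehari]
      gcongr
      exact hL _ (hR n)
    simpa using ha.add h1
  obtain ⟨u, k, hk, hlim⟩ := palaisSmale_of_bounded hcpt hlam hq2 hqθ hK hS0 hS hc hR hE hE'
  refine ⟨u, ⟨?_, ?_⟩, k, hk, hlim⟩
  · rintro rfl
    have h1 : Tendsto (fun n => ‖G (x (k n))‖ ^ 2) atTop (𝓝 0) := by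
      simpa using (((G.continuous.tendsto 0).comp hlim).norm.pow 2)
    have h2 := ge_of_tendsto' h1 fun n => hlow _ (hx (k n)).1 (hN (k n))
    linarith
  · rw [fderiv_absEnergy_self]
    have h1 : Tendsto (fun n => absNehari G ι T lam (x (k n))) atTop
        (𝓝 (absNehari G ι T lam u)) :=
      ((contDiff_powerFunctional G ι T 1 lam 1).continuous.tendsto u).comp hlim
    exact tendsto_nhds_unique h1 (by simp [hN])

end AbstractPalaisSmale

section ChoquardEnergy

variable {N : ℕ} {Ω : Set (RN N)} {μ q : ℝ}

instance : CompleteSpace (H01 Ω) :=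
  (testPairs Ω).isClosed_topologicalClosure.completeSpace_coe

instance : SecondCountableTopology (L2Pair Ω) := by
  have h1 : SecondCountableTopology (Lp ℝ 2 (volume.restrict Ω)) :=
    have : Fact ((2 : ENNReal) ≠ ⊤) := ⟨by simp⟩
    inferInstance
  have h2 : SecondCountableTopology (Lp (RN N) 2 (volume.restrict Ω)) :=
    have : Fact ((2 : ENNReal) ≠ ⊤) := ⟨by simp⟩
    inferInstance
  exact WithLp.secondCountableTopology 2 _ _

instance : TopologicalSpace.SeparableSpace (H01 Ω) := by
  have : SecondCountableTopology (H01 Ω) :=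
    inferInstanceAs (SecondCountableTopology ((testPairs Ω).topologicalClosure : Set (L2Pair Ω)))
  infer_instance

variable [hp : Fact (1 < hlsExp N μ)] [hq1 : Fact (1 < q)]
  {ι : H01 Ω →L[ℝ] Lp ℝ (ENNReal.ofReal q) (volume.restrict Ω)}
  {T : BilinMap (H01 Ω)
    (Lp ℝ (ENNReal.ofReal (hlsExp N μ)) (rieszMeasure μ (volume.restrict Ω)))}

theorem integral_abs_fn_rpow (hι : ∀ u, ι u =ᵐ[volume.restrict Ω] u.fn) (u : H01 Ω) :
    ∫ x in Ω, |u.fn x| ^ q = ‖ι u‖ ^ q := by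
  rw [norm_rpow_eq_integral (by linarith [hq1.out])]
  refine integral_congr_ae ?_
  filter_upwards [hι u] with x hx
  rw [hx]

theorem energy_eq_absEnergy (hι : ∀ u, ι u =ᵐ[volume.restrict Ω] u.fn)
    (hT : ∀ u v, T u v =ᵐ[rieszMeasure μ (volume.restrict Ω)] fun z => u.fn z.1 * v.fn z.2)
    (lam : ℝ) : energy Ω μ lam q = absEnergy (H01.gradL Ω) ι T lam := by
  funext u
  rw [energy, absEnergy, powerFunctional, H01.integral_grad_sq, integral_abs_fn_rpow hι,
    choquard_eq_norm_tensor hT]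

theorem nehariFunctional_eq_absNehari (hι : ∀ u, ι u =ᵐ[volume.restrict Ω] u.fn)
    (hT : ∀ u v, T u v =ᵐ[rieszMeasure μ (volume.restrict Ω)] fun z => u.fn z.1 * v.fn z.2)
    (lam : ℝ) : nehariFunctional Ω μ lam q = absNehari (H01.gradL Ω) ι T lam := by
  funext u
  have h1 := integral_abs_fn_rpow hι u
  have h2 := choquard_eq_norm_tensor hT u
  simp only [nehariFunctional, absNehari, powerFunctional, H01.integral_grad_sq, h1, h2, one_mul]

theorem compactTerms_H01 (hN : 3 ≤ N) (hμ0 : 0 < μ) (hμ : μ < N) (hΩm : MeasurableSet Ω)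
    (hΩb : Bornology.IsBounded Ω) (hq : q < sobolevExp N)
    (hι : ∀ u, ι u =ᵐ[volume.restrict Ω] u.fn)
    (hT : ∀ u v, T u v =ᵐ[rieszMeasure μ (volume.restrict Ω)] fun z => u.fn z.1 * v.fn z.2) :
    CompactTerms ι T where
  embedding w R hR hw := tendsto_embedding hN hΩb hq hι hR (rellich hΩb hR hw)
  tensor w R hR hw u := tendsto_tensor_left hN hμ0 hμ hΩm hΩb hT hR (rellich hΩb hR hw) u
  norm_comm := norm_tensor_comm hT
  ae_subseq x u R hR hw := by
    have h0 : Tendsto (fun n => H01.fnL Ω (x n)) atTop (𝓝 (H01.fnL Ω u)) := by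
      have h := (rellich hΩb hR hw).add_const (H01.fnL Ω u)
      rw [zero_add] at h
      refine h.congr fun n => ?_
      rw [(H01.fnL Ω).map_sub (x n) u, sub_add_cancel]
    obtain ⟨k, hk, hae⟩ := H01.exists_ae_tendsto_subseq h0
    refine ⟨k, hk, ?_⟩
    filter_upwards [ae_rieszMeasure_fst hae, ae_rieszMeasure_snd hae, hT u u,
      ae_all_iff.2 fun n => hT (x (k n)) (x (k n))] with z h1 h2 h3 h4
    rw [h3]
    exact (h1.mul h2).congr fun n => (h4 n).symm

theorem norm_sq_le_norm_gradL_sq (h : 0 < firstEigenvalue Ω) (u : H01 Ω) :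
    ‖u‖ ^ 2 ≤ (1 + (firstEigenvalue Ω)⁻¹) * ‖H01.gradL Ω u‖ ^ 2 := by
  have h1 := mul_le_mul_of_nonneg_left (firstEigenvalue_mul_le u) (inv_nonneg.2 h.le)
  rw [inv_mul_cancel_left₀ h.ne'] at h1
  rw [H01.norm_sq]
  linarith

theorem exists_lt_one_mul_norm_sq_le (hι : ∀ u, ι u =ᵐ[volume.restrict Ω] u.fn) {lam : ℝ}
    (hlam0 : 0 < lam) (hlam1 : lam < firstEigenvalue Ω) (hq2 : q = 2) :
    ∃ θ < 1, ∀ u, lam * ‖ι u‖ ^ q ≤ θ * ‖H01.gradL Ω u‖ ^ 2 := by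
  have h := hlam0.trans hlam1
  refine ⟨lam / firstEigenvalue Ω, (div_lt_one h).2 hlam1, fun u => ?_⟩
  have e : ‖ι u‖ ^ q = ‖H01.fnL Ω u‖ ^ 2 := by
    rw [← integral_abs_fn_rpow hι, ← H01.integral_fn_sq]
    simp only [hq2, Real.rpow_two]
  rw [e, div_mul_eq_mul_div, le_div_iff₀ h, mul_assoc]
  refine mul_le_mul_of_nonneg_left ?_ hlam0.le
  rw [mul_comm]
  exact firstEigenvalue_mul_le u

end ChoquardEnergy

theorem lemma3p1 (N : ℕ) (hN : 3 ≤ N) (μ : ℝ) (hμ0 : 0 < μ) (hμN : μ < (N : ℝ))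
    (Ω : Set (RN N)) (hΩo : IsOpen Ω) (hΩb : Bornology.IsBounded Ω)
    (lam : ℝ) (hlam0 : 0 < lam) (hlam1 : lam < firstEigenvalue Ω)
    (q : ℝ) (hq2 : 2 ≤ q) (hq : q < sobolevExp N) :
    ContDiff ℝ 1 (energy Ω μ lam q) ∧
    ∀ c : ℝ, c < ((N : ℝ) - μ + 2) / (2 * (2 * (N : ℝ) - μ)) *
        SHL N μ ^ ((2 * (N : ℝ) - μ) / ((N : ℝ) - μ + 2)) →
      PalaisSmale (energy Ω μ lam q) c ∧
      ConstrainedPalaisSmale (energy Ω μ lam q) (nehariFunctional Ω μ lam q)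
        (nehari Ω μ lam q) c := by
  have hNR : (3 : ℝ) ≤ N := by exact_mod_cast hN
  have hp : Fact (1 < hlsExp N μ) := ⟨one_lt_hlsExp hN hμN⟩
  have hq1 : Fact (1 < q) := ⟨by linarith⟩
  have hΩm := hΩo.measurableSet
  have hev := hlam0.trans hlam1
  obtain ⟨ι, hι⟩ := H01.exists_embedding hN hΩb hq.le
  obtain ⟨T, hT⟩ := exists_tensor hN hμ0 hμN Ω
  have hcpt := compactTerms_H01 hN hμ0 hμN hΩm hΩb hq hι hT
  have hK0 : 0 ≤ 1 + (firstEigenvalue Ω)⁻¹ := by positivity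
  have hS := SHL_mul_norm_tensor_le hN hμN hΩm hT
  have hθ := exists_lt_one_mul_norm_sq_le hι hlam0 hlam1
  have e1 : ((N : ℝ) - μ + 2) / (2 * (2 * (N : ℝ) - μ)) = 1 / 2 - 1 / (2 * hlsExp N μ) := by
    have h1 : (N : ℝ) - 2 ≠ 0 := by linarith
    have h2 : 2 * (N : ℝ) - μ ≠ 0 := by linarith
    have h3 : 1 / (2 * hlsExp N μ) = ((N : ℝ) - 2) / (2 * (2 * (N : ℝ) - μ)) := by
      rw [hlsExp]
      field_simp
    rw [h3, eq_sub_iff_add_eq, ← add_div, div_eq_iff (mul_ne_zero two_ne_zero h2)]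
    ring
  have e2 : (2 * (N : ℝ) - μ) / ((N : ℝ) - μ + 2) = hlsExp N μ / (hlsExp N μ - 1) := by
    have h1 : (N : ℝ) - 2 ≠ 0 := by linarith
    have h2 : (N : ℝ) - μ + 2 ≠ 0 := by linarith
    have h3 : hlsExp N μ - 1 = ((N : ℝ) - μ + 2) / (N - 2) := by
      rw [hlsExp]
      field_simp
      ring
    rw [h3, hlsExp]
    field_simp
  rw [e1, e2, energy_eq_absEnergy hι hT, nehariFunctional_eq_absNehari hι hT]
  refine ⟨contDiff_powerFunctional _ ι T _ _ _, fun c hc => ⟨?_, ?_⟩⟩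
  · exact palaisSmale_absEnergy hcpt hlam0.le hq2 hθ hK0 (norm_sq_le_norm_gradL_sq hev)
      (SHL_nonneg N μ) hS hc
  · have h := constrainedPalaisSmale_absEnergy hcpt hlam0.le hq2 hθ hK0
      (norm_sq_le_norm_gradL_sq hev) (SHL_nonneg N μ) hS hc
    rwa [← energy_eq_absEnergy hι hT] at h ⊢
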